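/- **Notation.** Fix $m$. Let $M_N(\mathbb{C})_{sa}^m$ be the real inner product space of $m$-tuples $x=(x_1,\dots,x_m)$ of self-adjoint $N\times N$ matrices with $\langle x,y\rangle_{\mathrm{Tr}}=\sum_j \mathrm{Tr}(x_jy_j)$; let $dx$ be Lebesgue measure and $\nabla$ the gradient for this inner product, $\tau_N=\frac1N\mathrm{Tr}$, $\|y\|_2=(\sum_j\tau_N(y_j^*y_j))^{1/2}$, $\|y\|_\infty=\max_j\|y_j\|$ (operator norm), and $DV=N\nabla V$. Scalar-valued trace polynomials ($\mathrm{TrP}_m^0$) are the linear combinations of formal products $\tau(p_1)\cdots\tau(p_n)$ with $p_i$ non-commutative polynomials in $X_1,\dots,X_m$ and $\tau(pq)=\tau(qp)$, and $\mathrm{TrP}_m^1=\mathrm{TrP}_m^0\otimes\mathbb{C}\langle X_1,\dots,X_m\rangle$ are the operator-valued ones; they are evaluated at $x\in M_N(\mathbb{C})_{sa}^m$ with $\tau=\tau_N$. A sequence $\phi_N:M_N(\mathbb{C})_{sa}^m\to M_N(\mathbb{C})^m$ is *asymptotically approximable by trace polynomials* if for all $\epsilon,R>0$ there is $f\in(\mathrm{TrP}_m^1)^m$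 with $\limsup_{N\to\infty}\sup_{\|x\|_\infty\le R}\|\phi_N(x)-f(x)\|_2\le\epsilon$; for $\phi_N:M_N(\mathbb{C})_{sa}^m\to\mathbb{C}$ one uses $f\in\mathrm{TrP}_m^0$ and the absolute value. For $V:M_N(\mathbb{C})_{sa}^m\to\mathbb{R}$ and Lipschitz $u: M_N(\mathbb{C})_{sa}^m\to\mathbb{C}$ let: - $d\mu(x)=Z^{-1}e^{-N^2V(x)}\,dx$ be the associated probability measure; - $P_tu(x)=\int u(x+y)\,d\sigma_{t,N}(y)$, where $d\sigma_{t,N}(y)=Z_{N,t}^{-1}\exp(-N\sum_j\mathrm{Tr}(y_j^2)/2t)\,dy$; - $S_t^Vu(x)=u(W(x,t))$ for $t\ge0$, where $W(x,\cdot)$ solves $\partial_tW(x,t)=-\frac12DV(W(x,t))$ on $[0,\infty)$, $W(x,0)=x$; - $T_t^Vu=\lim_{\ell\to\infty}(P_{2^{-\ell}}S^V_{2^{-\ell}})^{2^\ell t}u$ pointwise for dyadic rationals $t\ge0$, and $T_t^Vu=\lim_{s\to t,\ s\text{ dyadic}}T_s^Vu$ pointwise for general real $t\ge0$ (the Langevin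 semigroup). **Statement.** Let $0<c\le C$ and $K$ be constants. For each $N\ge1$ let $V_N:M_N(\mathbb{C})_{sa}^m\to\mathbb{R}$ be such that $V_N(x)-\frac c2\|x\|_2^2$ is convex and $V_N(x)-\frac C2\|x\|_2^2$ is concave, and let $\mu_N$ be the associated measure. Suppose that $\{DV_N\}$ is asymptotically approximable by trace polynomials. Let $u_N:M_N(\mathbb{C})_{sa}^m\to\mathbb{C}$ be $K$-Lipschitz with respect to $\|\cdot\|_2$ for every $N\ge1$, and suppose that $\{u_N\}$ is asymptotically approximable by (scalar-valued) trace polynomials. Then the objects above are well defined for every $N\ge1$ (the solution $W_N(x,\cdot)$ on $[0,\infty)$ exists and is unique for every $x$, the limits defining $T_t^{V_N}u_N$ exist at every point and for every $t\ge0$, $\mu_N$ is a probability measure and $u_N$ is $\mu_N$-integrable), and 1. $\{S_t^{V_N}u_N\}$ is asymptotically approximable by trace polynomials for each $t\ge0$; 2. $\{T_t^{V_N}u_N\}$ is asymptotically approximable by trace polynomials for each $t\ge0$; 3. $\lim_{N\to\infty}\int u_N\,d\mu_N$ exists (as a finite complex number). -/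

import Mathlib

open MeasureTheory Filter Topology
open scoped ENNReal TensorProduct

noncomputable section

/-! ### Tuples of self-adjoint matrices -/

/-- The space `M_N(ℂ)_sa^m` of `m`-tuples of self-adjoint complex `N × N` matrices. -/
def SATuple (m N : ℕ) : Type := Fin m → selfAdjoint (Matrix (Fin N) (Fin N) ℂ)

namespace SATuple

variable {m N : ℕ}

instance : AddCommGroup (SATuple m N) :=
  inferInstanceAs (AddCommGroup (Fin m → selfAdjoint (Matrix (Fin N) (Fin N) ℂ)))

instance : Module ℝ (SATuple m N) :=
  inferInstanceAs (Module ℝ (Fin m → selfAdjoint (Matrix (Fin N) (Fin N) ℂ)))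

/-- The underlying tuple of matrices. -/
def mat (x : SATuple m N) : Fin m → Matrix (Fin N) (Fin N) ℂ := fun j => (x j).1

theorem mat_add (x y : SATuple m N) : (x + y).mat = x.mat + y.mat := rfl

theorem mat_smul (r : ℝ) (x : SATuple m N) : (r • x).mat = r • x.mat := rfl

theorem mat_conjTranspose (x : SATuple m N) (j : Fin m) : (x.mat j).conjTranspose = x.mat j :=
  (x j).2

theorem mat_injective : Function.Injective (mat : SATuple m N → _) := by
  intro x y h
  funext j
  exact Subtype.ext (congrFun h j)

/-- The unnormalized inner product `⟨x, y⟩_Tr = ∑_j Tr (x_j y_j)` (a real number, as the `x_j` and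
`y_j` are self-adjoint; taking the real part only changes its type). -/
def trInner (x y : SATuple m N) : ℝ := ∑ j, (Matrix.trace (x.mat j * y.mat j)).re

theorem trace_mul_self_re (x : SATuple m N) (j : Fin m) :
    (Matrix.trace (x.mat j * x.mat j)).re = ∑ k, ∑ l, Complex.normSq (x.mat j l k) := by
  have h : Matrix.trace (x.mat j * x.mat j) =
      Matrix.trace ((x.mat j).conjTranspose * x.mat j) := by
    rw [mat_conjTranspose]
  rw [h]
  simp only [Matrix.trace, Matrix.diag_apply, Matrix.mul_apply, Matrix.conjTranspose_apply,
    Complex.re_sum]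
  refine Finset.sum_congr rfl fun k _ => Finset.sum_congr rfl fun l _ => ?_
  rw [Complex.star_def, ← Complex.normSq_eq_conj_mul_self, Complex.ofReal_re]

theorem trInner_self_nonneg (x : SATuple m N) : 0 ≤ trInner x x := by
  refine Finset.sum_nonneg fun j _ => ?_
  rw [trace_mul_self_re]
  exact Finset.sum_nonneg fun k _ => Finset.sum_nonneg fun l _ => Complex.normSq_nonneg _

theorem eq_zero_of_trInner_self (x : SATuple m N) (h : trInner x x = 0) : x = 0 := by
  apply mat_injective
  have h1 := (Finset.sum_eq_zero_iff_of_nonneg (fun j _ => by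
    rw [trace_mul_self_re]
    exact Finset.sum_nonneg fun k _ =>
      Finset.sum_nonneg fun l _ => Complex.normSq_nonneg _)).1 h
  funext j
  have h2 := h1 j (Finset.mem_univ j)
  rw [trace_mul_self_re] at h2
  ext l k
  have h3 := (Finset.sum_eq_zero_iff_of_nonneg (fun k _ =>
    Finset.sum_nonneg fun l _ => Complex.normSq_nonneg _)).1 h2 k (Finset.mem_univ k)
  have h4 := (Finset.sum_eq_zero_iff_of_nonneg
    (fun l _ => Complex.normSq_nonneg _)).1 h3 l (Finset.mem_univ l)
  exact Complex.normSq_eq_zero.1 h4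

/-- `M_N(ℂ)_sa^m` as a real inner product space with the inner product `⟨·,·⟩_Tr`. -/
@[reducible] def innerCore : InnerProductSpace.Core ℝ (SATuple m N) where
  inner := trInner
  conj_inner_symm x y := by
    simp only [trInner, conj_trivial]
    exact Finset.sum_congr rfl fun j _ => by rw [Matrix.trace_mul_comm]
  re_inner_nonneg x := trInner_self_nonneg x
  add_left x y z := by
    simp only [trInner, mat_add, Pi.add_apply, Matrix.add_mul, Matrix.trace_add, Complex.add_re,
      Finset.sum_add_distrib]
  smul_left x y r := by
    simp only [trInner, mat_smul, Pi.smul_apply, Matrix.smul_mul, Matrix.trace_smul,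
      Complex.smul_re, smul_eq_mul, Finset.mul_sum, conj_trivial]
  definite x h := eq_zero_of_trInner_self x h

instance : NormedAddCommGroup (SATuple m N) :=
  InnerProductSpace.Core.toNormedAddCommGroup (𝕜 := ℝ) (cd := innerCore)

instance : InnerProductSpace ℝ (SATuple m N) := InnerProductSpace.ofCore innerCore.toCore

instance : FiniteDimensional ℝ (SATuple m N) :=
  Module.Finite.of_injective
    ({ toFun := mat, map_add' := mat_add, map_smul' := mat_smul } :
      SATuple m N →ₗ[ℝ] (Fin m → Matrix (Fin N) (Fin N) ℂ)) mat_injective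

/-- The Borel σ-algebra. The measure `volume` is then the Lebesgue measure of the inner product
`⟨·,·⟩_Tr`, that is, Lebesgue measure in the coordinates of any orthonormal basis. -/
instance : MeasurableSpace (SATuple m N) := borel _

instance : BorelSpace (SATuple m N) := ⟨rfl⟩

end SATuple

/-- The normalized trace `τ_N = (1/N) Tr`, as a linear map on matrices. -/
def normTrace (N : ℕ) : Matrix (Fin N) (Fin N) ℂ →ₗ[ℂ] ℂ :=
  (N : ℂ)⁻¹ • Matrix.traceLinearMap (Fin N) ℂ ℂ

/-- The normalized 2-norm `‖y‖₂ = (∑_j τ_N (y_j^* y_j))^{1/2}` of a tuple of matrices. -/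
def norm2 {m N : ℕ} (y : Fin m → Matrix (Fin N) (Fin N) ℂ) : ℝ :=
  Real.sqrt (∑ j, (normTrace N ((y j).conjTranspose * y j)).re)

/-- `‖y‖_∞`, the maximum of the operator norms of the `y_j`. -/
def normInf {m N : ℕ} (y : Fin m → Matrix (Fin N) (Fin N) ℂ) : ℝ :=
  ⨆ j, ‖Matrix.toEuclideanCLM (n := Fin N) (𝕜 := ℂ) (y j)‖

/-- The normalized gradient `D V = N ∇ V`, with `∇` the gradient for `⟨·,·⟩_Tr`. -/
def normGrad {m N : ℕ} (V : SATuple m N → ℝ) (x : SATuple m N) : SATuple m N :=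
  (N : ℝ) • gradient V x

/-- The class `𝓔_{m,N}(c, C)`: `u - (c/2) ‖x‖₂²` is convex and `u - (C/2) ‖x‖₂²` is concave. -/
def MemE {m N : ℕ} (c C : ℝ) (u : SATuple m N → ℝ) : Prop :=
  ConvexOn ℝ Set.univ (fun x => u x - c / 2 * norm2 x.mat ^ 2) ∧
    ConcaveOn ℝ Set.univ (fun x => u x - C / 2 * norm2 x.mat ^ 2)

/-! ### Trace polynomials -/

/-- Non-commutative polynomials in `X_1, …, X_m`. -/
abbrev NCPoly (m : ℕ) : Type := FreeAlgebra ℂ (Fin m)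

/-- The linear span of the commutators `p q - q p`. -/
def commutatorSpan (m : ℕ) : Submodule ℂ (NCPoly m) :=
  Submodule.span ℂ {a | ∃ p q : NCPoly m, a = p * q - q * p}

/-- Scalar-valued trace polynomials: the symmetric algebra over the quotient of the space of
non-commutative polynomials by the span of the commutators; the class of `p` in the quotient is the
symbol `τ(p)`. -/
abbrev TrP0 (m : ℕ) : Type := SymmetricAlgebra ℂ (NCPoly m ⧸ commutatorSpan m)

/-- Operator-valued trace polynomials. -/
abbrev TrP1 (m : ℕ) : Type := TrP0 m ⊗[ℂ] NCPoly m

section Eval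

variable {m N : ℕ}

/-- Evaluation of non-commutative polynomials, `p ↦ p(x)`. -/
def evalNC (x : SATuple m N) : NCPoly m →ₐ[ℂ] Matrix (Fin N) (Fin N) ℂ :=
  FreeAlgebra.lift ℂ x.mat

/-- The map `τ(p) ↦ τ_N (p(x))`. -/
def evalTau (x : SATuple m N) : (NCPoly m ⧸ commutatorSpan m) →ₗ[ℂ] ℂ :=
  (commutatorSpan m).liftQ (normTrace N ∘ₗ (evalNC x).toLinearMap) (by
    rw [commutatorSpan, Submodule.span_le]
    rintro _ ⟨p, q, rfl⟩
    simp [normTrace, Matrix.trace_mul_comm (evalNC x p) (evalNC x q)])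

/-- Evaluation `f ↦ f(x)` of scalar-valued trace polynomials, with `τ = τ_N`. -/
def eval0 (x : SATuple m N) : TrP0 m →ₐ[ℂ] ℂ := SymmetricAlgebra.lift (evalTau x)

/-- Evaluation `f ↦ f(x)` of operator-valued trace polynomials, with `τ = τ_N`. -/
def eval1 (x : SATuple m N) : TrP1 m →ₐ[ℂ] Matrix (Fin N) (Fin N) ℂ :=
  Algebra.TensorProduct.lift
    ((Algebra.ofId ℂ (Matrix (Fin N) (Fin N) ℂ)).comp (eval0 x)) (evalNC x)
    (fun f p => Algebra.commutes (eval0 x f) (evalNC x p))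

end Eval

/-! ### Asymptotic approximation by trace polynomials

The suprema and upper limits are taken in `[0, ∞]`, so that they are never junk values. -/

/-- Asymptotic approximability by (`m`-tuples of operator-valued) trace polynomials of a sequence of
functions `φ_N : M_N(ℂ)_sa^m → M_N(ℂ)^m`. -/
def AsympApproxOp {m : ℕ} (φ : ∀ N, SATuple m N → Fin m → Matrix (Fin N) (Fin N) ℂ) : Prop :=
  ∀ ε > (0 : ℝ), ∀ R > (0 : ℝ), ∃ f : Fin m → TrP1 m,
    limsup (fun N => ⨆ x : SATuple m N, ⨆ _ : normInf x.mat ≤ R,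
      ENNReal.ofReal (norm2 (fun j => φ N x j - eval1 x (f j)))) atTop ≤ ENNReal.ofReal ε

/-- Asymptotic approximability by (scalar-valued) trace polynomials of a sequence of functions
`φ_N : M_N(ℂ)_sa^m → ℂ`. -/
def AsympApproxScalar {m : ℕ} (φ : ∀ N, SATuple m N → ℂ) : Prop :=
  ∀ ε > (0 : ℝ), ∀ R > (0 : ℝ), ∃ f : TrP0 m,
    limsup (fun N => ⨆ x : SATuple m N, ⨆ _ : normInf x.mat ≤ R,
      ENNReal.ofReal ‖φ N x - eval0 x f‖) atTop ≤ ENNReal.ofReal ε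

/-! ### Gibbs measures and the semigroups -/

section Semigroups

variable {m N : ℕ}

/-- The probability measure `dμ(x) = Z⁻¹ exp (-N² V(x)) dx`. -/
def gibbs (V : SATuple m N → ℝ) : Measure (SATuple m N) :=
  (volume : Measure (SATuple m N)).tilted (fun x => -((N : ℝ) ^ 2 * V x))

/-- The law `σ_{t,N}` of `m` independent GUE matrices of normalized variance `t > 0`:
`dσ_{t,N}(x) = Z⁻¹ exp (-N ∑_j Tr (x_j²) / 2t) dx`. -/
def gue (m N : ℕ) (t : ℝ) : Measure (SATuple m N) :=
  (volume : Measure (SATuple m N)).tilted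
    (fun x => -((N : ℝ) * (∑ j, (Matrix.trace (x.mat j * x.mat j)).re) / (2 * t)))

/-- The heat semigroup `P_t u (x) = ∫ u (x + y) dσ_{t,N}(y)`, for `t > 0`. -/
def heatSemigroup (t : ℝ) (u : SATuple m N → ℂ) (x : SATuple m N) : ℂ :=
  ∫ y, u (x + y) ∂(gue m N t)

/-- `w` solves `∂_t w = -(1/2) DV(w)` on `[0, ∞)` with `w(0) = x`. -/
def IsGradFlow (V : SATuple m N → ℝ) (x : SATuple m N) (w : ℝ → SATuple m N) : Prop :=
  w 0 = x ∧
    ∀ t ≥ (0 : ℝ), HasDerivWithinAt w (-((1 / 2 : ℝ) • normGrad V (w t))) (Set.Ici 0) t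

/-- The solution `t ↦ W(x, t)` of `∂_t W = -(1/2) DV(W)`, `W(x, 0) = x`. -/
def gradFlow (V : SATuple m N → ℝ) (x : SATuple m N) : ℝ → SATuple m N :=
  Classical.epsilon (IsGradFlow V x)

/-- The deterministic semigroup `S_t u (x) = u (W(x, t))`. -/
def detSemigroup (V : SATuple m N → ℝ) (t : ℝ) (u : SATuple m N → ℂ) (x : SATuple m N) : ℂ :=
  u (gradFlow V x t)

/-- `(P_{2^{-ℓ}} S_{2^{-ℓ}})^n u`. -/
def trotter (V : SATuple m N → ℝ) (l n : ℕ) (u : SATuple m N → ℂ) : SATuple m N → ℂ :=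
  (fun v => heatSemigroup ((2 : ℝ) ^ l)⁻¹ (detSemigroup V ((2 : ℝ) ^ l)⁻¹ v))^[n] u

/-- `T_{t,ℓ} u = (P_{2^{-ℓ}} S_{2^{-ℓ}})^{2^ℓ t} u` for `t ∈ 2^{-ℓ} ℕ`. A dyadic `t` belongs to
`2^{-ℓ} ℕ` for all large `ℓ`, and the rounding down in `⌊2^ℓ t⌋` then has no effect. -/
def langevinApprox (V : SATuple m N → ℝ) (l : ℕ) (t : ℝ) (u : SATuple m N → ℂ) :
    SATuple m N → ℂ :=
  trotter V l ⌊(2 : ℝ) ^ l * t⌋₊ u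

/-- `T_t u = lim_{ℓ → ∞} T_{t,ℓ} u` for dyadic `t ≥ 0`. -/
def langevinDyadic (V : SATuple m N → ℝ) (t : ℝ) (u : SATuple m N → ℂ) (x : SATuple m N) : ℂ :=
  limUnder atTop (fun l : ℕ => langevinApprox V l t u x)

/-- The non-negative dyadic rationals. -/
def dyadics : Set ℝ := {t | ∃ k l : ℕ, t = (k : ℝ) / 2 ^ l}

/-- The Langevin semigroup `T_t u`, `t ≥ 0`: the continuous extension to all `t ≥ 0` of its values
at dyadic times (for dyadic `t` the filter `𝓝[dyadics] t` charges `t` itself, so that the limit,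
when it exists, is the value at `t`). -/
def langevin (V : SATuple m N → ℝ) (t : ℝ) (u : SATuple m N → ℂ) (x : SATuple m N) : ℂ :=
  limUnder (𝓝[dyadics] t) (fun s => langevinDyadic V s u x)

end Semigroups

end

noncomputable section

set_option linter.unusedSectionVars false

/-! ### Quadratic bounds and gradients of semiconvex potentials -/

section ConvexPotential

variable {E : Type*} [NormedAddCommGroup E] [InnerProductSpace ℝ E] [FiniteDimensional ℝ E]

/-! Every estimate is made uniform in N by the normalisation. Since ‖x‖₂² = ‖x‖²/N, the convexity
and concavity assumptions make DV = N∇V strongly monotone with constant c and Lipschitz with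
constant C, whatever N is (`UnifConvex`). Hence the flow exists, is unique, and contracts distances
by e^{-ct/2}.

Approximability is stable under limits that are uniform on operator-norm balls, and under
composition of a Lipschitz approximable map with an approximable one (`AsympApproxScalar.comp`,
`AsympApproxOp.comp`). An Euler step is approximable because DV is, and the flow is a uniform limit
of iterated Euler steps (`asympApproxOp_gradFlow`); this gives claim 1.

For the heat semigroup, the Schwinger–Dyson equation (`integral_traceProd_cons`) expresses a GUE
average of a product of traces through averages with fewer Gaussian letters, the only dependence on
N being a factor 1/N². So P_t sends a trace polynomial to a trace polynomial up to an error that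
vanishes as N → ∞ (`tendstoTrP0_heatSemigroup`). An exponential tail bound for the operator norm
(`exists_radius_norm_integral_gue_le`) extends this to Lipschitz approximable functions.

For claim 2, P_h and S_h commute up to order h^{3/2} on Lipschitz functions
(`norm_heat_det_sub_det_heat_le`). Halving the step therefore changes the scheme at a fixed time by
O(√h), which is summable over dyadic steps. Regularity in time follows from propagating quadratic
majorants (`norm_trotterStep_iterate_sub_self_le`). The rates do not depend on N, and depend on x at
most through ‖DV(x)‖₂, so T_t is again a uniform limit on balls.

For claim 3, invariance of μ_N is proved without generators or stochastic calculus. If X has law μ_N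
and G is an independent Gaussian of variance h, the conditional law of X given y = X + G is nearly
Gaussian around the proximal point p(y) (`norm_integral_proximal_step_sub_le`), and p is the flow
for time 2h up to O(h²). Thus P_h S_{2h} P_h preserves μ_N up to O(h^{3/2}), and its iterates are
those of the splitting scheme up to one factor P_h at each end. In the limit μ_N is invariant under
T_t (`integral_langevinDyadic`). Since T_t shrinks Lipschitz constants by e^{-ct/2}, T_t u_N(0) is
close to ∫ u_N dμ_N, uniformly in N once first moments are bounded. It is also close to f(0) for a
single trace polynomial f, and f(0) does not depend on N. So the expectations form a Cauchy
sequence. -/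

theorem ConvexOn.exists_subgradient {g : E → ℝ} (hg : ConvexOn ℝ Set.univ g) (x : E) :
    ∃ p : E, ∀ y, g x + inner ℝ p (y - x) ≤ g y := by
  have hcont : Continuous g := hg.locallyLipschitz.continuous
  have hopen : IsOpen {q : E × ℝ | q.1 ∈ Set.univ ∧ g q.1 < q.2} := by
    simpa using isOpen_lt (hcont.comp continuous_fst) continuous_snd
  obtain ⟨f, hf⟩ := geometric_hahn_banach_open_point hg.convex_strict_epigraph hopen
    (x := (x, g x)) (by simp)
  have hf' : ∀ (y : E) (r : ℝ), f (y, r) = f (y, 0) + r * f (0, 1) := by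
    intro y r
    have : ((y, r) : E × ℝ) = (y, 0) + r • (0, 1) := by simp
    rw [this, map_add, map_smul, smul_eq_mul]
  -- The vertical slope of the functional separating the point from the strict epigraph. It is
  -- negative because the epigraph extends upwards over x, so dividing by it turns the hyperplane
  -- into the graph of an affine minorant.
  set α := f (0, 1) with hα
  have hneg : α < 0 := by
    have := hf (x, g x + 1) (by simp)
    rw [hf' x (g x + 1), hf' x (g x)] at this
    linarith
  have hle : ∀ y, f (y, 0) + g y * α ≤ f (x, 0) + g x * α := by
    intro y
    refine le_of_forall_pos_lt_add fun ε hε => ?_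
    have := hf (y, g y + ε / (-α)) (by simpa using div_pos hε (neg_pos.2 hneg))
    rw [hf' y _, hf' x (g x)] at this
    have h2 : ε / (-α) * α = -ε := by
      have := hneg.ne
      field_simp
    nlinarith
  let L : E →L[ℝ] ℝ := (-α)⁻¹ • (f.comp (ContinuousLinearMap.inl ℝ E ℝ))
  refine ⟨(InnerProductSpace.toDual ℝ E).symm L, fun y => ?_⟩
  rw [InnerProductSpace.toDual_symm_apply]
  have h3 : L (y - x) = (-α)⁻¹ * (f (y, 0) - f (x, 0)) := by
    have : ((y - x, 0) : E × ℝ) = (y, 0) - (x, 0) := by simp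
    change (-α)⁻¹ * f (y - x, 0) = _
    rw [this, map_sub]
  rw [h3]
  have h4 := hle y
  have h5 : (-α)⁻¹ * (f (y, 0) - f (x, 0)) ≤ (-α)⁻¹ * ((g y - g x) * (-α)) := by
    apply mul_le_mul_of_nonneg_left _ (inv_nonneg.2 (neg_pos.2 hneg).le)
    nlinarith
  have h6 : (-α)⁻¹ * ((g y - g x) * (-α)) = g y - g x := by
    have := hneg.ne
    field_simp
  linarith

theorem half_mul_norm_sq_expand (a : ℝ) (x y : E) :
    a / 2 * ‖y‖ ^ 2 = a / 2 * ‖x‖ ^ 2 + inner ℝ (a • x) (y - x) + a / 2 * ‖y - x‖ ^ 2 := by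
  have : ‖y‖ ^ 2 = ‖x‖ ^ 2 + 2 * inner ℝ x (y - x) + ‖y - x‖ ^ 2 := by
    rw [← norm_add_sq_real]; simp
  rw [this, real_inner_smul_left]
  ring

theorem exists_lower_quadratic {V : E → ℝ} {a : ℝ}
    (h : ConvexOn ℝ Set.univ (fun x => V x - a / 2 * ‖x‖ ^ 2)) (x : E) :
    ∃ p : E, ∀ y, V x + inner ℝ p (y - x) + a / 2 * ‖y - x‖ ^ 2 ≤ V y := by
  obtain ⟨p, hp⟩ := h.exists_subgradient x
  refine ⟨p + a • x, fun y => ?_⟩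
  have := hp y
  rw [inner_add_left]
  linarith [half_mul_norm_sq_expand a x y]

theorem exists_upper_quadratic {V : E → ℝ} {b : ℝ}
    (h : ConcaveOn ℝ Set.univ (fun x => V x - b / 2 * ‖x‖ ^ 2)) (x : E) :
    ∃ p : E, ∀ y, V y ≤ V x + inner ℝ p (y - x) + b / 2 * ‖y - x‖ ^ 2 := by
  have h' : ConvexOn ℝ Set.univ (fun x => -V x - (-b) / 2 * ‖x‖ ^ 2) := by
    refine h.neg.congr fun x _ => ?_
    simp only [Pi.neg_apply]
    ring
  obtain ⟨p, hp⟩ := exists_lower_quadratic h' x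
  refine ⟨-p, fun y => ?_⟩
  have := hp y
  rw [inner_neg_left]
  linarith

/-- `V` is differentiable with gradient `G`, and is squeezed between its quadratic expansions of
curvature `a` and `b`. -/
structure QuadraticBounds (V : E → ℝ) (G : E → E) (a b : ℝ) : Prop where
  hasGradientAt : ∀ x, HasGradientAt V (G x) x
  lower : ∀ x y, V x + inner ℝ (G x) (y - x) + a / 2 * ‖y - x‖ ^ 2 ≤ V y
  upper : ∀ x y, V y ≤ V x + inner ℝ (G x) (y - x) + b / 2 * ‖y - x‖ ^ 2

theorem quadraticBounds_of_convexOn_of_concaveOn {V : E → ℝ} {a b : ℝ}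
    (h₁ : ConvexOn ℝ Set.univ (fun x => V x - a / 2 * ‖x‖ ^ 2))
    (h₂ : ConcaveOn ℝ Set.univ (fun x => V x - b / 2 * ‖x‖ ^ 2)) :
    QuadraticBounds V (gradient V) a b := by
  have key : ∀ x, ∃ p : E, (∀ y, V x + inner ℝ p (y - x) + a / 2 * ‖y - x‖ ^ 2 ≤ V y) ∧
      (∀ y, V y ≤ V x + inner ℝ p (y - x) + b / 2 * ‖y - x‖ ^ 2) := by
    intro x
    obtain ⟨p, hp⟩ := exists_lower_quadratic h₁ x
    obtain ⟨q, hq⟩ := exists_upper_quadratic h₂ x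
    -- Both quadratic bounds touch V at x. Tested along x + t(p - q), they give ‖p - q‖² = O(t), and
    -- t → 0 identifies the slopes.
    have hpq : p = q := by
      have h3 : ∀ t > (0 : ℝ), ‖p - q‖ ^ 2 ≤ t * ((b - a) / 2 * ‖p - q‖ ^ 2) := by
        intro t ht
        have e1 := hp (x + t • (p - q))
        have e2 := hq (x + t • (p - q))
        have e3 : inner ℝ p (t • (p - q)) - inner ℝ q (t • (p - q)) = t * ‖p - q‖ ^ 2 := by
          rw [← inner_sub_left, real_inner_smul_right, real_inner_self_eq_norm_sq]
        simp only [add_sub_cancel_left, norm_smul, Real.norm_eq_abs, mul_pow, sq_abs] at e1 e2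
        have e4 : t * ‖p - q‖ ^ 2 ≤ t * (t * ((b - a) / 2 * ‖p - q‖ ^ 2)) := by nlinarith
        exact le_of_mul_le_mul_left e4 ht
      have h4 : ‖p - q‖ ^ 2 ≤ 0 := by
        refine le_of_forall_pos_le_add fun ε hε => ?_
        set D := (b - a) / 2 * ‖p - q‖ ^ 2
        have := h3 (ε / (|D| + 1)) (by positivity)
        refine this.trans ?_
        rw [zero_add, div_mul_eq_mul_div, div_le_iff₀ (by positivity)]
        have := le_abs_self D
        nlinarith
      have h5 : ‖p - q‖ = 0 := by
        have := sq_nonneg ‖p - q‖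
        exact pow_eq_zero_iff two_ne_zero |>.1 (le_antisymm h4 this)
      exact sub_eq_zero.1 (norm_eq_zero.1 h5)
    subst hpq
    exact ⟨p, hp, hq⟩
  have hgrad : ∀ x p, (∀ y, V x + inner ℝ p (y - x) + a / 2 * ‖y - x‖ ^ 2 ≤ V y) →
      (∀ y, V y ≤ V x + inner ℝ p (y - x) + b / 2 * ‖y - x‖ ^ 2) → HasGradientAt V p x := by
    intro x p hp hq
    rw [hasGradientAt_iff_isLittleO]
    -- The squeeze leaves a remainder of second order, so V is differentiable although no smoothness
    -- was assumed.
    have hO : (fun y => V y - V x - inner ℝ p (y - x)) =O[𝓝 x] fun y => ‖y - x‖ ^ 2 := by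
      refine Asymptotics.IsBigO.of_bound ((|a| + |b|) / 2) (Eventually.of_forall fun y => ?_)
      have e1 := hp y
      have e2 := hq y
      have e3 := sq_nonneg ‖y - x‖
      rw [Real.norm_eq_abs, Real.norm_eq_abs, abs_of_nonneg e3, abs_le]
      constructor
      · nlinarith [neg_abs_le a, abs_nonneg b]
      · nlinarith [le_abs_self b, abs_nonneg a]
    refine hO.trans_isLittleO ?_
    have h6 : (fun y : E => ‖y - x‖ ^ 2) =o[𝓝 x] fun y => ‖y - x‖ ^ 1 := by
      have hs : Tendsto (fun y : E => y - x) (𝓝 x) (𝓝 0) := by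
        have : Tendsto (fun y : E => y - x) (𝓝 x) (𝓝 (x - x)) :=
          (continuous_id.sub continuous_const).tendsto x
        simpa using this
      exact (Asymptotics.isLittleO_norm_pow_norm_pow (by norm_num)).comp_tendsto hs
    simp only [pow_one] at h6
    exact h6.norm_right.of_norm_right.trans_isBigO (Asymptotics.isBigO_norm_left.2
      (Asymptotics.isBigO_refl _ _))
  have hk : ∀ x, (∀ y, V x + inner ℝ (gradient V x) (y - x) + a / 2 * ‖y - x‖ ^ 2 ≤ V y) ∧
      (∀ y, V y ≤ V x + inner ℝ (gradient V x) (y - x) + b / 2 * ‖y - x‖ ^ 2) := by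
    intro x
    obtain ⟨p, hp, hq⟩ := key x
    rw [(hgrad x p hp hq).gradient]
    exact ⟨hp, hq⟩
  exact ⟨fun x => hgrad x _ (hk x).1 (hk x).2, fun x => (hk x).1, fun x => (hk x).2⟩

namespace QuadraticBounds

variable {V : E → ℝ} {G : E → E} {a b : ℝ}

theorem strongly_monotone (h : QuadraticBounds V G a b) (x y : E) :
    a * ‖x - y‖ ^ 2 ≤ inner ℝ (G x - G y) (x - y) := by
  have h1 := h.lower x y
  have h2 := h.lower y x
  have h3 : inner ℝ (G x) (y - x) = - inner ℝ (G x) (x - y) := by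
    rw [← inner_neg_right, neg_sub]
  rw [inner_sub_left]
  rw [h3, norm_sub_rev y x] at h1
  linarith

/-- A descent argument without second derivatives: z is the gradient step of length 1/b from x for
the function V - ⟨G y, ·⟩. Adding the lower bound from y to z and the upper bounds from x to z and
from y to x leaves ‖G x - G y‖²/(2b) ≤ b‖x - y‖²/2. -/
theorem norm_sub_le (h : QuadraticBounds V G a b) (ha : 0 ≤ a) (hb : 0 < b) (x y : E) :
    ‖G x - G y‖ ≤ b * ‖x - y‖ := by
  set z := x - b⁻¹ • (G x - G y) with hz
  have h1 := h.lower y z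
  have h2 := h.upper x z
  have h3 := h.upper y x
  have hzx : z - x = -(b⁻¹ • (G x - G y)) := by rw [hz]; abel
  have hzy : z - y = (x - y) + (z - x) := by abel
  have e1 : inner ℝ (G x) (z - x) - inner ℝ (G y) (z - x) = -(b⁻¹ * ‖G x - G y‖ ^ 2) := by
    rw [← inner_sub_left, hzx, inner_neg_right, real_inner_smul_right,
      real_inner_self_eq_norm_sq]
  have e2 : ‖z - x‖ ^ 2 = b⁻¹ ^ 2 * ‖G x - G y‖ ^ 2 := by
    rw [hzx, norm_neg, norm_smul, mul_pow, Real.norm_eq_abs, sq_abs]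
  have e4 : b / 2 * ‖z - x‖ ^ 2 = b⁻¹ / 2 * ‖G x - G y‖ ^ 2 := by
    rw [e2]; field_simp
  have e5 : 0 ≤ a / 2 * ‖z - y‖ ^ 2 := by positivity
  rw [hzy, inner_add_right, ← hzy] at h1
  have e6 : b⁻¹ / 2 * ‖G x - G y‖ ^ 2 ≤ b / 2 * ‖x - y‖ ^ 2 := by linarith
  have e7 : ‖G x - G y‖ ^ 2 ≤ (b * ‖x - y‖) ^ 2 := by
    have := mul_le_mul_of_nonneg_left e6 (by positivity : (0 : ℝ) ≤ 2 * b)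
    have t1 : 2 * b * (b⁻¹ / 2 * ‖G x - G y‖ ^ 2) = ‖G x - G y‖ ^ 2 := by field_simp
    have t2 : 2 * b * (b / 2 * ‖x - y‖ ^ 2) = (b * ‖x - y‖) ^ 2 := by ring
    linarith
  exact abs_le_of_sq_le_sq' e7 (by positivity) |>.2

end QuadraticBounds

end ConvexPotential

/-! ### Global solutions for Lipschitz vector fields -/

section GlobalExistence

variable {E : Type*} [NormedAddCommGroup E] [NormedSpace ℝ E] [CompleteSpace E]

/-- The existence time depends on K only: on the ball of radius ‖f x‖ + 1 the speed is at most ‖f x‖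
+ K(‖f x‖ + 1), so a path cannot leave it before time 1/(2(K + 1)). Independence of x is what allows
gluing. -/
theorem LipschitzWith.exists_solution_Icc {f : E → E} {K : NNReal} (hf : LipschitzWith K f)
    (x : E) : ∃ w : ℝ → E, w 0 = x ∧ ∀ t ∈ Set.Icc (0 : ℝ) (2 * ((K : ℝ) + 1))⁻¹,
      HasDerivWithinAt w (f (w t)) (Set.Icc 0 (2 * ((K : ℝ) + 1))⁻¹) t := by
  have hσ : (0 : ℝ) ≤ (2 * ((K : ℝ) + 1))⁻¹ := by positivity
  have hp : IsPicardLindelof (fun _ => f) (⟨0, le_rfl, hσ⟩ : Set.Icc (0 : ℝ) (2 * ((K : ℝ) + 1))⁻¹) x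
      (‖f x‖₊ + 1) 0 (‖f x‖₊ + K * (‖f x‖₊ + 1)) K := by
    refine IsPicardLindelof.of_time_independent (fun y hy => ?_) (hf.lipschitzOnWith) ?_
    · have h1 : ‖f y - f x‖ ≤ K * ‖y - x‖ := hf.norm_sub_le y x
      have h2 : ‖y - x‖ ≤ ‖f x‖ + 1 := by simpa [dist_eq_norm] using hy
      have h3 : ‖f y‖ ≤ ‖f x‖ + ‖f y - f x‖ := by
        simpa using norm_add_le (f x) (f y - f x)
      have h4 : (K : ℝ) * ‖y - x‖ ≤ K * (‖f x‖ + 1) := by gcongr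
      push_cast
      linarith
    · simp only [sub_zero, NNReal.coe_add, NNReal.coe_mul, coe_nnnorm, NNReal.coe_one,
        NNReal.coe_zero, sub_self, max_eq_left hσ]
      rw [← div_eq_mul_inv, div_le_iff₀ (by positivity)]
      have := norm_nonneg (f x)
      have := K.coe_nonneg
      nlinarith [mul_nonneg K.coe_nonneg (norm_nonneg (f x))]
  exact hp.exists_eq_forall_mem_Icc_hasDerivWithinAt₀

/-- A globally Lipschitz autonomous vector field has a solution on `[0, ∞)` from every point. -/
theorem LipschitzWith.exists_solution_Ici {f : E → E} {K : NNReal} (hf : LipschitzWith K f)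
    (x : E) : ∃ w : ℝ → E, w 0 = x ∧
      ∀ t ≥ (0 : ℝ), HasDerivWithinAt w (f (w t)) (Set.Ici 0) t := by
  choose α hα0 hα using hf.exists_solution_Icc
  set σ : ℝ := (2 * ((K : ℝ) + 1))⁻¹ with hσdef
  have hσ : 0 < σ := by positivity
  let X : ℕ → E := fun n => Nat.rec x (fun _ y => α y σ) n
  have hX : ∀ n, X (n + 1) = α (X n) σ := fun _ => rfl
  let w : ℝ → E := fun t => α (X ⌊t / σ⌋₊) (t - ⌊t / σ⌋₊ * σ)
  have hw : ∀ n : ℕ, ∀ t, n * σ ≤ t → t < (n + 1) * σ → w t = α (X n) (t - n * σ) := by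
    intro n t h1 h2
    have : ⌊t / σ⌋₊ = n := by
      rw [Nat.floor_eq_iff (div_nonneg (le_trans (by positivity) h1) hσ.le)]
      exact ⟨(le_div_iff₀ hσ).2 h1, (div_lt_iff₀ hσ).2 h2⟩
    simp only [w, this]
  -- The formula of the n-th piece persists at its right endpoint, where the floor has already
  -- jumped to n + 1.
  have hw' : ∀ n : ℕ, ∀ t, n * σ ≤ t → t ≤ (n + 1) * σ → w t = α (X n) (t - n * σ) := by
    intro n t h1 h2
    rcases h2.lt_or_eq with h | h
    · exact hw n t h1 h
    · rw [hw (n + 1) t (by push_cast; exact h.ge) (by push_cast; nlinarith), h, hX]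
      push_cast
      rw [sub_self, hα0]
      congr 1
      ring
  have hd : ∀ n : ℕ, ∀ t ∈ Set.Icc (n * σ) ((n + 1) * σ),
      HasDerivWithinAt w (f (w t)) (Set.Icc (n * σ) ((n + 1) * σ)) t := by
    intro n t ht
    have h1 : HasDerivWithinAt (fun s => α (X n) (s - n * σ)) (f (α (X n) (t - n * σ)))
        (Set.Icc (n * σ) ((n + 1) * σ)) t := by
      have h2 := hα (X n) (t - n * σ) ⟨by linarith [ht.1], by nlinarith [ht.2]⟩
      have h3 := h2.scomp t (h := fun s => s - n * σ) (t' := Set.Icc (0 : ℝ) σ)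
        (s := Set.Icc (n * σ) ((n + 1) * σ)) (h' := 1)
        ((hasDerivWithinAt_id t _).sub_const _)
        (fun s hs => ⟨by linarith [hs.1], by nlinarith [hs.2]⟩)
      simpa [Function.comp_def] using h3
    rw [hw' n t ht.1 ht.2]
    exact h1.congr (fun s hs => hw' n s hs.1 hs.2) (hw' n t ht.1 ht.2)
  refine ⟨w, by have := hw 0 0 (by simp) (by simpa using hσ); simpa [X, hα0] using this,
    fun t ht => ?_⟩
  set n := ⌊t / σ⌋₊ with hn
  have hn1 : n * σ ≤ t := (le_div_iff₀ hσ).1 (Nat.floor_le (div_nonneg ht hσ.le))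
  have hn2 : t < (n + 1) * σ := (div_lt_iff₀ hσ).1 (Nat.lt_floor_add_one _)
  have hright : HasDerivWithinAt w (f (w t)) (Set.Ici t) t := by
    refine (hd n t ⟨hn1, hn2.le⟩).mono_of_mem_nhdsWithin ?_
    filter_upwards [self_mem_nhdsWithin, mem_nhdsWithin_of_mem_nhds (Iio_mem_nhds hn2)] with s h1 h2
    exact ⟨hn1.trans h1, le_of_lt h2⟩
  -- At a grid time the left derivative comes from the preceding piece, hence the strict inequality
  -- k σ < t.
  have hleft : 0 < t → HasDerivWithinAt w (f (w t)) (Set.Iic t) t := by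
    intro ht0
    obtain ⟨k, hk1, hk2⟩ : ∃ k : ℕ, k * σ < t ∧ t ≤ (k + 1) * σ := by
      rcases hn1.lt_or_eq with h | h
      · exact ⟨n, h, hn2.le⟩
      · have : n ≠ 0 := by
          rintro h0
          rw [h0] at h
          simp at h
          linarith
        obtain ⟨k, hk⟩ := Nat.exists_eq_succ_of_ne_zero this
        refine ⟨k, ?_, ?_⟩ <;> rw [← h, hk] <;> push_cast <;> nlinarith
    refine (hd k t ⟨hk1.le, hk2⟩).mono_of_mem_nhdsWithin ?_
    filter_upwards [self_mem_nhdsWithin, mem_nhdsWithin_of_mem_nhds (Ioi_mem_nhds hk1)] with s h1 h2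
    exact ⟨le_of_lt h2, le_trans h1 hk2⟩
  rcases ht.lt_or_eq with h | h
  · have h3 := (hleft h).union hright
    exact h3.mono (fun s _ => le_total s t)
  · rw [← h] at hright ⊢
    exact hright

end GlobalExistence

/-! ### Contraction and short-time estimates for dissipative flows -/

section DissipativeFlow

variable {E : Type*} [NormedAddCommGroup E] [InnerProductSpace ℝ E]

/-- `w` solves `w' = -(1/2) b(w)` on `[0, ∞)`. -/
def IsHalfFlow (b : E → E) (w : ℝ → E) : Prop :=
  ∀ t ≥ (0 : ℝ), HasDerivWithinAt w (-((1 / 2 : ℝ) • b (w t))) (Set.Ici 0) t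

namespace IsHalfFlow

variable {b : E → E} {w w' : ℝ → E} {c C : ℝ}

theorem continuousOn (h : IsHalfFlow b w) : ContinuousOn w (Set.Ici 0) :=
  fun t ht => (h t ht).continuousWithinAt

theorem hasDerivAt (h : IsHalfFlow b w) {t : ℝ} (ht : 0 < t) :
    HasDerivAt w (-((1 / 2 : ℝ) • b (w t))) t :=
  (h t ht.le).hasDerivAt (Ici_mem_nhds ht)

theorem hasDerivWithinAt_Ici (h : IsHalfFlow b w) {t : ℝ} (ht : 0 ≤ t) :
    HasDerivWithinAt w (-((1 / 2 : ℝ) • b (w t))) (Set.Ici t) t :=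
  (h t ht).mono (Set.Ici_subset_Ici.2 ht)

theorem shift (h : IsHalfFlow b w) {s : ℝ} (hs : 0 ≤ s) : IsHalfFlow b (fun t => w (t + s)) := by
  intro t ht
  have h1 := (h (t + s) (add_nonneg ht hs)).scomp t (h := fun r => r + s) (t' := Set.Ici (0 : ℝ))
    (s := Set.Ici (0 : ℝ)) (h' := 1) ((hasDerivWithinAt_id t _).add_const _)
    (fun r hr => add_nonneg hr hs)
  simpa [Function.comp_def] using h1

/-- The function e^{ct}‖w - w'‖² is nonincreasing: the factor 2 from differentiating the square
cancels the 1/2 in the drift, and strong monotonicity supplies the rate c. -/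
theorem norm_sub_le_exp (h : IsHalfFlow b w) (h' : IsHalfFlow b w')
    (hb : ∀ x y, c * ‖x - y‖ ^ 2 ≤ inner ℝ (b x - b y) (x - y)) {t : ℝ} (ht : 0 ≤ t) :
    ‖w t - w' t‖ ≤ Real.exp (-(c * t / 2)) * ‖w 0 - w' 0‖ := by
  set φ : ℝ → ℝ := fun t => Real.exp (c * t) * ‖w t - w' t‖ ^ 2 with hφ
  have hanti : AntitoneOn φ (Set.Ici 0) := by
    have hder : ∀ t, 0 < t → HasDerivAt φ (Real.exp (c * t) * c * ‖w t - w' t‖ ^ 2 +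
        Real.exp (c * t) * (2 * inner ℝ (w t - w' t)
          (-((1 / 2 : ℝ) • b (w t)) - -((1 / 2 : ℝ) • b (w' t))))) t := by
      intro t ht
      have h1 : HasDerivAt (fun t => Real.exp (c * t)) (Real.exp (c * t) * c) t := by
        have := ((hasDerivAt_id t).const_mul c).exp
        simpa using this
      exact h1.mul ((h.hasDerivAt ht).sub (h'.hasDerivAt ht)).norm_sq
    refine antitoneOn_of_deriv_nonpos (convex_Ici 0) ?_ ?_ ?_
    · refine ContinuousOn.mul (by fun_prop) ?_
      exact ((h.continuousOn.sub h'.continuousOn).norm).pow 2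
    · rw [interior_Ici]
      exact fun t ht => (hder t ht).differentiableAt.differentiableWithinAt
    · rw [interior_Ici]
      intro t ht
      rw [(hder t ht).deriv]
      have e1 : inner ℝ (w t - w' t) (-((1 / 2 : ℝ) • b (w t)) - -((1 / 2 : ℝ) • b (w' t))) =
          -(1 / 2 * inner ℝ (b (w t) - b (w' t)) (w t - w' t)) := by
        rw [real_inner_comm, ← real_inner_smul_left, ← inner_neg_left, smul_sub]
        congr 1
        abel
      rw [e1]
      have e2 := hb (w t) (w' t)
      have e3 := (Real.exp_pos (c * t)).le
      nlinarith [mul_le_mul_of_nonneg_left e2 e3]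
  have h0 := hanti (Set.self_mem_Ici) (Set.mem_Ici.2 ht) ht
  simp only [hφ, mul_zero, Real.exp_zero, one_mul] at h0
  have h1 : ‖w t - w' t‖ ^ 2 ≤ (Real.exp (-(c * t / 2)) * ‖w 0 - w' 0‖) ^ 2 := by
    have e1 : Real.exp (-(c * t / 2)) ^ 2 * Real.exp (c * t) = 1 := by
      rw [← Real.exp_nat_mul, ← Real.exp_add]
      simp; ring
    calc ‖w t - w' t‖ ^ 2 = Real.exp (-(c * t / 2)) ^ 2 * (Real.exp (c * t) * ‖w t - w' t‖ ^ 2) := by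
          rw [← mul_assoc, e1, one_mul]
      _ ≤ Real.exp (-(c * t / 2)) ^ 2 * ‖w 0 - w' 0‖ ^ 2 := by gcongr
      _ = _ := by ring
  exact abs_le_of_sq_le_sq' h1 (by positivity) |>.2

theorem norm_sub_le (h : IsHalfFlow b w) (h' : IsHalfFlow b w') (hc : 0 ≤ c)
    (hb : ∀ x y, c * ‖x - y‖ ^ 2 ≤ inner ℝ (b x - b y) (x - y)) {t : ℝ} (ht : 0 ≤ t) :
    ‖w t - w' t‖ ≤ ‖w 0 - w' 0‖ := by
  refine (h.norm_sub_le_exp h' hb ht).trans ?_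
  exact mul_le_of_le_one_left (norm_nonneg _) (Real.exp_le_one_iff.2 (by
    have := mul_nonneg hc ht; linarith))

theorem eq_of_eq_zero (h : IsHalfFlow b w) (h' : IsHalfFlow b w')
    (hb : ∀ x y, c * ‖x - y‖ ^ 2 ≤ inner ℝ (b x - b y) (x - y)) (h0 : w 0 = w' 0)
    {t : ℝ} (ht : 0 ≤ t) : w t = w' t := by
  have := h.norm_sub_le_exp h' hb ht
  rw [h0, sub_self, norm_zero, mul_zero] at this
  exact sub_eq_zero.1 (norm_le_zero_iff.1 this)

/-- The speed of a dissipative flow does not increase. -/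
theorem norm_speed_le (h : IsHalfFlow b w) (hc : 0 ≤ c)
    (hb : ∀ x y, c * ‖x - y‖ ^ 2 ≤ inner ℝ (b x - b y) (x - y)) {t : ℝ} (ht : 0 ≤ t) :
    ‖(1 / 2 : ℝ) • b (w t)‖ ≤ ‖(1 / 2 : ℝ) • b (w 0)‖ := by
  have h1 : ∀ s : ℝ, 0 ≤ s → Tendsto (fun r => ‖slope w s r‖) (𝓝[>] s)
      (𝓝 ‖(1 / 2 : ℝ) • b (w s)‖) := by
    intro s hs
    have := (hasDerivWithinAt_iff_tendsto_slope' (by simp)).1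
      ((h.hasDerivWithinAt_Ici hs).mono Set.Ioi_subset_Ici_self)
    simpa using this.norm
  have h2 := h1 0 le_rfl
  have h3 : Tendsto (fun r => ‖slope w t (r + t)‖) (𝓝[>] 0) (𝓝 ‖(1 / 2 : ℝ) • b (w t)‖) := by
    refine (h1 t ht).comp ?_
    refine tendsto_nhdsWithin_iff.2 ⟨?_, ?_⟩
    · have : Tendsto (fun r : ℝ => r + t) (𝓝 0) (𝓝 (0 + t)) :=
        (continuous_id.add continuous_const).tendsto 0
      rw [zero_add] at this
      exact this.mono_left nhdsWithin_le_nhds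
    · filter_upwards [self_mem_nhdsWithin] with r hr
      simpa using hr
  -- The path shifted by r is again a flow, so ‖w(t + r) - w(t)‖ ≤ ‖w(r) - w(0)‖. Dividing by r and
  -- letting r → 0 compares the speeds.
  refine le_of_tendsto_of_tendsto h3 h2 ?_
  filter_upwards [self_mem_nhdsWithin] with r hr
  have hr' : (0 : ℝ) ≤ r := le_of_lt hr
  have := (h.shift hr').norm_sub_le h hc hb ht
  simp only [slope_def_module, norm_smul, add_sub_cancel_right, sub_zero]
  gcongr
  rw [add_comm r t]
  simpa using this

theorem norm_sub_initial_le (h : IsHalfFlow b w) (hc : 0 ≤ c)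
    (hb : ∀ x y, c * ‖x - y‖ ^ 2 ≤ inner ℝ (b x - b y) (x - y)) {t : ℝ} (ht : 0 ≤ t) :
    ‖w t - w 0‖ ≤ t / 2 * ‖b (w 0)‖ := by
  have := norm_image_sub_le_of_norm_deriv_right_le_segment (f := w) (a := 0) (b := t)
    (C := ‖(1 / 2 : ℝ) • b (w 0)‖) (h.continuousOn.mono Set.Icc_subset_Ici_self)
    (fun s hs => h.hasDerivWithinAt_Ici hs.1)
    (fun s hs => by rw [norm_neg]; exact h.norm_speed_le hc hb hs.1) t ⟨ht, le_rfl⟩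
  rw [norm_smul] at this
  norm_num at this
  linarith

theorem norm_sub_euler_le (h : IsHalfFlow b w) (hc : 0 ≤ c) (hC : 0 ≤ C)
    (hb : ∀ x y, c * ‖x - y‖ ^ 2 ≤ inner ℝ (b x - b y) (x - y))
    (hL : ∀ x y, ‖b x - b y‖ ≤ C * ‖x - y‖) {t : ℝ} (ht : 0 ≤ t) :
    ‖w t - (w 0 - (t / 2) • b (w 0))‖ ≤ C * t ^ 2 / 4 * ‖b (w 0)‖ := by
  have hd : ∀ s, 0 ≤ s → HasDerivWithinAt (fun s => w s + (s / 2) • b (w 0))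
      (-((1 / 2 : ℝ) • b (w s)) + (1 / 2 : ℝ) • b (w 0)) (Set.Ici s) s := by
    intro s hs
    exact (h.hasDerivWithinAt_Ici hs).add
      (((hasDerivWithinAt_id s _).div_const 2).smul_const (b (w 0)))
  have := norm_image_sub_le_of_norm_deriv_right_le_segment
    (f := fun s => w s + (s / 2) • b (w 0)) (a := 0) (b := t)
    (C := C * t / 4 * ‖b (w 0)‖)
    ((h.continuousOn.mono Set.Icc_subset_Ici_self).add (by fun_prop))
    (fun s hs => hd s hs.1)
    (fun s hs => by
      have e : -((1 / 2 : ℝ) • b (w s)) + (1 / 2 : ℝ) • b (w 0) =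
          -((1 / 2 : ℝ) • (b (w s) - b (w 0))) := by rw [smul_sub]; abel
      rw [e, norm_neg, norm_smul]
      have e1 := h.norm_sub_initial_le hc hb hs.1
      have e2 := hL (w s) (w 0)
      have e3 : C * ‖w s - w 0‖ ≤ C * (t / 2 * ‖b (w 0)‖) := by
        refine mul_le_mul_of_nonneg_left (e1.trans ?_) hC
        have := hs.2.le
        gcongr
      norm_num
      linarith) t ⟨ht, le_rfl⟩
  have e : w t - (w 0 - (t / 2) • b (w 0)) =
      w t + (t / 2) • b (w 0) - (w 0 + ((0 : ℝ) / 2) • b (w 0)) := by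
    simp; abel
  rw [e]
  refine this.trans (le_of_eq ?_)
  ring

/-- Up to a relative error O(t), the flow moves nearby points by a common translation. This is what
makes the flow almost commute with Gaussian averaging. -/
theorem norm_sub_sub_le (h : IsHalfFlow b w) (h' : IsHalfFlow b w') (hc : 0 ≤ c) (hC : 0 ≤ C)
    (hb : ∀ x y, c * ‖x - y‖ ^ 2 ≤ inner ℝ (b x - b y) (x - y))
    (hL : ∀ x y, ‖b x - b y‖ ≤ C * ‖x - y‖) {t : ℝ} (ht : 0 ≤ t) :
    ‖(w t - w' t) - (w 0 - w' 0)‖ ≤ C / 2 * ‖w 0 - w' 0‖ * t := by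
  have := norm_image_sub_le_of_norm_deriv_right_le_segment (f := fun s => w s - w' s)
    (a := 0) (b := t) (C := C / 2 * ‖w 0 - w' 0‖)
    ((h.continuousOn.sub h'.continuousOn).mono Set.Icc_subset_Ici_self)
    (fun s hs => (h.hasDerivWithinAt_Ici hs.1).sub (h'.hasDerivWithinAt_Ici hs.1))
    (fun s hs => by
      have e : -((1 / 2 : ℝ) • b (w s)) - -((1 / 2 : ℝ) • b (w' s)) =
          -((1 / 2 : ℝ) • (b (w s) - b (w' s))) := by rw [smul_sub]; abel
      rw [e, norm_neg, norm_smul]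
      have e1 := h.norm_sub_le h' hc hb hs.1
      have e2 := hL (w s) (w' s)
      have e3 := mul_le_mul_of_nonneg_left e1 hC
      norm_num
      linarith) t ⟨ht, le_rfl⟩
  simpa using this

end IsHalfFlow

end DissipativeFlow

/-! ### The normalised 2-norm as a Euclidean norm -/

section MatrixTupleNorm

variable {m N : ℕ}

theorem normTrace_conjTranspose_mul_self_re (A : Matrix (Fin N) (Fin N) ℂ) :
    (normTrace N (A.conjTranspose * A)).re = (N : ℝ)⁻¹ * ∑ k, ∑ l, ‖A k l‖ ^ 2 := by
  have h : Matrix.trace (A.conjTranspose * A) = ((∑ k, ∑ l, ‖A k l‖ ^ 2 : ℝ) : ℂ) := by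
    rw [Finset.sum_comm]
    simp only [Matrix.trace, Matrix.diag_apply, Matrix.mul_apply, Matrix.conjTranspose_apply]
    push_cast
    refine Finset.sum_congr rfl fun k _ => Finset.sum_congr rfl fun l _ => ?_
    rw [Complex.star_def, Complex.conj_mul']
  simp only [normTrace, LinearMap.smul_apply, Matrix.traceLinearMap_apply, smul_eq_mul, h]
  have : ((N : ℂ)⁻¹ * ((∑ k, ∑ l, ‖A k l‖ ^ 2 : ℝ) : ℂ)) =
      (((N : ℝ)⁻¹ * ∑ k, ∑ l, ‖A k l‖ ^ 2 : ℝ) : ℂ) := by push_cast; rfl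
  rw [this, Complex.ofReal_re]

/-- A tuple of matrices as a vector of a Euclidean space. -/
def tupleVec (y : Fin m → Matrix (Fin N) (Fin N) ℂ) :
    EuclideanSpace ℂ (Fin m × Fin N × Fin N) :=
  WithLp.toLp 2 fun p => y p.1 p.2.1 p.2.2

/-- The triangle inequality and homogeneity of `norm2` are inherited from this identification. -/
theorem norm2_eq_norm_tupleVec (y : Fin m → Matrix (Fin N) (Fin N) ℂ) :
    norm2 y = (Real.sqrt N)⁻¹ * ‖tupleVec y‖ := by
  rw [norm2, EuclideanSpace.norm_eq, ← Real.sqrt_inv, ← Real.sqrt_mul (by positivity)]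
  congr 1
  simp only [normTrace_conjTranspose_mul_self_re, Finset.mul_sum, Fintype.sum_prod_type, tupleVec]

theorem norm2_nonneg (y : Fin m → Matrix (Fin N) (Fin N) ℂ) : 0 ≤ norm2 y := Real.sqrt_nonneg _

theorem norm2_add_le (x y : Fin m → Matrix (Fin N) (Fin N) ℂ) :
    norm2 (x + y) ≤ norm2 x + norm2 y := by
  simp only [norm2_eq_norm_tupleVec]
  rw [← mul_add]
  exact mul_le_mul_of_nonneg_left (norm_add_le (tupleVec x) (tupleVec y)) (by positivity)

theorem norm2_smul (r : ℂ) (x : Fin m → Matrix (Fin N) (Fin N) ℂ) :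
    norm2 (r • x) = ‖r‖ * norm2 x := by
  simp only [norm2_eq_norm_tupleVec]
  have : tupleVec (r • x) = r • tupleVec x := rfl
  rw [this, norm_smul]
  ring

theorem norm2_sub_le (x y z : Fin m → Matrix (Fin N) (Fin N) ℂ) :
    norm2 (x - z) ≤ norm2 (x - y) + norm2 (y - z) := by
  simpa using norm2_add_le (x - y) (y - z)

theorem norm2_conjTranspose (x : Fin m → Matrix (Fin N) (Fin N) ℂ) :
    norm2 (fun j => (x j).conjTranspose) = norm2 x := by
  simp only [norm2, normTrace_conjTranspose_mul_self_re, Matrix.conjTranspose_apply, norm_star]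
  congr 1
  exact Finset.sum_congr rfl fun j _ => by rw [Finset.sum_comm]

namespace SATuple

theorem inner_def (x y : SATuple m N) :
    inner ℝ x y = ∑ j, (Matrix.trace (x.mat j * y.mat j)).re := rfl

theorem norm_sq_eq (x : SATuple m N) :
    ‖x‖ ^ 2 = ∑ j, (Matrix.trace (x.mat j * x.mat j)).re := by
  rw [← real_inner_self_eq_norm_sq, inner_def]

theorem mat_sub (x y : SATuple m N) : (x - y).mat = x.mat - y.mat := rfl

theorem norm_eq_norm_tupleVec (x : SATuple m N) : ‖x‖ = ‖tupleVec x.mat‖ := by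
  have h : ‖x‖ ^ 2 = ‖tupleVec x.mat‖ ^ 2 := by
    rw [norm_sq_eq, EuclideanSpace.norm_sq_eq, Fintype.sum_prod_type]
    refine Finset.sum_congr rfl fun j _ => ?_
    rw [trace_mul_self_re, Fintype.sum_prod_type, Finset.sum_comm]
    simp [Complex.normSq_eq_norm_sq, tupleVec]
  exact (pow_left_inj₀ (norm_nonneg _) (norm_nonneg _) two_ne_zero).1 h

theorem norm2_mat (x : SATuple m N) : norm2 x.mat = (Real.sqrt N)⁻¹ * ‖x‖ := by
  rw [norm2_eq_norm_tupleVec, norm_eq_norm_tupleVec]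

theorem norm2_mat_sq (x : SATuple m N) : norm2 x.mat ^ 2 = (N : ℝ)⁻¹ * ‖x‖ ^ 2 := by
  rw [norm2_mat, mul_pow, inv_pow, Real.sq_sqrt (by positivity)]

theorem norm_entry_le (x : SATuple m N) (b : Fin m) (i j : Fin N) : ‖x.mat b i j‖ ≤ ‖x‖ := by
  rw [norm_eq_norm_tupleVec]
  exact PiLp.norm_apply_le (tupleVec x.mat) (b, i, j)

/-- The matrix `x ↦ x_b` as a continuous real-linear map. -/
def entryCLM (b : Fin m) (i j : Fin N) : SATuple m N →L[ℝ] ℂ :=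
  LinearMap.toContinuousLinearMap
    { toFun := fun x => x.mat b i j
      map_add' := fun x y => by rw [mat_add]; rfl
      map_smul' := fun r x => by rw [mat_smul]; rfl }

@[simp] theorem entryCLM_apply (b : Fin m) (i j : Fin N) (x : SATuple m N) :
    entryCLM b i j x = x.mat b i j := rfl

end SATuple

end MatrixTupleNorm

/-! ### The gradient flow, with constants independent of N -/

section GradientFlow

variable {m N : ℕ} {c C : ℝ} {V : SATuple m N → ℝ}

namespace MemE

/-- The curvatures become c/N and C/N because ‖x‖₂² = ‖x‖²/N; the factor N in `normGrad` then
restores c and C. -/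
theorem quadraticBounds (h : MemE c C V) :
    QuadraticBounds V (gradient V) (c / N) (C / N) := by
  refine quadraticBounds_of_convexOn_of_concaveOn ?_ ?_
  · refine h.1.congr fun x _ => ?_
    simp only [SATuple.norm2_mat_sq]
    ring
  · refine h.2.congr fun x _ => ?_
    simp only [SATuple.norm2_mat_sq]
    ring

theorem normGrad_monotone (h : MemE c C V) (hN : 1 ≤ N) (x y : SATuple m N) :
    c * ‖x - y‖ ^ 2 ≤ inner ℝ (normGrad V x - normGrad V y) (x - y) := by
  have h1 := h.quadraticBounds.strongly_monotone x y
  have hN' : (0 : ℝ) < N := by exact_mod_cast hN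
  rw [normGrad, normGrad, ← smul_sub, real_inner_smul_left]
  calc c * ‖x - y‖ ^ 2 = N * (c / N * ‖x - y‖ ^ 2) := by field_simp
    _ ≤ _ := by gcongr

theorem norm_normGrad_sub_le (h : MemE c C V) (hN : 1 ≤ N) (hc : 0 < c) (hcC : c ≤ C)
    (x y : SATuple m N) : ‖normGrad V x - normGrad V y‖ ≤ C * ‖x - y‖ := by
  have hN' : (0 : ℝ) < N := by exact_mod_cast hN
  have h1 := h.quadraticBounds.norm_sub_le (by positivity)
    (div_pos (hc.trans_le hcC) hN') x y
  rw [normGrad, normGrad, ← smul_sub, norm_smul, Real.norm_eq_abs, abs_of_pos hN']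
  calc N * ‖gradient V x - gradient V y‖ ≤ N * (C / N * ‖x - y‖) := by gcongr
    _ = _ := by field_simp

theorem exists_isGradFlow (h : MemE c C V) (hN : 1 ≤ N) (hc : 0 < c) (hcC : c ≤ C)
    (x : SATuple m N) : ∃ w, IsGradFlow V x w := by
  have hL : LipschitzWith (Real.toNNReal (C / 2)) (fun y => -((1 / 2 : ℝ) • normGrad V y)) := by
    have hC : 0 ≤ C := (hc.trans_le hcC).le
    refine LipschitzWith.of_dist_le_mul fun y z => ?_
    rw [dist_eq_norm, dist_eq_norm, Real.coe_toNNReal _ (by positivity)]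
    have e : -((1 / 2 : ℝ) • normGrad V y) - -((1 / 2 : ℝ) • normGrad V z) =
        -((1 / 2 : ℝ) • (normGrad V y - normGrad V z)) := by rw [smul_sub]; abel
    rw [e, norm_neg, norm_smul]
    have := h.norm_normGrad_sub_le hN hc hcC y z
    norm_num
    linarith
  exact hL.exists_solution_Ici x

theorem isGradFlow_gradFlow (h : MemE c C V) (hN : 1 ≤ N) (hc : 0 < c) (hcC : c ≤ C)
    (x : SATuple m N) : IsGradFlow V x (gradFlow V x) :=
  Classical.epsilon_spec (h.exists_isGradFlow hN hc hcC x)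

end MemE

/-- The standing assumptions on one potential: `N ≥ 1`, `0 < c ≤ C` and `V ∈ 𝓔_{m,N}(c, C)`. -/
structure UnifConvex (c C : ℝ) (V : SATuple m N → ℝ) : Prop where
  one_le : 1 ≤ N
  pos : 0 < c
  le : c ≤ C
  mem : MemE c C V

namespace UnifConvex

variable (h : UnifConvex c C V)
include h

theorem C_pos : 0 < C := h.pos.trans_le h.le

theorem monotone (x y : SATuple m N) :
    c * ‖x - y‖ ^ 2 ≤ inner ℝ (normGrad V x - normGrad V y) (x - y) :=
  h.mem.normGrad_monotone h.one_le x y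

theorem lipschitz (x y : SATuple m N) : ‖normGrad V x - normGrad V y‖ ≤ C * ‖x - y‖ :=
  h.mem.norm_normGrad_sub_le h.one_le h.pos h.le x y

theorem isHalfFlow (x : SATuple m N) : IsHalfFlow (normGrad V) (gradFlow V x) :=
  (h.mem.isGradFlow_gradFlow h.one_le h.pos h.le x).2

theorem gradFlow_zero (x : SATuple m N) : gradFlow V x 0 = x :=
  (h.mem.isGradFlow_gradFlow h.one_le h.pos h.le x).1

/-- The defining condition constrains a solution on [0, ∞) only, so the chosen `gradFlow` is
determined at nonnegative times and nowhere else. -/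
theorem gradFlow_unique {x : SATuple m N} {w : ℝ → SATuple m N} (hw : IsGradFlow V x w)
    {t : ℝ} (ht : 0 ≤ t) : w t = gradFlow V x t :=
  IsHalfFlow.eq_of_eq_zero hw.2 (h.isHalfFlow x) h.monotone (by rw [hw.1, h.gradFlow_zero]) ht

theorem gradFlow_add (x : SATuple m N) {s t : ℝ} (hs : 0 ≤ s) (ht : 0 ≤ t) :
    gradFlow V x (s + t) = gradFlow V (gradFlow V x s) t := by
  rw [add_comm]
  exact h.gradFlow_unique (x := gradFlow V x s) (w := fun t => gradFlow V x (t + s))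
    ⟨by simp, (h.isHalfFlow x).shift hs⟩ ht

theorem norm_gradFlow_sub_le_exp (x y : SATuple m N) {t : ℝ} (ht : 0 ≤ t) :
    ‖gradFlow V x t - gradFlow V y t‖ ≤ Real.exp (-(c * t / 2)) * ‖x - y‖ := by
  simpa only [h.gradFlow_zero] using
    (h.isHalfFlow x).norm_sub_le_exp (h.isHalfFlow y) h.monotone ht

theorem norm_gradFlow_sub_le (x y : SATuple m N) {t : ℝ} (ht : 0 ≤ t) :
    ‖gradFlow V x t - gradFlow V y t‖ ≤ ‖x - y‖ := by
  simpa only [h.gradFlow_zero] using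
    (h.isHalfFlow x).norm_sub_le (h.isHalfFlow y) h.pos.le h.monotone ht

theorem norm_gradFlow_sub_self_le (x : SATuple m N) {t : ℝ} (ht : 0 ≤ t) :
    ‖gradFlow V x t - x‖ ≤ t / 2 * ‖normGrad V x‖ := by
  simpa only [h.gradFlow_zero] using
    (h.isHalfFlow x).norm_sub_initial_le h.pos.le h.monotone ht

theorem norm_gradFlow_sub_euler_le (x : SATuple m N) {t : ℝ} (ht : 0 ≤ t) :
    ‖gradFlow V x t - (x - (t / 2) • normGrad V x)‖ ≤ C * t ^ 2 / 4 * ‖normGrad V x‖ := by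
  simpa only [h.gradFlow_zero] using
    (h.isHalfFlow x).norm_sub_euler_le h.pos.le h.C_pos.le h.monotone h.lipschitz ht

theorem norm_gradFlow_sub_sub_le (x y : SATuple m N) {t : ℝ} (ht : 0 ≤ t) :
    ‖(gradFlow V x t - gradFlow V y t) - (x - y)‖ ≤ C / 2 * ‖x - y‖ * t := by
  simpa only [h.gradFlow_zero] using
    (h.isHalfFlow x).norm_sub_sub_le (h.isHalfFlow y) h.pos.le h.C_pos.le h.monotone h.lipschitz ht

theorem norm_normGrad_gradFlow_le (x : SATuple m N) {t : ℝ} (ht : 0 ≤ t) :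
    ‖normGrad V (gradFlow V x t)‖ ≤ ‖normGrad V x‖ := by
  have := (h.isHalfFlow x).norm_speed_le h.pos.le h.monotone ht
  rw [h.gradFlow_zero, norm_smul, norm_smul] at this
  norm_num at this
  linarith

end UnifConvex

end GradientFlow

/-! ### Gaussian measures: transforms, convolution, integration by parts -/

section GaussianMeasure

variable {E : Type*} [NormedAddCommGroup E] [InnerProductSpace ℝ E] [FiniteDimensional ℝ E]
  [MeasurableSpace E] [BorelSpace E]

/-- The centred Gaussian measure with density proportional to `exp (-κ ‖y‖²)`. -/
def gaussTilt (E : Type*) [NormedAddCommGroup E] [InnerProductSpace ℝ E] [FiniteDimensional ℝ E]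
    [MeasurableSpace E] [BorelSpace E] (κ : ℝ) : Measure E :=
  (volume : Measure E).tilted fun y => -(κ * ‖y‖ ^ 2)

variable {κ : ℝ}

theorem integrable_exp_neg_mul_norm_sq (hκ : 0 < κ) :
    Integrable (fun y : E => Real.exp (-(κ * ‖y‖ ^ 2))) := by
  have h := (GaussianFourier.integrable_cexp_neg_mul_sq_norm_add (V := E) (b := (κ : ℂ))
    (by simpa using hκ) 0 0).norm
  refine h.congr (Eventually.of_forall fun y => ?_)
  simp only [Complex.norm_exp, inner_zero_left, Complex.ofReal_zero, mul_zero, add_zero]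
  congr 1
  have : (-(κ : ℂ) * (‖y‖ : ℂ) ^ 2) = ((-(κ * ‖y‖ ^ 2) : ℝ) : ℂ) := by push_cast; ring
  rw [this, Complex.ofReal_re]

theorem isProbabilityMeasure_gaussTilt (hκ : 0 < κ) : IsProbabilityMeasure (gaussTilt E κ) :=
  isProbabilityMeasure_tilted (integrable_exp_neg_mul_norm_sq hκ)

theorem integrable_exp_mul_norm_mul_gaussian (hκ : 0 < κ) (β : ℝ) :
    Integrable (fun y : E => Real.exp (-(κ * ‖y‖ ^ 2)) * Real.exp (β * ‖y‖)) := by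
  refine ((integrable_exp_neg_mul_norm_sq (E := E) (half_pos hκ)).const_mul
    (Real.exp (β ^ 2 / (2 * κ)))).mono' (by fun_prop) (Eventually.of_forall fun y => ?_)
  rw [Real.norm_eq_abs, abs_of_pos (by positivity), ← Real.exp_add, ← Real.exp_add]
  refine Real.exp_le_exp.2 ?_
  have h1 : β ^ 2 / (2 * κ) + -(κ / 2 * ‖y‖ ^ 2) - (-(κ * ‖y‖ ^ 2) + β * ‖y‖) =
      (κ * ‖y‖ - β) ^ 2 / (2 * κ) := by field_simp; ring
  have h2 : 0 ≤ (κ * ‖y‖ - β) ^ 2 / (2 * κ) := by positivity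
  linarith

theorem integrable_gaussian_smul_of_norm_le_exp {G : Type*} [NormedAddCommGroup G]
    [NormedSpace ℝ G] (hκ : 0 < κ) {F : E → G} (hF : AEStronglyMeasurable F) {A β : ℝ}
    (h : ∀ y, ‖F y‖ ≤ A * Real.exp (β * ‖y‖)) :
    Integrable (fun y : E => Real.exp (-(κ * ‖y‖ ^ 2)) • F y) := by
  refine ((integrable_exp_mul_norm_mul_gaussian (E := E) hκ β).const_mul A).mono'
    (AEStronglyMeasurable.smul (by fun_prop) hF) (Eventually.of_forall fun y => ?_)
  rw [norm_smul, Real.norm_eq_abs, abs_of_pos (Real.exp_pos _)]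
  nlinarith [h y, Real.exp_pos (-(κ * ‖y‖ ^ 2))]

theorem integrable_gaussTilt_of_norm_le_exp {G : Type*} [NormedAddCommGroup G] [NormedSpace ℝ G]
    (hκ : 0 < κ) {F : E → G} (hF : Continuous F) {A β : ℝ}
    (h : ∀ y, ‖F y‖ ≤ A * Real.exp (β * ‖y‖)) : Integrable F (gaussTilt E κ) := by
  rw [gaussTilt, integrable_tilted_iff (integrable_exp_neg_mul_norm_sq hκ)]
  exact integrable_gaussian_smul_of_norm_le_exp hκ hF.aestronglyMeasurable h

/-- Kept complex in a on purpose: a = 1 yields the Laplace transform behind the tail bounds, a = i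
the characteristic function that identifies convolutions and dilations. -/
theorem integral_cexp_gaussTilt (hκ : 0 < κ) (a : ℂ) (w : E) :
    ∫ y, Complex.exp (a * (inner ℝ w y : ℝ)) ∂(gaussTilt E κ) =
      Complex.exp (a ^ 2 * ‖w‖ ^ 2 / (4 * κ)) := by
  have hκ' : 0 < (κ : ℂ).re := by simpa using hκ
  have h0 := GaussianFourier.integral_cexp_neg_mul_sq_norm (V := E) hκ'
  have h1 := GaussianFourier.integral_cexp_neg_mul_sq_norm_add (V := E) hκ' a w
  have hZ : (((∫ y : E, Real.exp (-(κ * ‖y‖ ^ 2))) : ℝ) : ℂ) =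
      (Real.pi / (κ : ℂ)) ^ (Module.finrank ℝ E / 2 : ℂ) := by
    rw [← h0, ← integral_complex_ofReal]
    refine integral_congr_ae (Eventually.of_forall fun y => ?_)
    push_cast
    simp
  have hZpos : 0 < ∫ y : E, Real.exp (-(κ * ‖y‖ ^ 2)) :=
    integral_exp_pos (integrable_exp_neg_mul_norm_sq hκ)
  rw [gaussTilt, integral_tilted]
  have h2 : ∀ y : E, (Real.exp (-(κ * ‖y‖ ^ 2)) / ∫ y : E, Real.exp (-(κ * ‖y‖ ^ 2))) •
      Complex.exp (a * (inner ℝ w y : ℝ)) =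
      (((∫ y : E, Real.exp (-(κ * ‖y‖ ^ 2))) : ℝ) : ℂ)⁻¹ *
        Complex.exp (-κ * ‖y‖ ^ 2 + a * (inner ℝ w y : ℝ)) := by
    intro y
    rw [Complex.exp_add, Complex.real_smul]
    push_cast
    rw [div_eq_inv_mul, mul_assoc, neg_mul]
  simp only [h2]
  rw [integral_const_mul, h1, hZ, ← mul_assoc, inv_mul_cancel₀, one_mul]
  rw [← hZ]
  exact_mod_cast hZpos.ne'

theorem integral_exp_inner_gaussTilt (hκ : 0 < κ) (w : E) :
    ∫ y, Real.exp (inner ℝ w y) ∂(gaussTilt E κ) = Real.exp (‖w‖ ^ 2 / (4 * κ)) := by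
  have h := integral_cexp_gaussTilt hκ 1 w
  have h2 : ∫ y, Complex.exp (1 * (inner ℝ w y : ℝ)) ∂(gaussTilt E κ) =
      ((∫ y, Real.exp (inner ℝ w y) ∂(gaussTilt E κ) : ℝ) : ℂ) := by
    rw [← integral_complex_ofReal]
    simp
  rw [h2] at h
  rw [← Complex.ofReal_inj, h]
  push_cast
  simp

theorem integrable_exp_inner_gaussTilt (hκ : 0 < κ) (w : E) :
    Integrable (fun y => Real.exp (inner ℝ w y)) (gaussTilt E κ) := by
  refine integrable_gaussTilt_of_norm_le_exp hκ (by fun_prop) (A := 1) (β := ‖w‖) fun y => ?_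
  rw [one_mul, Real.norm_eq_abs, abs_of_pos (Real.exp_pos _)]
  exact Real.exp_le_exp.2 (real_inner_le_norm w y)

theorem charFun_gaussTilt (hκ : 0 < κ) (w : E) :
    charFun (gaussTilt E κ) w = Complex.exp (-(‖w‖ ^ 2 / (4 * κ))) := by
  have h := integral_cexp_gaussTilt hκ Complex.I w
  rw [charFun_apply]
  simp only [real_inner_comm w, mul_comm _ Complex.I] at h ⊢
  rw [h, Complex.I_sq]
  congr 1
  ring

/-- The reciprocal rates are proportional to the variances, which add when characteristic functions
are multiplied. -/
theorem gaussTilt_conv {κ' κ'' : ℝ} (hκ : 0 < κ) (hκ' : 0 < κ') (hκ'' : 0 < κ'')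
    (h : κ⁻¹ + κ'⁻¹ = κ''⁻¹) :
    gaussTilt E κ ∗ gaussTilt E κ' = gaussTilt E κ'' := by
  have := isProbabilityMeasure_gaussTilt (E := E) hκ
  have := isProbabilityMeasure_gaussTilt (E := E) hκ'
  have := isProbabilityMeasure_gaussTilt (E := E) hκ''
  refine Measure.ext_of_charFun (funext fun w => ?_)
  rw [charFun_conv, charFun_gaussTilt hκ, charFun_gaussTilt hκ', charFun_gaussTilt hκ'',
    ← Complex.exp_add]
  congr 1
  have h' : (κ : ℂ)⁻¹ + (κ' : ℂ)⁻¹ = (κ'' : ℂ)⁻¹ := by exact_mod_cast h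
  simp only [div_eq_mul_inv, mul_inv, ← h']
  ring

theorem map_smul_gaussTilt {r : ℝ} (hκ : 0 < κ) (hr : 0 < r) :
    (gaussTilt E (κ * r ^ 2)).map (r • ·) = gaussTilt E κ := by
  have := isProbabilityMeasure_gaussTilt (E := E) hκ
  have := isProbabilityMeasure_gaussTilt (E := E) (mul_pos hκ (pow_pos hr 2))
  refine Measure.ext_of_charFun (funext fun w => ?_)
  rw [charFun_map_smul, charFun_gaussTilt hκ, charFun_gaussTilt (mul_pos hκ (pow_pos hr 2)),
    norm_smul, Real.norm_eq_abs, abs_of_pos hr]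
  congr 2
  have h1 : (r : ℂ) ≠ 0 := by exact_mod_cast hr.ne'
  have h2 : (κ : ℂ) ≠ 0 := by exact_mod_cast hκ.ne'
  push_cast
  field_simp

/-- Continuous functions of at most exponential growth. -/
def ExpGrowth {E G : Type*} [NormedAddCommGroup E] [NormedAddCommGroup G] (F : E → G) : Prop :=
  Continuous F ∧ ∃ A β : ℝ, ∀ y, ‖F y‖ ≤ A * Real.exp (β * ‖y‖)

namespace ExpGrowth

section

variable {E G : Type*} [NormedAddCommGroup E] [NormedAddCommGroup G] {F F' : E → G}

theorem exists_nonneg (h : ExpGrowth F) :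
    ∃ A β : ℝ, 0 ≤ A ∧ 0 ≤ β ∧ ∀ y, ‖F y‖ ≤ A * Real.exp (β * ‖y‖) := by
  obtain ⟨-, A, β, hb⟩ := h
  refine ⟨|A|, |β|, abs_nonneg _, abs_nonneg _, fun y => (hb y).trans ?_⟩
  have := le_abs_self A
  have := le_abs_self β
  gcongr

theorem const (a : G) : ExpGrowth fun _ : E => a :=
  ⟨continuous_const, ‖a‖, 0, fun y => by simp⟩

theorem of_norm_le (hF : Continuous F) {A : ℝ} (h : ∀ y, ‖F y‖ ≤ A * ‖y‖) : ExpGrowth F := by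
  refine ⟨hF, |A|, 1, fun y => (h y).trans ?_⟩
  rw [one_mul]
  have h1 : ‖y‖ ≤ Real.exp ‖y‖ := by linarith [Real.add_one_le_exp ‖y‖]
  have h2 := le_abs_self A
  gcongr

theorem add (h : ExpGrowth F) (h' : ExpGrowth F') : ExpGrowth fun y => F y + F' y := by
  obtain ⟨A, β, hA, hβ, hb⟩ := h.exists_nonneg
  obtain ⟨A', β', hA', hβ', hb'⟩ := h'.exists_nonneg
  refine ⟨h.1.add h'.1, A + A', β + β', fun y => (norm_add_le _ _).trans ?_⟩
  have h0 := norm_nonneg y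
  have h1 : Real.exp (β * ‖y‖) ≤ Real.exp ((β + β') * ‖y‖) := by gcongr; linarith
  have h2 : Real.exp (β' * ‖y‖) ≤ Real.exp ((β + β') * ‖y‖) := by gcongr; linarith
  rw [add_mul]
  exact add_le_add ((hb y).trans (mul_le_mul_of_nonneg_left h1 hA))
    ((hb' y).trans (mul_le_mul_of_nonneg_left h2 hA'))

theorem finset_sum {ι : Type*} (s : Finset ι) {f : ι → E → G} (h : ∀ i, ExpGrowth (f i)) :
    ExpGrowth fun y => ∑ i ∈ s, f i y := by
  classical
  induction s using Finset.induction_on with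
  | empty => simpa using const (0 : G)
  | insert i s hi ih =>
    simp only [Finset.sum_insert hi]
    exact (h i).add ih

theorem mul {R : Type*} [NormedRing R] {f f' : E → R} (h : ExpGrowth f) (h' : ExpGrowth f') :
    ExpGrowth fun y => f y * f' y := by
  obtain ⟨A, β, hA, hβ, hb⟩ := h.exists_nonneg
  obtain ⟨A', β', hA', hβ', hb'⟩ := h'.exists_nonneg
  refine ⟨h.1.mul h'.1, A * A', β + β', fun y => (norm_mul_le _ _).trans ?_⟩
  rw [add_mul, Real.exp_add, mul_mul_mul_comm]
  exact mul_le_mul (hb y) (hb' y) (norm_nonneg _) (by positivity)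

theorem smul [NormedSpace ℝ G] {f : E → ℝ} (h : ExpGrowth f) (h' : ExpGrowth F') :
    ExpGrowth fun y => f y • F' y := by
  obtain ⟨A, β, hA, hβ, hb⟩ := h.exists_nonneg
  obtain ⟨A', β', hA', hβ', hb'⟩ := h'.exists_nonneg
  refine ⟨h.1.smul h'.1, A * A', β + β', fun y => ?_⟩
  rw [norm_smul, add_mul, Real.exp_add, mul_mul_mul_comm]
  exact mul_le_mul (hb y) (hb' y) (norm_nonneg _) (by positivity)

end

theorem integrable_gaussTilt {G : Type*} [NormedAddCommGroup G] [NormedSpace ℝ G] {F : E → G}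
    (h : ExpGrowth F) (hκ : 0 < κ) : Integrable F (gaussTilt E κ) := by
  obtain ⟨hc, A, β, hb⟩ := h
  exact integrable_gaussTilt_of_norm_le_exp hκ hc hb

theorem inner (w : E) : ExpGrowth fun y : E => (inner ℝ w y : ℝ) :=
  of_norm_le (by fun_prop) (norm_inner_le_norm w)

end ExpGrowth

/-- Gaussian integration by parts. -/
theorem integral_inner_smul_gaussTilt {G : Type*} [NormedAddCommGroup G] [NormedSpace ℝ G]
    (hκ : 0 < κ) (w : E) {F F' : E → G} (hF : ExpGrowth F) (hF' : ExpGrowth F')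
    (hd : ∀ y, HasLineDerivAt ℝ F (F' y) y w) :
    ∫ y, (inner ℝ w y : ℝ) • F y ∂(gaussTilt E κ) =
      (2 * κ)⁻¹ • ∫ y, F' y ∂(gaussTilt E κ) := by
  set ρ : E → ℝ := fun y => Real.exp (-(κ * ‖y‖ ^ 2)) with hρ
  have hρd : ∀ y, HasLineDerivAt ℝ ρ (-(2 * κ * (inner ℝ w y * ρ y))) y w := by
    intro y
    have h := ((((hasStrictFDerivAt_norm_sq y).hasFDerivAt).const_mul κ).fun_neg).exp
    convert h.hasLineDerivAt w using 1
    simp [real_inner_comm w y]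
    ring
  have hint : ∀ {F : E → G}, ExpGrowth F → Integrable (fun y => ρ y • F y) := by
    rintro F ⟨hc, A, β, hb⟩
    exact integrable_gaussian_smul_of_norm_le_exp hκ hc.aestronglyMeasurable hb
  have key := integral_bilinear_hasLineDerivAt_right_eq_neg_left_of_integrable (μ := volume)
    (f := ρ) (g := F) (f' := fun y => -(2 * κ * (inner ℝ w y * ρ y))) (g' := F') (v := w)
    (B := ContinuousLinearMap.lsmul ℝ ℝ)
    (by
      simp only [ContinuousLinearMap.lsmul_apply]
      refine ((hint ((ExpGrowth.inner w).smul hF)).smul (-(2 * κ))).congr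
        (Eventually.of_forall fun y => ?_)
      simp only [smul_smul, Pi.smul_apply]
      congr 1
      ring)
    (by simpa using hint hF') (by simpa using hint hF) (fun y _ => hρd y) (fun y _ => hd y)
  simp only [ContinuousLinearMap.lsmul_apply] at key
  have h2 : ∫ y, (-(2 * κ * ((Inner.inner ℝ w y : ℝ) * ρ y))) • F y =
      (-(2 * κ)) • ∫ y, ρ y • ((Inner.inner ℝ w y : ℝ) • F y) := by
    rw [← integral_smul]
    refine integral_congr_ae (Eventually.of_forall fun y => ?_)
    simp only [smul_smul]
    congr 1
    ring
  rw [h2, neg_smul, neg_neg] at key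
  rw [gaussTilt, integral_tilted, integral_tilted]
  simp only [div_eq_inv_mul, ← smul_smul]
  rw [integral_smul, integral_smul, key, smul_comm _ (2 * κ), smul_smul (2 * κ)⁻¹,
    inv_mul_cancel₀ (by positivity), one_smul]

end GaussianMeasure

/-! ### GUE moments and entrywise integration by parts -/

section GUE

variable {m N : ℕ} {t : ℝ}

theorem gue_eq_gaussTilt (m N : ℕ) (t : ℝ) :
    gue m N t = gaussTilt (SATuple m N) (N / (2 * t)) := by
  rw [gue, gaussTilt]
  congr 1
  funext x
  rw [SATuple.norm_sq_eq]
  ring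

theorem gue_rate_pos (hN : 1 ≤ N) (ht : 0 < t) : 0 < (N : ℝ) / (2 * t) :=
  div_pos (by exact_mod_cast hN) (by linarith)

theorem isProbabilityMeasure_gue (hN : 1 ≤ N) (ht : 0 < t) : IsProbabilityMeasure (gue m N t) := by
  rw [gue_eq_gaussTilt]
  exact isProbabilityMeasure_gaussTilt (gue_rate_pos hN ht)

theorem integrable_gue_of_norm_le_exp {G : Type*} [NormedAddCommGroup G] [NormedSpace ℝ G]
    (hN : 1 ≤ N) (ht : 0 < t) {F : SATuple m N → G} (hF : Continuous F) {A β : ℝ}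
    (h : ∀ y, ‖F y‖ ≤ A * Real.exp (β * ‖y‖)) : Integrable F (gue m N t) := by
  rw [gue_eq_gaussTilt]
  exact integrable_gaussTilt_of_norm_le_exp (gue_rate_pos hN ht) hF h

theorem gue_conv {s : ℝ} (hN : 1 ≤ N) (hs : 0 < s) (ht : 0 < t) :
    gue m N s ∗ gue m N t = gue m N (s + t) := by
  simp only [gue_eq_gaussTilt]
  refine gaussTilt_conv (gue_rate_pos hN hs) (gue_rate_pos hN ht)
    (gue_rate_pos hN (add_pos hs ht)) ?_
  have : (0 : ℝ) < N := by exact_mod_cast hN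
  field_simp

theorem map_sqrt_smul_gue (hN : 1 ≤ N) (ht : 0 < t) :
    (gue m N 1).map (Real.sqrt t • ·) = gue m N t := by
  simp only [gue_eq_gaussTilt]
  have := map_smul_gaussTilt (E := SATuple m N) (gue_rate_pos hN ht) (Real.sqrt_pos.2 ht)
  rw [Real.sq_sqrt ht.le] at this
  convert this using 3
  field_simp

/-- The tuple with the self-adjoint matrix `A` in the slot `b` and zeros elsewhere. -/
def SATuple.single (b : Fin m) (A : selfAdjoint (Matrix (Fin N) (Fin N) ℂ)) : SATuple m N :=
  Function.update (0 : Fin m → selfAdjoint (Matrix (Fin N) (Fin N) ℂ)) b A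

theorem SATuple.single_mat (b : Fin m) (A : selfAdjoint (Matrix (Fin N) (Fin N) ℂ)) (j : Fin m) :
    (SATuple.single b A).mat j = if j = b then A.1 else 0 := by
  by_cases h : j = b
  · subst h
    simp [SATuple.single, SATuple.mat]
  · simp [SATuple.single, SATuple.mat, h]

theorem SATuple.inner_single (b : Fin m) (A : selfAdjoint (Matrix (Fin N) (Fin N) ℂ))
    (y : SATuple m N) :
    ((inner ℝ (SATuple.single b A) y : ℝ) : ℂ) = Matrix.trace (A.1 * y.mat b) := by
  have h1 : inner ℝ (SATuple.single b A) y = (Matrix.trace (A.1 * y.mat b)).re := by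
    rw [SATuple.inner_def, Finset.sum_eq_single b]
    · rw [SATuple.single_mat, if_pos rfl]
    · intro j _ hj
      rw [SATuple.single_mat, if_neg hj]
      simp
    · simp
  rw [h1]
  refine Complex.conj_eq_iff_re.1 ?_
  have h2 : A.1.conjTranspose = A.1 := A.2
  rw [← Complex.star_def, ← Matrix.trace_conjTranspose, Matrix.conjTranspose_mul,
    SATuple.mat_conjTranspose, h2, Matrix.trace_mul_comm]

/-- The self-adjoint part of the matrix unit `E_{ji}`, in the slot `b`. -/
def unitRe (b : Fin m) (i j : Fin N) : SATuple m N :=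
  SATuple.single b (realPart (Matrix.single j i (1 : ℂ)))

/-- The skew-adjoint part (divided by `i`) of the matrix unit `E_{ji}`, in the slot `b`. -/
def unitIm (b : Fin m) (i j : Fin N) : SATuple m N :=
  SATuple.single b (imaginaryPart (Matrix.single j i (1 : ℂ)))

theorem unitRe_add_unitIm_mat (b a : Fin m) (i j : Fin N) :
    (unitRe b i j).mat a + Complex.I • (unitIm b i j).mat a =
      if a = b then Matrix.single j i (1 : ℂ) else 0 := by
  simp only [unitRe, unitIm, SATuple.single_mat]
  split_ifs
  · exact realPart_add_I_smul_imaginaryPart _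
  · simp

/-- Since Tr(E_{ji} y_b) is the (i, j) entry of y_b, a complex entry is a complex combination of two
real functionals given by self-adjoint directions, the only directions along which the real
integration by parts applies. -/
theorem inner_unitRe_add_inner_unitIm (b : Fin m) (i j : Fin N) (y : SATuple m N) :
    ((inner ℝ (unitRe b i j) y : ℝ) : ℂ) + Complex.I * ((inner ℝ (unitIm b i j) y : ℝ) : ℂ) =
      y.mat b i j := by
  rw [unitRe, unitIm, SATuple.inner_single, SATuple.inner_single, ← smul_eq_mul Complex.I,
    ← Matrix.trace_smul, ← Matrix.trace_add, ← Matrix.smul_mul, ← Matrix.add_mul,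
    realPart_add_I_smul_imaginaryPart, Matrix.trace_single_mul]
  simp

theorem ExpGrowth.integrable_gue {G : Type*} [NormedAddCommGroup G] [NormedSpace ℝ G]
    {F : SATuple m N → G} (h : ExpGrowth F) (hN : 1 ≤ N) (ht : 0 < t) :
    Integrable F (gue m N t) := by
  rw [gue_eq_gaussTilt]
  exact h.integrable_gaussTilt (gue_rate_pos hN ht)

theorem expGrowth_entry (b : Fin m) (i j : Fin N) :
    ExpGrowth fun y : SATuple m N => y.mat b i j :=
  ExpGrowth.of_norm_le (A := 1) (SATuple.entryCLM b i j).continuous fun y => by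
    rw [one_mul]
    exact SATuple.norm_entry_le y b i j

/-- Gaussian integration by parts for a matrix entry. -/
theorem integral_entry_mul_gue (hN : 1 ≤ N) (ht : 0 < t) (b : Fin m) (i j : Fin N)
    {F D₁ D₂ : SATuple m N → ℂ} (hF : ExpGrowth F) (h₁ : ExpGrowth D₁) (h₂ : ExpGrowth D₂)
    (hd₁ : ∀ y, HasLineDerivAt ℝ F (D₁ y) y (unitRe b i j))
    (hd₂ : ∀ y, HasLineDerivAt ℝ F (D₂ y) y (unitIm b i j)) :
    ∫ y, y.mat b i j * F y ∂(gue m N t) =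
      (t / N) * ∫ y, (D₁ y + Complex.I * D₂ y) ∂(gue m N t) := by
  have key : ∀ (w : SATuple m N) (D : SATuple m N → ℂ), ExpGrowth D →
      (∀ y, HasLineDerivAt ℝ F (D y) y w) →
      ∫ y, (inner ℝ w y : ℝ) • F y ∂(gue m N t) = (t / N : ℂ) * ∫ y, D y ∂(gue m N t) := by
    intro w D hD hd
    have := integral_inner_smul_gaussTilt (gue_rate_pos hN ht) w hF hD hd
    rw [← gue_eq_gaussTilt] at this
    rw [this, Complex.real_smul]
    congr 1
    push_cast
    have : (N : ℂ) ≠ 0 := by exact_mod_cast (by omega : N ≠ 0)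
    have : (t : ℂ) ≠ 0 := by exact_mod_cast ht.ne'
    field_simp
  have hI : ∀ w : SATuple m N, Integrable (fun y => (inner ℝ w y : ℝ) • F y) (gue m N t) :=
    fun w => ((ExpGrowth.inner w).smul hF).integrable_gue hN ht
  have h3 : ∀ y : SATuple m N, y.mat b i j * F y = (inner ℝ (unitRe b i j) y : ℝ) • F y +
      Complex.I * ((inner ℝ (unitIm b i j) y : ℝ) • F y) := by
    intro y
    rw [← inner_unitRe_add_inner_unitIm, Complex.real_smul, Complex.real_smul]
    ring
  simp only [h3]
  rw [integral_add (hI _) ((hI _).const_mul _), integral_const_mul, key _ D₁ h₁ hd₁,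
    key _ D₂ h₂ hd₂, integral_add (h₁.integrable_gue hN ht) ((h₂.integrable_gue hN ht).const_mul _),
    integral_const_mul]
  ring

theorem norm_le_exp_norm {E : Type*} [NormedAddCommGroup E] (y : E) : ‖y‖ ≤ Real.exp ‖y‖ := by
  linarith [Real.add_one_le_exp ‖y‖]

/-- Integration by parts against the transposed entry gives E[y_{ij} y_{ji}] = t/N, and there are
mN² such terms. -/
theorem integral_norm_sq_gue (hN : 1 ≤ N) (ht : 0 < t) :
    ∫ y, ‖y‖ ^ 2 ∂(gue m N t) = m * N * t := by
  have := isProbabilityMeasure_gue (m := m) hN ht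
  have hN' : (N : ℂ) ≠ 0 := by exact_mod_cast (by omega : N ≠ 0)
  have h1 : ∀ (b : Fin m) (i j : Fin N),
      ∫ y : SATuple m N, y.mat b i j * y.mat b j i ∂(gue m N t) = t / N := by
    intro b i j
    have h := integral_entry_mul_gue hN ht b i j (F := fun y : SATuple m N => y.mat b j i)
      (expGrowth_entry b j i) (ExpGrowth.const _) (ExpGrowth.const _)
      (fun y => (SATuple.entryCLM b j i).hasFDerivAt.hasLineDerivAt _)
      (fun y => (SATuple.entryCLM b j i).hasFDerivAt.hasLineDerivAt _)
    rw [h]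
    have e : (SATuple.entryCLM b j i) (unitRe b i j) + Complex.I *
        (SATuple.entryCLM b j i) (unitIm b i j) = 1 := by
      have := congrFun (congrFun (unitRe_add_unitIm_mat b b i j) j) i
      simpa using this
    simp only [e]
    simp
  have hint : ∀ (b : Fin m) (i j : Fin N),
      Integrable (fun y : SATuple m N => y.mat b i j * y.mat b j i) (gue m N t) := by
    exact fun b i j => ((expGrowth_entry b i j).mul (expGrowth_entry b j i)).integrable_gue hN ht
  have h2 : ∀ y : SATuple m N, ((‖y‖ ^ 2 : ℝ) : ℂ) =
      ∑ b : Fin m, ∑ i : Fin N, ∑ j : Fin N, y.mat b i j * y.mat b j i := by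
    intro y
    rw [SATuple.norm_sq_eq, Complex.ofReal_sum]
    refine Finset.sum_congr rfl fun b _ => ?_
    have h3 := SATuple.inner_single b (y b) y
    have h4 : Matrix.trace (y.mat b * y.mat b) = ((inner ℝ (SATuple.single b (y b)) y : ℝ) : ℂ) :=
      h3.symm
    rw [h4, Complex.ofReal_re, ← h4, Matrix.trace]
    simp only [Matrix.diag_apply, Matrix.mul_apply]
  rw [← Complex.ofReal_inj, ← integral_complex_ofReal]
  simp only [h2]
  rw [integral_finsetSum _ fun b _ => integrable_finsetSum _ fun i _ =>
    integrable_finsetSum _ fun j _ => hint b i j]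
  have h5 : ∀ b : Fin m, ∫ y : SATuple m N, ∑ i : Fin N, ∑ j : Fin N,
      y.mat b i j * y.mat b j i ∂(gue m N t) = N * t := by
    intro b
    rw [integral_finsetSum _ fun i _ => integrable_finsetSum _ fun j _ => hint b i j]
    have h6 : ∀ i : Fin N, ∫ y : SATuple m N, ∑ j : Fin N,
        y.mat b i j * y.mat b j i ∂(gue m N t) = t := by
      intro i
      rw [integral_finsetSum _ fun j _ => hint b i j]
      simp only [h1, Finset.sum_const, Finset.card_univ, Fintype.card_fin, nsmul_eq_mul]
      field_simp
    simp only [h6, Finset.sum_const, Finset.card_univ, Fintype.card_fin, nsmul_eq_mul]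
  simp only [h5, Finset.sum_const, Finset.card_univ, Fintype.card_fin, nsmul_eq_mul]
  push_cast
  ring

theorem integrable_norm_pow_gue (hN : 1 ≤ N) (ht : 0 < t) (k : ℕ) :
    Integrable (fun y => ‖y‖ ^ k) (gue m N t) := by
  refine integrable_gue_of_norm_le_exp hN ht (A := 1) (β := k) (by fun_prop) fun y => ?_
  rw [one_mul, Real.exp_nat_mul, norm_pow, norm_norm]
  have := norm_le_exp_norm y
  gcongr

/-- Nonnegativity of the variance of ‖y‖. -/
theorem integral_norm_gue_le (hN : 1 ≤ N) (ht : 0 < t) :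
    ∫ y, ‖y‖ ∂(gue m N t) ≤ Real.sqrt (m * N * t) := by
  have := isProbabilityMeasure_gue (m := m) hN ht
  have hi1 : Integrable (fun y : SATuple m N => ‖y‖) (gue m N t) := by
    simpa using integrable_norm_pow_gue (m := m) hN ht 1
  have hi2 := integrable_norm_pow_gue (m := m) hN ht 2
  refine Real.le_sqrt_of_sq_le ?_
  rw [← integral_norm_sq_gue hN ht]
  set a := ∫ y, ‖y‖ ∂(gue m N t) with ha
  have h0 : 0 ≤ ∫ y, (‖y‖ - a) ^ 2 ∂(gue m N t) := integral_nonneg fun y => sq_nonneg _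
  have h1 : ∫ y, (‖y‖ - a) ^ 2 ∂(gue m N t) = ∫ y, ‖y‖ ^ 2 ∂(gue m N t) - a ^ 2 := by
    have e : ∀ y : SATuple m N, (‖y‖ - a) ^ 2 = (‖y‖ ^ 2 - (2 * a) * ‖y‖) + a ^ 2 := fun y => by ring
    simp only [e]
    have e1 : Integrable (fun y : SATuple m N => ‖y‖ ^ 2 - (2 * a) * ‖y‖) (gue m N t) :=
      hi2.sub (hi1.const_mul _)
    rw [integral_add e1 (integrable_const _),
      integral_sub hi2 (hi1.const_mul _), integral_const_mul, ← ha]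
    simp
    ring
  linarith

theorem integrable_norm2_gue (hN : 1 ≤ N) (ht : 0 < t) :
    Integrable (fun y : SATuple m N => norm2 y.mat) (gue m N t) := by
  simp only [SATuple.norm2_mat]
  simpa using (integrable_norm_pow_gue (m := m) hN ht 1).const_mul (Real.sqrt N)⁻¹

theorem integral_norm2_gue_le (hN : 1 ≤ N) (ht : 0 < t) :
    ∫ y : SATuple m N, norm2 y.mat ∂(gue m N t) ≤ Real.sqrt (m * t) := by
  have hN' : (0 : ℝ) < N := by exact_mod_cast hN
  simp only [SATuple.norm2_mat]
  rw [integral_const_mul, inv_mul_le_iff₀ (Real.sqrt_pos.2 hN'), ← Real.sqrt_mul hN'.le]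
  refine (integral_norm_gue_le hN ht).trans (le_of_eq ?_)
  congr 1
  ring

theorem integral_norm2_sq_gue (hN : 1 ≤ N) (ht : 0 < t) :
    ∫ y : SATuple m N, norm2 y.mat ^ 2 ∂(gue m N t) = m * t := by
  have hN' : (0 : ℝ) < N := by exact_mod_cast hN
  simp only [SATuple.norm2_mat_sq]
  rw [integral_const_mul, integral_norm_sq_gue hN ht]
  field_simp

end GUE

/-! ### Operator norm, 2-norm and trace -/

section OperatorNorm

variable {m N : ℕ}

/-- The operator norm of a complex matrix. -/
def opn (A : Matrix (Fin N) (Fin N) ℂ) : ℝ := ‖Matrix.toEuclideanCLM (n := Fin N) (𝕜 := ℂ) A‖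

theorem opn_nonneg (A : Matrix (Fin N) (Fin N) ℂ) : 0 ≤ opn A := norm_nonneg _

theorem opn_mul_le (A B : Matrix (Fin N) (Fin N) ℂ) : opn (A * B) ≤ opn A * opn B := by
  simp only [opn, map_mul]
  exact norm_mul_le _ _

theorem opn_add_le (A B : Matrix (Fin N) (Fin N) ℂ) : opn (A + B) ≤ opn A + opn B := by
  simp only [opn, map_add]
  exact norm_add_le _ _

theorem opn_smul (r : ℂ) (A : Matrix (Fin N) (Fin N) ℂ) : opn (r • A) = ‖r‖ * opn A := by
  simp only [opn, map_smul, norm_smul]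

theorem opn_one_le : opn (1 : Matrix (Fin N) (Fin N) ℂ) ≤ 1 := by
  rw [opn, map_one]
  exact ContinuousLinearMap.norm_id_le

theorem opn_conjTranspose (A : Matrix (Fin N) (Fin N) ℂ) : opn A.conjTranspose = opn A := by
  rw [opn, ← Matrix.star_eq_conjTranspose, map_star, ContinuousLinearMap.star_eq_adjoint,
    LinearIsometryEquiv.norm_map, opn]

theorem norm_toEuclideanCLM_apply_le (A : Matrix (Fin N) (Fin N) ℂ) (v : EuclideanSpace ℂ (Fin N)) :
    ‖Matrix.toEuclideanCLM (n := Fin N) (𝕜 := ℂ) A v‖ ≤ opn A * ‖v‖ :=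
  ContinuousLinearMap.le_opNorm _ _

theorem toEuclideanCLM_single (A : Matrix (Fin N) (Fin N) ℂ) (i j : Fin N) :
    (Matrix.toEuclideanCLM (n := Fin N) (𝕜 := ℂ) A (EuclideanSpace.single j 1)) i = A i j := by
  have := Matrix.ofLp_toEuclideanCLM (𝕜 := ℂ) A (EuclideanSpace.single j 1)
  rw [this]
  simp [Matrix.mulVec, dotProduct]

theorem norm_entry_le_opn (A : Matrix (Fin N) (Fin N) ℂ) (i j : Fin N) : ‖A i j‖ ≤ opn A := by
  rw [← toEuclideanCLM_single A i j]
  refine (PiLp.norm_apply_le _ i).trans ?_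
  simpa using norm_toEuclideanCLM_apply_le A (EuclideanSpace.single j 1)

theorem norm_normTrace_le (A : Matrix (Fin N) (Fin N) ℂ) : ‖normTrace N A‖ ≤ opn A := by
  simp only [normTrace, LinearMap.smul_apply, Matrix.traceLinearMap_apply, smul_eq_mul, norm_mul,
    norm_inv, Complex.norm_natCast, Matrix.trace, Matrix.diag_apply]
  rcases Nat.eq_zero_or_pos N with h | h
  · subst h
    simpa using opn_nonneg A
  · rw [inv_mul_le_iff₀ (by exact_mod_cast h)]
    refine (norm_sum_le _ _).trans ((Finset.sum_le_sum fun i _ => norm_entry_le_opn A i i).trans ?_)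
    simp

theorem opn_le_normInf (y : Fin m → Matrix (Fin N) (Fin N) ℂ) (j : Fin m) : opn (y j) ≤ normInf y :=
  le_ciSup (f := fun j => ‖Matrix.toEuclideanCLM (n := Fin N) (𝕜 := ℂ) (y j)‖)
    (Set.finite_range _).bddAbove j

theorem normInf_nonneg (y : Fin m → Matrix (Fin N) (Fin N) ℂ) : 0 ≤ normInf y :=
  Real.iSup_nonneg fun _ => norm_nonneg _

theorem normInf_le {y : Fin m → Matrix (Fin N) (Fin N) ℂ} {R : ℝ} (hR : 0 ≤ R)
    (h : ∀ j, opn (y j) ≤ R) : normInf y ≤ R := Real.iSup_le h hR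

theorem normInf_add_le (x y : Fin m → Matrix (Fin N) (Fin N) ℂ) :
    normInf (x + y) ≤ normInf x + normInf y :=
  normInf_le (add_nonneg (normInf_nonneg _) (normInf_nonneg _)) fun j =>
    (opn_add_le _ _).trans (add_le_add (opn_le_normInf x j) (opn_le_normInf y j))

theorem norm2_le_normInf (y : Fin m → Matrix (Fin N) (Fin N) ℂ) :
    norm2 y ≤ Real.sqrt m * normInf y := by
  rw [norm2]
  refine Real.sqrt_le_iff.2 ⟨mul_nonneg (Real.sqrt_nonneg _) (normInf_nonneg _), ?_⟩
  rw [mul_pow, Real.sq_sqrt (by positivity)]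
  have h : ∀ j, (normTrace N ((y j).conjTranspose * y j)).re ≤ normInf y ^ 2 := by
    intro j
    refine (Complex.re_le_norm _).trans ((norm_normTrace_le _).trans ((opn_mul_le _ _).trans ?_))
    rw [opn_conjTranspose, sq]
    have := opn_le_normInf y j
    have := opn_nonneg (y j)
    have := normInf_nonneg y
    gcongr
  refine (Finset.sum_le_sum fun j _ => h j).trans ?_
  simp

/-- Cauchy–Schwarz: the Hilbert–Schmidt norm dominates the operator norm. -/
theorem opn_le_norm (x : SATuple m N) (j : Fin m) : opn (x.mat j) ≤ ‖x‖ := by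
  have h : opn (x.mat j) ≤ ‖tupleVec (fun _ : Fin 1 => x.mat j)‖ := by
    refine ContinuousLinearMap.opNorm_le_bound _ (norm_nonneg _) fun v => ?_
    rw [EuclideanSpace.norm_eq, EuclideanSpace.norm_eq, EuclideanSpace.norm_eq,
      ← Real.sqrt_mul (by positivity)]
    refine Real.sqrt_le_sqrt ?_
    rw [Fintype.sum_prod_type]
    simp only [Finset.univ_unique, Finset.sum_singleton, Fintype.sum_prod_type, Finset.sum_mul,
      tupleVec, Matrix.ofLp_toEuclideanCLM, Matrix.mulVec, dotProduct]
    refine Finset.sum_le_sum fun i _ => ?_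
    calc ‖∑ k, x.mat j i k * v k‖ ^ 2 ≤ (∑ k, ‖x.mat j i k‖ * ‖v k‖) ^ 2 := by
          gcongr
          refine (norm_sum_le _ _).trans (le_of_eq ?_)
          simp only [norm_mul]
      _ ≤ (∑ k, ‖x.mat j i k‖ ^ 2) * ∑ k, ‖v k‖ ^ 2 := Finset.sum_mul_sq_le_sq_mul_sq _ _ _
      _ = _ := by rw [Finset.sum_mul]
  refine h.trans ?_
  rw [SATuple.norm_eq_norm_tupleVec, EuclideanSpace.norm_eq, EuclideanSpace.norm_eq]
  refine Real.sqrt_le_sqrt ?_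
  rw [Fintype.sum_prod_type, Fintype.sum_prod_type]
  simp only [Finset.univ_unique, Finset.sum_singleton]
  exact Finset.single_le_sum (f := fun j => ∑ p : Fin N × Fin N, ‖tupleVec x.mat (j, p)‖ ^ 2)
    (fun j _ => Finset.sum_nonneg fun _ _ => by positivity) (Finset.mem_univ j)

theorem normInf_le_norm (x : SATuple m N) : normInf x.mat ≤ ‖x‖ :=
  normInf_le (norm_nonneg _) (opn_le_norm x)

theorem continuous_toEuclideanCLM_mat (j : Fin m) : Continuous fun x : SATuple m N =>
    Matrix.toEuclideanCLM (n := Fin N) (𝕜 := ℂ) (x.mat j) :=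
  LinearMap.continuous_of_finiteDimensional
    ({ toFun := fun x => Matrix.toEuclideanCLM (n := Fin N) (𝕜 := ℂ) (x.mat j)
       map_add' := fun x y => by rw [SATuple.mat_add, Pi.add_apply, map_add]
       map_smul' := fun r x => by
        rw [SATuple.mat_smul, Pi.smul_apply]
        exact (Matrix.toEuclideanCLM (n := Fin N) (𝕜 := ℂ)).toAlgEquiv.toLinearMap.map_smul_of_tower
          r (x.mat j) } :
      SATuple m N →ₗ[ℝ] (EuclideanSpace ℂ (Fin N) →L[ℂ] EuclideanSpace ℂ (Fin N)))

theorem continuous_opn_mat (j : Fin m) : Continuous fun x : SATuple m N => opn (x.mat j) :=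
  (continuous_toEuclideanCLM_mat j).norm

end OperatorNorm

/-! ### Uniform bounds and closure properties of trace polynomials -/

section TracePolynomials

variable {m : ℕ}

theorem evalNC_ι {N : ℕ} (x : SATuple m N) (j : Fin m) :
    evalNC x (FreeAlgebra.ι ℂ j) = x.mat j := by simp [evalNC]

theorem eval0_ι_mk {N : ℕ} (x : SATuple m N) (p : NCPoly m) :
    eval0 x (SymmetricAlgebra.ι ℂ _ ((commutatorSpan m).mkQ p)) = normTrace N (evalNC x p) := by
  simp [eval0, evalTau, SymmetricAlgebra.lift_ι_apply]

theorem eval1_tmul {N : ℕ} (x : SATuple m N) (a : TrP0 m) (p : NCPoly m) :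
    eval1 x (a ⊗ₜ p) = eval0 x a • evalNC x p := by
  refine (Algebra.TensorProduct.lift_tmul
    ((Algebra.ofId ℂ (Matrix (Fin N) (Fin N) ℂ)).comp (eval0 x)) (evalNC x)
    (fun f p => Algebra.commutes (eval0 x f) (evalNC x p)) a p).trans ?_
  rw [AlgHom.comp_apply, Algebra.ofId_apply, Algebra.algebraMap_eq_smul_one, smul_mul_assoc,
    one_mul]

theorem TrP0.induction_mk {P : TrP0 m → Prop} (h0 : ∀ r : ℂ, P (algebraMap ℂ _ r))
    (h1 : ∀ p : NCPoly m, P (SymmetricAlgebra.ι ℂ _ ((commutatorSpan m).mkQ p)))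
    (hm : ∀ a b, P a → P b → P (a * b)) (ha : ∀ a b, P a → P b → P (a + b)) (f : TrP0 m) : P f := by
  induction f using SymmetricAlgebra.induction with
  | algebraMap r => exact h0 r
  | ι q =>
    obtain ⟨p, rfl⟩ := (commutatorSpan m).mkQ_surjective q
    exact h1 p
  | mul a b h h' => exact hm a b h h'
  | add a b h h' => exact ha a b h h'

/-- That A and d do not depend on N is the point: trace polynomials are then bounded on
operator-norm balls uniformly in N. -/
theorem NCPoly.exists_opn_evalNC_le (p : NCPoly m) : ∃ A : ℝ, 0 ≤ A ∧ ∃ d : ℕ,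
    ∀ N (x : SATuple m N), opn (evalNC x p) ≤ A * (1 + normInf x.mat) ^ d := by
  induction p using FreeAlgebra.induction with
  | grade0 r =>
    refine ⟨‖r‖, norm_nonneg _, 0, fun N x => ?_⟩
    rw [AlgHom.commutes, Algebra.algebraMap_eq_smul_one, opn_smul, pow_zero]
    exact mul_le_mul_of_nonneg_left opn_one_le (norm_nonneg _)
  | grade1 j =>
    refine ⟨1, zero_le_one, 1, fun N x => ?_⟩
    rw [evalNC_ι, pow_one, one_mul]
    linarith [opn_le_normInf x.mat j]
  | mul a b ha hb =>
    obtain ⟨A, hA, d, h⟩ := ha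
    obtain ⟨B, hB, e, h'⟩ := hb
    refine ⟨A * B, mul_nonneg hA hB, d + e, fun N x => ?_⟩
    rw [map_mul, pow_add, mul_mul_mul_comm]
    have := normInf_nonneg x.mat
    exact (opn_mul_le _ _).trans (mul_le_mul (h N x) (h' N x) (opn_nonneg _) (by positivity))
  | add a b ha hb =>
    obtain ⟨A, hA, d, h⟩ := ha
    obtain ⟨B, hB, e, h'⟩ := hb
    refine ⟨A + B, add_nonneg hA hB, d + e, fun N x => ?_⟩
    have h1 : 1 ≤ 1 + normInf x.mat := by linarith [normInf_nonneg x.mat]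
    have h2 := pow_le_pow_right₀ h1 (Nat.le_add_right d e)
    have h3 := pow_le_pow_right₀ h1 (Nat.le_add_left e d)
    rw [map_add, add_mul]
    exact (opn_add_le _ _).trans (add_le_add ((h N x).trans (mul_le_mul_of_nonneg_left h2 hA))
      ((h' N x).trans (mul_le_mul_of_nonneg_left h3 hB)))

theorem TrP0.exists_norm_eval0_le (f : TrP0 m) : ∃ A : ℝ, 0 ≤ A ∧ ∃ d : ℕ,
    ∀ N (x : SATuple m N), ‖eval0 x f‖ ≤ A * (1 + normInf x.mat) ^ d := by
  induction f using TrP0.induction_mk with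
  | h0 r => exact ⟨‖r‖, norm_nonneg _, 0, fun N x => by simp⟩
  | h1 p =>
    obtain ⟨A, hA, d, h⟩ := NCPoly.exists_opn_evalNC_le p
    refine ⟨A, hA, d, fun N x => ?_⟩
    rw [eval0_ι_mk]
    exact (norm_normTrace_le _).trans (h N x)
  | hm a b ha hb =>
    obtain ⟨A, hA, d, h⟩ := ha
    obtain ⟨B, hB, e, h'⟩ := hb
    refine ⟨A * B, mul_nonneg hA hB, d + e, fun N x => ?_⟩
    rw [map_mul, pow_add, mul_mul_mul_comm, norm_mul]
    have := normInf_nonneg x.mat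
    exact mul_le_mul (h N x) (h' N x) (norm_nonneg _) (by positivity)
  | ha a b ha hb =>
    obtain ⟨A, hA, d, h⟩ := ha
    obtain ⟨B, hB, e, h'⟩ := hb
    refine ⟨A + B, add_nonneg hA hB, d + e, fun N x => ?_⟩
    have h1 : 1 ≤ 1 + normInf x.mat := by linarith [normInf_nonneg x.mat]
    have h2 := pow_le_pow_right₀ h1 (Nat.le_add_right d e)
    have h3 := pow_le_pow_right₀ h1 (Nat.le_add_left e d)
    rw [map_add, add_mul]
    exact (norm_add_le _ _).trans (add_le_add ((h N x).trans (mul_le_mul_of_nonneg_left h2 hA))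
      ((h' N x).trans (mul_le_mul_of_nonneg_left h3 hB)))

theorem TrP0.exists_bound (f : TrP0 m) {R : ℝ} :
    ∃ B : ℝ, 0 ≤ B ∧ ∀ N (x : SATuple m N), normInf x.mat ≤ R → ‖eval0 x f‖ ≤ B := by
  obtain ⟨A, hA, d, h⟩ := f.exists_norm_eval0_le
  refine ⟨A * (1 + |R|) ^ d, by positivity, fun N x hx => (h N x).trans ?_⟩
  have := normInf_nonneg x.mat
  have := hx.trans (le_abs_self R)
  gcongr

theorem TrP1.exists_bound (f : TrP1 m) {R : ℝ} :
    ∃ B : ℝ, 0 ≤ B ∧ ∀ N (x : SATuple m N), normInf x.mat ≤ R → opn (eval1 x f) ≤ B := by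
  induction f using TensorProduct.induction_on with
  | zero => exact ⟨0, le_rfl, fun N x _ => by simp [opn]⟩
  | tmul a p =>
    obtain ⟨B, hB, h⟩ := TrP0.exists_bound a (R := R)
    obtain ⟨A, hA, d, h'⟩ := NCPoly.exists_opn_evalNC_le p
    refine ⟨B * (A * (1 + |R|) ^ d), by positivity, fun N x hx => ?_⟩
    rw [eval1_tmul, opn_smul]
    refine mul_le_mul (h N x hx) ((h' N x).trans ?_) (opn_nonneg _) hB
    have := normInf_nonneg x.mat
    have := hx.trans (le_abs_self R)
    gcongr
  | add a b ha hb =>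
    obtain ⟨A, hA, h⟩ := ha
    obtain ⟨B, hB, h'⟩ := hb
    refine ⟨A + B, add_nonneg hA hB, fun N x hx => ?_⟩
    rw [map_add]
    exact (opn_add_le _ _).trans (add_le_add (h N x hx) (h' N x hx))

theorem TrP1.exists_bound_tuple (f : Fin m → TrP1 m) {R : ℝ} :
    ∃ B : ℝ, 0 ≤ B ∧ ∀ N (x : SATuple m N), normInf x.mat ≤ R →
      normInf (fun j => eval1 x (f j)) ≤ B := by
  choose B hB h using fun j => TrP1.exists_bound (f j) (R := R)
  have h0 : 0 ≤ ∑ j, B j := Finset.sum_nonneg fun j _ => hB j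
  refine ⟨∑ j, B j, h0, fun N x hx => normInf_le h0 fun j => (h j N x hx).trans ?_⟩
  exact Finset.single_le_sum (fun j _ => hB j) (Finset.mem_univ j)

theorem NCPoly.exists_star (p : NCPoly m) : ∃ q : NCPoly m, ∀ N (x : SATuple m N),
    evalNC x q = (evalNC x p).conjTranspose := by
  induction p using FreeAlgebra.induction with
  | grade0 r =>
    refine ⟨algebraMap ℂ _ (star r), fun N x => ?_⟩
    simp [Algebra.algebraMap_eq_smul_one]
  | grade1 j => exact ⟨FreeAlgebra.ι ℂ j, fun N x => by rw [evalNC_ι, x.mat_conjTranspose]⟩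
  | mul a b ha hb =>
    obtain ⟨p, hp⟩ := ha
    obtain ⟨q, hq⟩ := hb
    exact ⟨q * p, fun N x => by rw [map_mul, map_mul, Matrix.conjTranspose_mul, hp, hq]⟩
  | add a b ha hb =>
    obtain ⟨p, hp⟩ := ha
    obtain ⟨q, hq⟩ := hb
    exact ⟨p + q, fun N x => by rw [map_add, map_add, Matrix.conjTranspose_add, hp, hq]⟩

theorem TrP0.exists_star (f : TrP0 m) : ∃ g : TrP0 m, ∀ N (x : SATuple m N),
    eval0 x g = star (eval0 x f) := by
  induction f using TrP0.induction_mk with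
  | h0 r => exact ⟨algebraMap ℂ _ (star r), fun N x => by simp⟩
  | h1 p =>
    obtain ⟨q, hq⟩ := NCPoly.exists_star p
    refine ⟨SymmetricAlgebra.ι ℂ _ ((commutatorSpan m).mkQ q), fun N x => ?_⟩
    rw [eval0_ι_mk, eval0_ι_mk, hq]
    simp [normTrace, Matrix.trace_conjTranspose]
  | hm a b ha hb =>
    obtain ⟨p, hp⟩ := ha
    obtain ⟨q, hq⟩ := hb
    exact ⟨p * q, fun N x => by rw [map_mul, map_mul, star_mul', hp, hq]⟩
  | ha a b ha hb =>
    obtain ⟨p, hp⟩ := ha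
    obtain ⟨q, hq⟩ := hb
    exact ⟨p + q, fun N x => by rw [map_add, map_add, star_add, hp, hq]⟩

theorem TrP1.exists_star (f : TrP1 m) : ∃ g : TrP1 m, ∀ N (x : SATuple m N),
    eval1 x g = (eval1 x f).conjTranspose := by
  induction f using TensorProduct.induction_on with
  | zero => exact ⟨0, fun N x => by simp⟩
  | tmul a p =>
    obtain ⟨q, hq⟩ := NCPoly.exists_star p
    obtain ⟨b, hb⟩ := TrP0.exists_star a
    exact ⟨b ⊗ₜ q, fun N x => by
      rw [eval1_tmul, eval1_tmul, Matrix.conjTranspose_smul, hq, hb]⟩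
  | add a b ha hb =>
    obtain ⟨p, hp⟩ := ha
    obtain ⟨q, hq⟩ := hb
    exact ⟨p + q, fun N x => by rw [map_add, map_add, Matrix.conjTranspose_add, hp, hq]⟩

theorem TrP1.exists_normTrace (f : TrP1 m) : ∃ g : TrP0 m, ∀ N (x : SATuple m N),
    eval0 x g = normTrace N (eval1 x f) := by
  induction f using TensorProduct.induction_on with
  | zero => exact ⟨0, fun N x => by simp⟩
  | tmul a p =>
    exact ⟨a * SymmetricAlgebra.ι ℂ _ ((commutatorSpan m).mkQ p), fun N x => by
      rw [eval1_tmul, map_mul, eval0_ι_mk, map_smul, smul_eq_mul]⟩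
  | add a b ha hb =>
    obtain ⟨p, hp⟩ := ha
    obtain ⟨q, hq⟩ := hb
    exact ⟨p + q, fun N x => by rw [map_add, map_add, map_add, hp, hq]⟩

/-- Evaluation makes sense only at self-adjoint tuples, so substitution is phrased through a
self-adjoint z whose components are values of g. A single q must serve all N. -/
theorem NCPoly.exists_subst (g : Fin m → TrP1 m) (p : NCPoly m) : ∃ q : TrP1 m,
    ∀ N (x z : SATuple m N), (∀ j, z.mat j = eval1 x (g j)) → evalNC z p = eval1 x q := by
  induction p using FreeAlgebra.induction with
  | grade0 r =>
    exact ⟨algebraMap ℂ _ r, fun N x z _ => by rw [AlgHom.commutes, AlgHom.commutes]⟩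
  | grade1 j => exact ⟨g j, fun N x z h => by rw [evalNC_ι, h]⟩
  | mul a b ha hb =>
    obtain ⟨p, hp⟩ := ha
    obtain ⟨q, hq⟩ := hb
    exact ⟨p * q, fun N x z h => by rw [map_mul, map_mul, hp N x z h, hq N x z h]⟩
  | add a b ha hb =>
    obtain ⟨p, hp⟩ := ha
    obtain ⟨q, hq⟩ := hb
    exact ⟨p + q, fun N x z h => by rw [map_add, map_add, hp N x z h, hq N x z h]⟩

theorem TrP0.exists_subst (g : Fin m → TrP1 m) (f : TrP0 m) : ∃ q : TrP0 m,
    ∀ N (x z : SATuple m N), (∀ j, z.mat j = eval1 x (g j)) → eval0 z f = eval0 x q := by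
  induction f using TrP0.induction_mk with
  | h0 r => exact ⟨algebraMap ℂ _ r, fun N x z _ => by rw [AlgHom.commutes, AlgHom.commutes]⟩
  | h1 p =>
    obtain ⟨q, hq⟩ := NCPoly.exists_subst g p
    obtain ⟨a, ha⟩ := TrP1.exists_normTrace q
    exact ⟨a, fun N x z h => by rw [eval0_ι_mk, hq N x z h, ha]⟩
  | hm a b ha hb =>
    obtain ⟨p, hp⟩ := ha
    obtain ⟨q, hq⟩ := hb
    exact ⟨p * q, fun N x z h => by rw [map_mul, map_mul, hp N x z h, hq N x z h]⟩
  | ha a b ha hb =>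
    obtain ⟨p, hp⟩ := ha
    obtain ⟨q, hq⟩ := hb
    exact ⟨p + q, fun N x z h => by rw [map_add, map_add, hp N x z h, hq N x z h]⟩

theorem TrP1.exists_subst (g : Fin m → TrP1 m) (f : TrP1 m) : ∃ q : TrP1 m,
    ∀ N (x z : SATuple m N), (∀ j, z.mat j = eval1 x (g j)) → eval1 z f = eval1 x q := by
  induction f using TensorProduct.induction_on with
  | zero => exact ⟨0, fun N x z _ => by simp⟩
  | tmul a p =>
    obtain ⟨q, hq⟩ := NCPoly.exists_subst g p
    obtain ⟨b, hb⟩ := TrP0.exists_subst g a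
    exact ⟨(b ⊗ₜ 1) * q, fun N x z h => by
      rw [eval1_tmul, map_mul, eval1_tmul, map_one, smul_mul_assoc, one_mul, hq N x z h,
        hb N x z h]⟩
  | add a b ha hb =>
    obtain ⟨p, hp⟩ := ha
    obtain ⟨q, hq⟩ := hb
    exact ⟨p + q, fun N x z h => by rw [map_add, map_add, hp N x z h, hq N x z h]⟩

end TracePolynomials

/-! ### Asymptotic approximability: reformulation, limits, composition -/

section AsymptoticApproximation

variable {m : ℕ}

/-- Trades the limsup in [0, ∞] for an eventual pointwise bound; the quantifier over ε pays for the
strict inequality this requires. -/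
theorem forall_exists_limsup_iSup_le_iff {ι : Type*} {X : ℕ → Type*} (S : ∀ N, Set (X N))
    (d : ι → ∀ N, X N → ℝ) :
    (∀ ε > (0 : ℝ), ∃ i, limsup (fun N => ⨆ x : X N, ⨆ _ : x ∈ S N, ENNReal.ofReal (d i N x))
      atTop ≤ ENNReal.ofReal ε) ↔
    ∀ ε > (0 : ℝ), ∃ i, ∀ᶠ N in atTop, ∀ x ∈ S N, d i N x ≤ ε := by
  constructor
  · intro h ε hε
    obtain ⟨i, hi⟩ := h (ε / 2) (half_pos hε)
    refine ⟨i, ?_⟩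
    have hlt := hi.trans_lt ((ENNReal.ofReal_lt_ofReal_iff hε).2 (half_lt_self hε))
    filter_upwards [eventually_lt_of_limsup_lt hlt] with N hN x hx
    have h1 : ENNReal.ofReal (d i N x) ≤
        ⨆ x : X N, ⨆ _ : x ∈ S N, ENNReal.ofReal (d i N x) :=
      le_iSup₂ (f := fun x (_ : x ∈ S N) => ENNReal.ofReal (d i N x)) x hx
    exact (ENNReal.ofReal_le_ofReal_iff hε.le).1 (h1.trans hN.le)
  · intro h ε hε
    obtain ⟨i, hi⟩ := h ε hε
    refine ⟨i, limsup_le_of_le (by isBoundedDefault) ?_⟩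
    filter_upwards [hi] with N hN
    exact iSup₂_le fun x hx => ENNReal.ofReal_le_ofReal (hN x hx)

theorem asympApproxOp_iff {φ : ∀ N, SATuple m N → Fin m → Matrix (Fin N) (Fin N) ℂ} :
    AsympApproxOp φ ↔ ∀ R > (0 : ℝ), ∀ ε > (0 : ℝ), ∃ f : Fin m → TrP1 m, ∀ᶠ N in atTop,
      ∀ x : SATuple m N, normInf x.mat ≤ R → norm2 (fun j => φ N x j - eval1 x (f j)) ≤ ε := by
  have h := fun R : ℝ => forall_exists_limsup_iSup_le_iff
    (fun N => {x : SATuple m N | normInf x.mat ≤ R})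
    (fun (f : Fin m → TrP1 m) N x => norm2 (fun j => φ N x j - eval1 x (f j)))
  constructor
  · intro hφ R hR
    exact (h R).1 fun ε hε => hφ ε hε R hR
  · intro hφ ε hε R hR
    exact (h R).2 (hφ R hR) ε hε

theorem asympApproxScalar_iff {φ : ∀ N, SATuple m N → ℂ} :
    AsympApproxScalar φ ↔ ∀ R > (0 : ℝ), ∀ ε > (0 : ℝ), ∃ f : TrP0 m, ∀ᶠ N in atTop,
      ∀ x : SATuple m N, normInf x.mat ≤ R → ‖φ N x - eval0 x f‖ ≤ ε := by
  have h := fun R : ℝ => forall_exists_limsup_iSup_le_iff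
    (fun N => {x : SATuple m N | normInf x.mat ≤ R})
    (fun (f : TrP0 m) N x => ‖φ N x - eval0 x f‖)
  constructor
  · intro hφ R hR
    exact (h R).1 fun ε hε => hφ ε hε R hR
  · intro hφ ε hε R hR
    exact (h R).2 (hφ R hR) ε hε

/-- Uniformity is needed only on each operator-norm ball, and ψ may depend on R and ε. -/
theorem AsympApproxOp.of_uniform_limit {φ : ∀ N, SATuple m N → Fin m → Matrix (Fin N) (Fin N) ℂ}
    (h : ∀ R > (0 : ℝ), ∀ ε > (0 : ℝ), ∃ ψ : ∀ N, SATuple m N → Fin m → Matrix (Fin N) (Fin N) ℂ,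
      AsympApproxOp ψ ∧ ∀ᶠ N in atTop, ∀ x : SATuple m N, normInf x.mat ≤ R →
        norm2 (φ N x - ψ N x) ≤ ε) : AsympApproxOp φ := by
  rw [asympApproxOp_iff]
  intro R hR ε hε
  obtain ⟨ψ, hψ, hd⟩ := h R hR (ε / 2) (half_pos hε)
  obtain ⟨f, hf⟩ := asympApproxOp_iff.1 hψ R hR (ε / 2) (half_pos hε)
  refine ⟨f, ?_⟩
  filter_upwards [hd, hf] with N h1 h2 x hx
  have := norm2_sub_le (φ N x) (ψ N x) (fun j => eval1 x (f j))
  have h3 : norm2 (ψ N x - fun j => eval1 x (f j)) ≤ ε / 2 := h2 x hx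
  exact this.trans (by linarith [h1 x hx])

theorem AsympApproxScalar.of_uniform_limit {φ : ∀ N, SATuple m N → ℂ}
    (h : ∀ R > (0 : ℝ), ∀ ε > (0 : ℝ), ∃ ψ : ∀ N, SATuple m N → ℂ,
      AsympApproxScalar ψ ∧ ∀ᶠ N in atTop, ∀ x : SATuple m N, normInf x.mat ≤ R →
        ‖φ N x - ψ N x‖ ≤ ε) : AsympApproxScalar φ := by
  rw [asympApproxScalar_iff]
  intro R hR ε hε
  obtain ⟨ψ, hψ, hd⟩ := h R hR (ε / 2) (half_pos hε)
  obtain ⟨f, hf⟩ := asympApproxScalar_iff.1 hψ R hR (ε / 2) (half_pos hε)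
  refine ⟨f, ?_⟩
  filter_upwards [hd, hf] with N h1 h2 x hx
  linarith [h1 x hx, h2 x hx, norm_sub_le_norm_sub_add_norm_sub (φ N x) (ψ N x) (eval0 x f)]

theorem AsympApproxOp.exists_bound {φ : ∀ N, SATuple m N → Fin m → Matrix (Fin N) (Fin N) ℂ}
    (h : AsympApproxOp φ) {R : ℝ} (hR : 0 < R) : ∃ B : ℝ, 0 ≤ B ∧ ∀ᶠ N in atTop,
      ∀ x : SATuple m N, normInf x.mat ≤ R → norm2 (φ N x) ≤ B := by
  obtain ⟨f, hf⟩ := asympApproxOp_iff.1 h R hR 1 one_pos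
  obtain ⟨B, hB, hfB⟩ := TrP1.exists_bound_tuple f (R := R)
  refine ⟨1 + Real.sqrt m * B, by positivity, ?_⟩
  filter_upwards [hf] with N hN x hx
  have h1 := hN x hx
  have h2 := norm2_le_normInf (fun j => eval1 x (f j))
  have h3 := hfB N x hx
  have h4 : norm2 (φ N x) ≤ norm2 (fun j => φ N x j - eval1 x (f j)) +
      norm2 (fun j => eval1 x (f j)) := by
    have := norm2_add_le (fun j => φ N x j - eval1 x (f j)) (fun j => eval1 x (f j))
    refine le_trans (le_of_eq ?_) this
    congr 1
    funext j
    simp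
  have h5 := mul_le_mul_of_nonneg_left h3 (Real.sqrt_nonneg m)
  linarith

theorem AsympApproxScalar.exists_bound {φ : ∀ N, SATuple m N → ℂ}
    (h : AsympApproxScalar φ) {R : ℝ} (hR : 0 < R) : ∃ B : ℝ, 0 ≤ B ∧ ∀ᶠ N in atTop,
      ∀ x : SATuple m N, normInf x.mat ≤ R → ‖φ N x‖ ≤ B := by
  obtain ⟨f, hf⟩ := asympApproxScalar_iff.1 h R hR 1 one_pos
  obtain ⟨B, hB, hfB⟩ := TrP0.exists_bound f (R := R)
  refine ⟨1 + B, by positivity, ?_⟩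
  filter_upwards [hf] with N hN x hx
  have h1 := hN x hx
  have h3 := hfB N x hx
  have h4 := norm_add_le (φ N x - eval0 x f) (eval0 x f)
  rw [sub_add_cancel] at h4
  linarith

theorem asympApproxOp_id : AsympApproxOp fun N (x : SATuple m N) => x.mat := by
  rw [asympApproxOp_iff]
  intro R _ ε hε
  refine ⟨fun j => 1 ⊗ₜ FreeAlgebra.ι ℂ j, Eventually.of_forall fun N x _ => ?_⟩
  simp only [eval1_tmul, map_one, one_smul, evalNC_ι, sub_self]
  have : norm2 (0 : Fin m → Matrix (Fin N) (Fin N) ℂ) = 0 := by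
    simpa using norm2_smul 0 x.mat
  exact this.le.trans hε.le

theorem AsympApproxOp.sub_smul {φ ψ : ∀ N, SATuple m N → Fin m → Matrix (Fin N) (Fin N) ℂ}
    (hφ : AsympApproxOp φ) (hψ : AsympApproxOp ψ) (r : ℂ) :
    AsympApproxOp fun N x => φ N x - r • ψ N x := by
  rw [asympApproxOp_iff]
  intro R hR ε hε
  obtain ⟨f, hf⟩ := asympApproxOp_iff.1 hφ R hR (ε / 2) (half_pos hε)
  obtain ⟨g, hg⟩ := asympApproxOp_iff.1 hψ R hR (ε / 2 / (‖r‖ + 1)) (by positivity)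
  refine ⟨fun j => f j - r • g j, ?_⟩
  filter_upwards [hf, hg] with N h1 h2 x hx
  have e : (fun j => (φ N x - r • ψ N x) j - eval1 x (f j - r • g j)) =
      (fun j => φ N x j - eval1 x (f j)) + (-r) • fun j => ψ N x j - eval1 x (g j) := by
    funext j
    change (φ N x j - r • ψ N x j) - eval1 x (f j - r • g j) =
      (φ N x j - eval1 x (f j)) + (-r) • (ψ N x j - eval1 x (g j))
    rw [map_sub, map_smul, neg_smul, smul_sub]
    abel
  rw [e]
  refine (norm2_add_le _ _).trans ?_
  rw [norm2_smul, norm_neg]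
  have h3 := mul_le_mul_of_nonneg_left (h2 x hx) (norm_nonneg r)
  have h4 : ‖r‖ * (ε / 2 / (‖r‖ + 1)) ≤ ε / 2 := by
    rw [mul_div_assoc', div_le_iff₀ (by positivity)]
    nlinarith [norm_nonneg r]
  linarith [h1 x hx]

/-- An approximable sequence of self-adjoint tuples is approximable by trace polynomials with
self-adjoint values. -/
theorem AsympApproxOp.exists_selfAdjoint {ψ : ∀ N, SATuple m N → SATuple m N}
    (hψ : AsympApproxOp fun N x => (ψ N x).mat) {R ε : ℝ} (hR : 0 < R) (hε : 0 < ε) :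
    ∃ (g : Fin m → TrP1 m) (z : ∀ N, SATuple m N → SATuple m N),
      (∀ N x j, (z N x).mat j = eval1 x (g j)) ∧
      ∀ᶠ N in atTop, ∀ x : SATuple m N, normInf x.mat ≤ R → norm2 (ψ N x - z N x).mat ≤ ε := by
  obtain ⟨f, hf⟩ := asympApproxOp_iff.1 hψ R hR ε hε
  choose f' hf' using fun j => TrP1.exists_star (f j)
  let g : Fin m → TrP1 m := fun j => (1 / 2 : ℂ) • (f j + f' j)
  have hg : ∀ N (x : SATuple m N) j, eval1 x (g j) =
      (1 / 2 : ℂ) • (eval1 x (f j) + (eval1 x (f j)).conjTranspose) := by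
    intro N x j
    simp only [g, map_smul, map_add, hf']
  have hsa : ∀ N (x : SATuple m N) j, IsSelfAdjoint (eval1 x (g j)) := by
    intro N x j
    rw [hg, isSelfAdjoint_iff, Matrix.star_eq_conjTranspose, Matrix.conjTranspose_smul,
      Matrix.conjTranspose_add, Matrix.conjTranspose_conjTranspose, add_comm]
    simp
  let z : ∀ N, SATuple m N → SATuple m N := fun N x j => ⟨eval1 x (g j), hsa N x j⟩
  refine ⟨g, z, fun N x j => rfl, ?_⟩
  filter_upwards [hf] with N hN x hx
  have h1 := hN x hx
  have e : (ψ N x - z N x).mat =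
      (1 / 2 : ℂ) • (fun j => (ψ N x).mat j - eval1 x (f j)) +
      (1 / 2 : ℂ) • (fun j => ((ψ N x).mat j - eval1 x (f j)).conjTranspose) := by
    funext j
    have h2 : (ψ N x - z N x).mat j =
      (ψ N x).mat j - eval1 x (g j) := rfl
    rw [h2, hg, Pi.add_apply, Pi.smul_apply, Pi.smul_apply, Matrix.conjTranspose_sub,
      (ψ N x).mat_conjTranspose, ← smul_add]
    have h3 : (ψ N x).mat j = (1 / 2 : ℂ) • ((ψ N x).mat j + (ψ N x).mat j) := by
      rw [← two_smul ℂ, smul_smul]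
      norm_num
    nth_rewrite 1 [h3]
    rw [← smul_sub]
    congr 1
    abel
  rw [e]
  refine (norm2_add_le _ _).trans ?_
  rw [norm2_smul, norm2_smul, norm2_conjTranspose (fun j => (ψ N x).mat j - eval1 x (f j))]
  norm_num
  linarith

/-- The inner map need not be bounded in operator norm, so it is first replaced by self-adjoint
trace polynomials z, which are bounded by some B on the ball. The Lipschitz property in ‖·‖₂ absorbs
the replacement, and u is then approximated on the ball of radius B + 1, where z takes its values.
-/
theorem AsympApproxScalar.comp {u : ∀ N, SATuple m N → ℂ} (hu : AsympApproxScalar u) {K : ℝ}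
    (hK : 0 ≤ K) (hLip : ∀ N ≥ 1, ∀ x y : SATuple m N, ‖u N x - u N y‖ ≤ K * norm2 (x - y).mat)
    {ψ : ∀ N, SATuple m N → SATuple m N} (hψ : AsympApproxOp fun N x => (ψ N x).mat) :
    AsympApproxScalar fun N x => u N (ψ N x) := by
  rw [asympApproxScalar_iff]
  intro R hR ε hε
  obtain ⟨g, z, hz, hψz⟩ := hψ.exists_selfAdjoint hR (show 0 < ε / 2 / (K + 1) by positivity)
  obtain ⟨B, hB, hgB⟩ := TrP1.exists_bound_tuple g (R := R)
  obtain ⟨f, hf⟩ := asympApproxScalar_iff.1 hu (B + 1) (by positivity) (ε / 2) (half_pos hε)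
  obtain ⟨q, hq⟩ := TrP0.exists_subst g f
  refine ⟨q, ?_⟩
  filter_upwards [hψz, hf, eventually_ge_atTop 1] with N h1 h2 hN x hx
  have h3 : normInf (z N x).mat ≤ B + 1 := by
    have : (z N x).mat = fun j => eval1 x (g j) := funext (hz N x)
    rw [this]
    linarith [hgB N x hx]
  have h4 := h2 (z N x) h3
  rw [hq N x (z N x) (hz N x)] at h4
  have h5 := hLip N hN (ψ N x) (z N x)
  have h6 := mul_le_mul_of_nonneg_left (h1 x hx) hK
  have h7 : K * (ε / 2 / (K + 1)) ≤ ε / 2 := by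
    rw [mul_div_assoc', div_le_iff₀ (by positivity)]
    nlinarith
  linarith [norm_sub_le_norm_sub_add_norm_sub (u N (ψ N x)) (u N (z N x)) (eval0 x q)]

theorem AsympApproxOp.comp {φ : ∀ N, SATuple m N → Fin m → Matrix (Fin N) (Fin N) ℂ}
    (hφ : AsympApproxOp φ) {K : ℝ} (hK : 0 ≤ K)
    (hLip : ∀ N ≥ 1, ∀ x y : SATuple m N, norm2 (φ N x - φ N y) ≤ K * norm2 (x - y).mat)
    {ψ : ∀ N, SATuple m N → SATuple m N} (hψ : AsympApproxOp fun N x => (ψ N x).mat) :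
    AsympApproxOp fun N x => φ N (ψ N x) := by
  rw [asympApproxOp_iff]
  intro R hR ε hε
  obtain ⟨g, z, hz, hψz⟩ := hψ.exists_selfAdjoint hR (show 0 < ε / 2 / (K + 1) by positivity)
  obtain ⟨B, hB, hgB⟩ := TrP1.exists_bound_tuple g (R := R)
  obtain ⟨f, hf⟩ := asympApproxOp_iff.1 hφ (B + 1) (by positivity) (ε / 2) (half_pos hε)
  choose q hq using fun j => TrP1.exists_subst g (f j)
  refine ⟨q, ?_⟩
  filter_upwards [hψz, hf, eventually_ge_atTop 1] with N h1 h2 hN x hx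
  have h3 : normInf (z N x).mat ≤ B + 1 := by
    have : (z N x).mat = fun j => eval1 x (g j) := funext (hz N x)
    rw [this]
    linarith [hgB N x hx]
  have h4 := h2 (z N x) h3
  simp only [fun j => hq j N x (z N x) (hz N x)] at h4
  have h5 := hLip N hN (ψ N x) (z N x)
  have h6 := mul_le_mul_of_nonneg_left (h1 x hx) hK
  have h7 : K * (ε / 2 / (K + 1)) ≤ ε / 2 := by
    rw [mul_div_assoc', div_le_iff₀ (by positivity)]
    nlinarith
  have h8 := norm2_sub_le (φ N (ψ N x)) (φ N (z N x)) (fun j => eval1 x (q j))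
  have h9 : norm2 (φ N (z N x) - fun j => eval1 x (q j)) ≤ ε / 2 := h4
  have h10 : norm2 (φ N (ψ N x) - fun j => eval1 x (q j)) ≤ ε := by linarith
  exact h10

end AsymptoticApproximation

/-! ### Euler scheme and approximability of the flow -/

section DeterministicSemigroup

variable {m : ℕ} {c C : ℝ} {V : ∀ N, SATuple m N → ℝ}

/-- One explicit Euler step for the gradient flow. -/
def eulerStep {N : ℕ} (V : SATuple m N → ℝ) (h : ℝ) (x : SATuple m N) : SATuple m N :=
  x - (h / 2) • normGrad V x

theorem norm2_mono_of_norm_le {N : ℕ} {x y : SATuple m N} {K : ℝ} (h : ‖x‖ ≤ K * ‖y‖) :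
    norm2 x.mat ≤ K * norm2 y.mat := by
  rw [SATuple.norm2_mat, SATuple.norm2_mat]
  calc (Real.sqrt N)⁻¹ * ‖x‖ ≤ (Real.sqrt N)⁻¹ * (K * ‖y‖) := by gcongr
    _ = _ := by ring

theorem UnifConvex.norm_eulerStep_sub_le {N : ℕ} {V : SATuple m N → ℝ} (hV : UnifConvex c C V)
    {h : ℝ} (hh : 0 ≤ h) (x y : SATuple m N) :
    ‖eulerStep V h x - eulerStep V h y‖ ≤ (1 + h / 2 * C) * ‖x - y‖ := by
  have e : eulerStep V h x - eulerStep V h y =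
      (x - y) - (h / 2) • (normGrad V x - normGrad V y) := by
    simp only [eulerStep, smul_sub]; abel
  rw [e]
  refine (norm_sub_le _ _).trans ?_
  rw [norm_smul, Real.norm_eq_abs, abs_of_nonneg (by positivity)]
  have := mul_le_mul_of_nonneg_left (hV.lipschitz x y) (show 0 ≤ h / 2 by positivity)
  linarith

/-- Discrete Gronwall: a step multiplies the accumulated error by at most 1 + hC/2 and adds a local
error of order h², in which the speed along the trajectory is bounded by the initial one. -/
theorem UnifConvex.norm_gradFlow_sub_eulerStep_iterate_le {N : ℕ} {V : SATuple m N → ℝ}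
    (hV : UnifConvex c C V) {h : ℝ} (hh : 0 ≤ h) (x : SATuple m N) (n : ℕ) :
    ‖gradFlow V x (n * h) - (eulerStep V h)^[n] x‖ ≤
      n * (1 + h / 2 * C) ^ n * (C * h ^ 2 / 4 * ‖normGrad V x‖) := by
  induction n with
  | zero => simp [hV.gradFlow_zero]
  | succ n ih =>
    have hC := hV.C_pos
    have h1 : gradFlow V x ((n + 1 : ℕ) * h) = gradFlow V (gradFlow V x (n * h)) h := by
      rw [← hV.gradFlow_add x (by positivity) hh]
      congr 1
      push_cast
      ring
    rw [h1, Function.iterate_succ_apply']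
    set y := gradFlow V x (n * h) with hy
    set z := (eulerStep V h)^[n] x
    set D := C * h ^ 2 / 4 * ‖normGrad V x‖ with hD
    set q := 1 + h / 2 * C with hq
    have hq1 : 1 ≤ q := by rw [hq]; have := mul_nonneg (half_pos (zero_lt_two)).le hh; nlinarith
    have hD0 : 0 ≤ D := by positivity
    have h2 : ‖gradFlow V y h - eulerStep V h y‖ ≤ D := by
      refine (hV.norm_gradFlow_sub_euler_le y hh).trans ?_
      have := hV.norm_normGrad_gradFlow_le x (t := n * h) (by positivity)
      rw [hD]
      gcongr
    have h3 := hV.norm_eulerStep_sub_le hh y z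
    rw [← hq] at h3
    have h4 : q * ‖y - z‖ ≤ q * (n * q ^ n * D) := mul_le_mul_of_nonneg_left ih (by linarith)
    have h5 := norm_sub_le_norm_sub_add_norm_sub (gradFlow V y h) (eulerStep V h y)
      (eulerStep V h z)
    have h6 : 1 * D ≤ q ^ (n + 1) * D := mul_le_mul_of_nonneg_right (one_le_pow₀ hq1) hD0
    push_cast
    calc _ ≤ D + q * (n * q ^ n * D) := by linarith
      _ ≤ q ^ (n + 1) * D + q * (n * q ^ n * D) := by linarith
      _ = _ := by ring

/-- With n Euler steps the error is O(1/n) times ‖DV(x)‖₂, and approximability of DV bounds this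
norm on operator-norm balls, uniformly in large N. -/
theorem asympApproxOp_gradFlow (hV : ∀ N ≥ 1, UnifConvex c C (V N))
    (hDV : AsympApproxOp (fun N x => (normGrad (V N) x).mat)) {t : ℝ} (ht : 0 ≤ t) :
    AsympApproxOp fun N x => (gradFlow (V N) x t).mat := by
  have hC : 0 < C := (hV 1 le_rfl).C_pos
  have hstep : ∀ h : ℝ, 0 ≤ h → ∀ n : ℕ,
      AsympApproxOp fun N x => ((eulerStep (V N) h)^[n] x).mat := by
    intro h hh n
    induction n with
    | zero => exact asympApproxOp_id
    | succ n ih =>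
      simp only [Function.iterate_succ_apply']
      have h1 : AsympApproxOp fun N x => (eulerStep (V N) h x).mat := by
        have := asympApproxOp_id.sub_smul hDV ((h / 2 : ℝ) : ℂ)
        have e : (fun (N : ℕ) (x : SATuple m N) => (eulerStep (V N) h x).mat) =
            fun N x => x.mat - ((h / 2 : ℝ) : ℂ) • (normGrad (V N) x).mat := by
          funext N x
          rw [eulerStep, SATuple.mat_sub, SATuple.mat_smul]
          rfl
        rw [e]
        exact this
      have h2 : ∀ N ≥ 1, ∀ x y : SATuple m N, norm2 ((eulerStep (V N) h x).mat -
          (eulerStep (V N) h y).mat) ≤ (1 + h / 2 * C) * norm2 (x - y).mat := by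
        intro N hN x y
        rw [← SATuple.mat_sub]
        exact norm2_mono_of_norm_le ((hV N hN).norm_eulerStep_sub_le hh x y)
      exact AsympApproxOp.comp (φ := fun N x => (eulerStep (V N) h x).mat)
        (ψ := fun N x => (eulerStep (V N) h)^[n] x) h1 (by positivity) h2 ih
  refine AsympApproxOp.of_uniform_limit fun R hR ε hε => ?_
  obtain ⟨B, hB, hbd⟩ := hDV.exists_bound hR
  have hlim : Tendsto (fun n : ℕ => Real.exp (t / 2 * C) * (C * t ^ 2 / 4 * B) / (n + 1 : ℝ))
      atTop (𝓝 0) := by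
    have h1 := (tendsto_one_div_add_atTop_nhds_zero_nat (𝕜 := ℝ)).const_mul
      (Real.exp (t / 2 * C) * (C * t ^ 2 / 4 * B))
    simpa only [mul_zero, mul_one_div] using h1
  obtain ⟨n, hn⟩ : ∃ n : ℕ, Real.exp (t / 2 * C) * (C * t ^ 2 / 4 * B) / (n + 1 : ℝ) < ε :=
    (hlim.eventually (gt_mem_nhds hε)).exists
  have ht' : 0 ≤ t / (n + 1) := by positivity
  refine ⟨fun N x => ((eulerStep (V N) (t / (n + 1)))^[n + 1] x).mat,
    hstep (t / (n + 1)) ht' (n + 1), ?_⟩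
  filter_upwards [hbd, eventually_ge_atTop 1] with N h1 hN x hx
  rw [← SATuple.mat_sub]
  have hn0 : (0 : ℝ) < n + 1 := by positivity
  have h2 := (hV N hN).norm_gradFlow_sub_eulerStep_iterate_le (h := t / (n + 1))
    (by positivity) x (n + 1)
  have e1 : ((n + 1 : ℕ) : ℝ) * (t / (n + 1)) = t := by push_cast; field_simp
  rw [e1] at h2
  have h3 : (1 + t / (n + 1) / 2 * C) ^ (n + 1) ≤ Real.exp (t / 2 * C) := by
    have e2 : t / 2 * C = ((n + 1 : ℕ) : ℝ) * (t / (n + 1) / 2 * C) := by push_cast; field_simp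
    rw [e2, Real.exp_nat_mul]
    gcongr
    linarith [Real.add_one_le_exp (t / (n + 1) / 2 * C)]
  have h4 : ‖gradFlow (V N) x t - (eulerStep (V N) (t / (n + 1)))^[n + 1] x‖ ≤
      (Real.exp (t / 2 * C) * (C * t ^ 2 / 4) / (n + 1)) * ‖normGrad (V N) x‖ := by
    refine h2.trans ?_
    calc _ ≤ ((n + 1 : ℕ) : ℝ) * Real.exp (t / 2 * C) *
          (C * (t / (n + 1)) ^ 2 / 4 * ‖normGrad (V N) x‖) := by gcongr
      _ = _ := by push_cast; field_simp
  refine (norm2_mono_of_norm_le h4).trans ?_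
  refine le_trans ?_ hn.le
  calc _ ≤ (Real.exp (t / 2 * C) * (C * t ^ 2 / 4) / (n + 1)) * B := by
        have := h1 x hx
        gcongr
    _ = _ := by ring

theorem asympApproxScalar_detSemigroup (hV : ∀ N ≥ 1, UnifConvex c C (V N))
    (hDV : AsympApproxOp (fun N x => (normGrad (V N) x).mat)) {u : ∀ N, SATuple m N → ℂ}
    (hu : AsympApproxScalar u) {K : ℝ} (hK : 0 ≤ K)
    (hLip : ∀ N ≥ 1, ∀ x y : SATuple m N, ‖u N x - u N y‖ ≤ K * norm2 (x - y).mat)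
    {t : ℝ} (ht : 0 ≤ t) : AsympApproxScalar fun N => detSemigroup (V N) t (u N) :=
  hu.comp hK hLip (asympApproxOp_gradFlow hV hDV ht)

end DeterministicSemigroup

/-! ### Heat and flow semigroups, and the splitting scheme -/

section Semigroups

variable {m N : ℕ} {c C K : ℝ} {V : SATuple m N → ℝ} {u v : SATuple m N → ℂ}

/-- `u` is `K`-Lipschitz with respect to the normalized 2-norm. -/
def Lip2 (K : ℝ) (u : SATuple m N → ℂ) : Prop :=
  ∀ x y : SATuple m N, ‖u x - u y‖ ≤ K * norm2 (x - y).mat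

theorem norm2_mat_add_le (x y : SATuple m N) :
    norm2 (x + y).mat ≤ norm2 x.mat + norm2 y.mat := norm2_add_le _ _

theorem norm2_mat_le_norm (hN : 1 ≤ N) (x : SATuple m N) : norm2 x.mat ≤ ‖x‖ := by
  rw [SATuple.norm2_mat]
  have : 1 ≤ Real.sqrt N := Real.one_le_sqrt.2 (by exact_mod_cast hN)
  exact mul_le_of_le_one_left (norm_nonneg _) (inv_le_one_of_one_le₀ this)

theorem continuous_norm2_mat : Continuous fun x : SATuple m N => norm2 x.mat := by
  simp only [SATuple.norm2_mat]
  fun_prop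

namespace Lip2

theorem continuous (hu : Lip2 K u) : Continuous u := by
  rw [continuous_iff_continuousAt]
  intro x
  rw [ContinuousAt, tendsto_iff_norm_sub_tendsto_zero]
  have h1 : Tendsto (fun y : SATuple m N => K * norm2 (y - x).mat) (𝓝 x) (𝓝 0) := by
    have h2 : Continuous fun y : SATuple m N => K * norm2 (y - x).mat :=
      continuous_const.mul (continuous_norm2_mat.comp (continuous_id.sub continuous_const))
    have := h2.tendsto x
    simpa [SATuple.norm2_mat] using this
  exact squeeze_zero (fun _ => norm_nonneg _) (fun y => hu y x) h1

theorem mono {K' : ℝ} (hu : Lip2 K u) (h : K ≤ K') : Lip2 K' u := fun x y =>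
  (hu x y).trans (mul_le_mul_of_nonneg_right h (norm2_nonneg _))

theorem integrable_gue (hu : Lip2 K u) (hN : 1 ≤ N) (hK : 0 ≤ K) {t : ℝ} (ht : 0 < t)
    (x : SATuple m N) : Integrable (fun y => u (x + y)) (gue m N t) := by
  refine integrable_gue_of_norm_le_exp hN ht (A := ‖u x‖ + K) (β := 1)
    (hu.continuous.comp (by fun_prop)) fun y => ?_
  have h1 := hu (x + y) x
  rw [add_sub_cancel_left] at h1
  have h2 := norm2_mat_le_norm hN y
  have h3 := norm_le_exp_norm y
  have h4 := Real.one_le_exp (norm_nonneg y)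
  have h5 : ‖u (x + y)‖ ≤ ‖u x‖ + ‖u (x + y) - u x‖ := by
    simpa using norm_add_le (u x) (u (x + y) - u x)
  rw [one_mul]
  nlinarith [norm_nonneg (u x), mul_le_mul_of_nonneg_left (h2.trans h3) hK]

theorem heat (hu : Lip2 K u) (hN : 1 ≤ N) (hK : 0 ≤ K) {t : ℝ} (ht : 0 < t) :
    Lip2 K (heatSemigroup t u) := by
  intro x y
  have := isProbabilityMeasure_gue (m := m) hN ht
  rw [heatSemigroup, heatSemigroup,
    ← integral_sub (hu.integrable_gue hN hK ht x) (hu.integrable_gue hN hK ht y)]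
  refine (norm_integral_le_of_norm_le_const (C := K * norm2 (x - y).mat)
    (Eventually.of_forall fun z => ?_)).trans (by simp)
  have := hu (x + z) (y + z)
  rwa [add_sub_add_right_eq_sub] at this

theorem det_exp (hu : Lip2 K u) (hK : 0 ≤ K) (hV : UnifConvex c C V) {t : ℝ} (ht : 0 ≤ t) :
    Lip2 (K * Real.exp (-(c * t / 2))) (detSemigroup V t u) := by
  intro x y
  refine (hu _ _).trans ?_
  rw [mul_assoc]
  exact mul_le_mul_of_nonneg_left
    (norm2_mono_of_norm_le (hV.norm_gradFlow_sub_le_exp x y ht)) hK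

theorem det (hu : Lip2 K u) (hK : 0 ≤ K) (hV : UnifConvex c C V) {t : ℝ} (ht : 0 ≤ t) :
    Lip2 K (detSemigroup V t u) := by
  refine (hu.det_exp hK hV ht).mono (mul_le_of_le_one_right hK (Real.exp_le_one_iff.2 ?_))
  have := mul_nonneg hV.pos.le ht
  linarith

end Lip2

theorem norm_heatSemigroup_sub_le (hu : Lip2 K u) (hv : Lip2 K v) (hN : 1 ≤ N) (hK : 0 ≤ K)
    {t : ℝ} (ht : 0 < t) {δ : ℝ} (h : ∀ x, ‖u x - v x‖ ≤ δ) (x : SATuple m N) :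
    ‖heatSemigroup t u x - heatSemigroup t v x‖ ≤ δ := by
  have := isProbabilityMeasure_gue (m := m) hN ht
  rw [heatSemigroup, heatSemigroup,
    ← integral_sub (hu.integrable_gue hN hK ht x) (hv.integrable_gue hN hK ht x)]
  exact (norm_integral_le_of_norm_le_const (Eventually.of_forall fun z => h _)).trans (by simp)

theorem norm_heatSemigroup_sub_self_le (hu : Lip2 K u) (hN : 1 ≤ N) (hK : 0 ≤ K)
    {t : ℝ} (ht : 0 < t) (x : SATuple m N) :
    ‖heatSemigroup t u x - u x‖ ≤ K * Real.sqrt (m * t) := by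
  have := isProbabilityMeasure_gue (m := m) hN ht
  have h1 : heatSemigroup t u x - u x = ∫ y, (u (x + y) - u x) ∂(gue m N t) := by
    rw [integral_sub (hu.integrable_gue hN hK ht x) (integrable_const _)]
    simp [heatSemigroup]
  rw [h1]
  refine (norm_integral_le_of_norm_le ((integrable_norm2_gue hN ht).const_mul K)
    (Eventually.of_forall fun y => ?_)).trans ?_
  · simpa using hu (x + y) x
  · rw [integral_const_mul]
    exact mul_le_mul_of_nonneg_left (integral_norm2_gue_le hN ht) hK

theorem heatSemigroup_add (hu : Lip2 K u) (hN : 1 ≤ N) (hK : 0 ≤ K) {s t : ℝ} (hs : 0 < s)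
    (ht : 0 < t) : heatSemigroup (s + t) u = heatSemigroup s (heatSemigroup t u) := by
  funext x
  have := isProbabilityMeasure_gue (m := m) hN hs
  have := isProbabilityMeasure_gue (m := m) hN ht
  simp only [heatSemigroup]
  rw [← gue_conv hN hs ht, integral_conv]
  · simp only [add_assoc]
  · rw [gue_conv hN hs ht]
    exact hu.integrable_gue hN hK (add_pos hs ht) x

theorem detSemigroup_add (hV : UnifConvex c C V) {s t : ℝ} (hs : 0 ≤ s) (ht : 0 ≤ t) :
    detSemigroup V (s + t) u = detSemigroup V s (detSemigroup V t u) := by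
  funext x
  simp only [detSemigroup, hV.gradFlow_add x hs ht]

/-- Both terms average over the same Gaussian y, and W(x + y, h) - W(x, h) - y has 2-norm O(h‖y‖₂),
while the mean of ‖y‖₂ is at most √(mh). Hence order h^{3/2}, with a constant free of N and x. -/
theorem norm_heat_det_sub_det_heat_le (hu : Lip2 K u) (hK : 0 ≤ K) (hV : UnifConvex c C V)
    {h : ℝ} (hh : 0 < h) (x : SATuple m N) :
    ‖heatSemigroup h (detSemigroup V h u) x - detSemigroup V h (heatSemigroup h u) x‖ ≤
      K * (C / 2 * h * Real.sqrt (m * h)) := by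
  have hN := hV.one_le
  have := isProbabilityMeasure_gue (m := m) hN hh
  have h1 := (hu.det hK hV hh.le).integrable_gue hN hK hh x
  have h2 := hu.integrable_gue hN hK hh (gradFlow V x h)
  have e : heatSemigroup h (detSemigroup V h u) x - detSemigroup V h (heatSemigroup h u) x =
      ∫ y, (u (gradFlow V (x + y) h) - u (gradFlow V x h + y)) ∂(gue m N h) := by
    exact (integral_sub h1 h2).symm
  rw [e]
  refine (norm_integral_le_of_norm_le
    ((integrable_norm2_gue hN hh).const_mul (K * (C / 2 * h)))
    (Eventually.of_forall fun y => ?_)).trans ?_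
  · refine (hu _ _).trans ?_
    rw [mul_assoc]
    refine mul_le_mul_of_nonneg_left (norm2_mono_of_norm_le ?_) hK
    have := hV.norm_gradFlow_sub_sub_le (x + y) x hh.le
    rw [add_sub_cancel_left] at this
    rw [← sub_sub]
    linarith
  · rw [integral_const_mul, mul_assoc]
    refine mul_le_mul_of_nonneg_left ?_ hK
    have := hV.C_pos
    exact mul_le_mul_of_nonneg_left (integral_norm2_gue_le hN hh) (by positivity)

/-- One step `P_h S_h` of the splitting scheme. -/
def trotterStep (V : SATuple m N → ℝ) (h : ℝ) (u : SATuple m N → ℂ) : SATuple m N → ℂ :=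
  heatSemigroup h (detSemigroup V h u)

theorem trotter_eq (l n : ℕ) : trotter V l n u = (trotterStep V ((2 : ℝ) ^ l)⁻¹)^[n] u := rfl

theorem Lip2.trotterStep_exp (hu : Lip2 K u) (hK : 0 ≤ K) (hV : UnifConvex c C V) {h : ℝ}
    (hh : 0 < h) : Lip2 (K * Real.exp (-(c * h / 2))) (trotterStep V h u) :=
  (hu.det_exp hK hV hh.le).heat hV.one_le (by positivity) hh

theorem Lip2.trotterStep (hu : Lip2 K u) (hK : 0 ≤ K) (hV : UnifConvex c C V) {h : ℝ}
    (hh : 0 < h) : Lip2 K (trotterStep V h u) :=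
  (hu.det hK hV hh.le).heat hV.one_le hK hh

theorem Lip2.trotterStep_iterate_exp (hu : Lip2 K u) (hK : 0 ≤ K) (hV : UnifConvex c C V) {h : ℝ}
    (hh : 0 < h) (n : ℕ) :
    Lip2 (K * Real.exp (-(c * (n * h) / 2))) ((_root_.trotterStep V h)^[n] u) := by
  induction n with
  | zero => simpa using hu
  | succ n ih =>
    rw [Function.iterate_succ_apply']
    convert ih.trotterStep_exp (by positivity) hV hh using 1
    rw [mul_assoc, ← Real.exp_add]
    congr 2
    push_cast
    ring

theorem Lip2.trotterStep_iterate (hu : Lip2 K u) (hK : 0 ≤ K) (hV : UnifConvex c C V) {h : ℝ}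
    (hh : 0 < h) (n : ℕ) : Lip2 K ((_root_.trotterStep V h)^[n] u) := by
  induction n with
  | zero => simpa using hu
  | succ n ih =>
    rw [Function.iterate_succ_apply']
    exact ih.trotterStep hK hV hh

theorem norm_trotterStep_sub_le (hu : Lip2 K u) (hv : Lip2 K v) (hK : 0 ≤ K)
    (hV : UnifConvex c C V) {h : ℝ} (hh : 0 < h) {δ : ℝ} (hδ : ∀ x, ‖u x - v x‖ ≤ δ)
    (x : SATuple m N) : ‖trotterStep V h u x - trotterStep V h v x‖ ≤ δ :=
  norm_heatSemigroup_sub_le (hu.det hK hV hh.le) (hv.det hK hV hh.le) hV.one_le hK hh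
    (fun _ => hδ _) x

/-- By the semigroup laws the two sides are PSPS and PPSS, which differ by a single commutator under
P. -/
theorem norm_trotterStep_double_sub_le (hu : Lip2 K u) (hK : 0 ≤ K) (hV : UnifConvex c C V)
    {h : ℝ} (hh : 0 < h) (x : SATuple m N) :
    ‖trotterStep V h (trotterStep V h u) x - trotterStep V (h + h) u x‖ ≤
      K * (C / 2 * h * Real.sqrt (m * h)) := by
  have hN := hV.one_le
  have hw := hu.det hK hV hh.le
  have e : trotterStep V (h + h) u =
      heatSemigroup h (heatSemigroup h (detSemigroup V h (detSemigroup V h u))) := by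
    rw [trotterStep, detSemigroup_add hV hh.le hh.le,
      heatSemigroup_add (hw.det hK hV hh.le) hN hK hh hh]
  rw [e]
  refine norm_heatSemigroup_sub_le ((hw.heat hN hK hh).det hK hV hh.le)
    ((hw.det hK hV hh.le).heat hN hK hh) hN hK hh (fun y => ?_) x
  rw [norm_sub_rev]
  exact norm_heat_det_sub_det_heat_le hw hK hV hh y

/-- For n of order t/h the total error is O(t√h), uniformly in x; this is summable along h = 2^{-l}.
-/
theorem norm_trotterStep_iterate_double_sub_le (hu : Lip2 K u) (hK : 0 ≤ K)
    (hV : UnifConvex c C V) {h : ℝ} (hh : 0 < h) (n : ℕ) (x : SATuple m N) :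
    ‖(trotterStep V h)^[2 * n] u x - (trotterStep V (h + h))^[n] u x‖ ≤
      n * (K * (C / 2 * h * Real.sqrt (m * h))) := by
  induction n generalizing x with
  | zero => simp
  | succ n ih =>
    have e : (trotterStep V h)^[2 * (n + 1)] u =
        trotterStep V h (trotterStep V h ((trotterStep V h)^[2 * n] u)) := by
      rw [show 2 * (n + 1) = (2 * n + 1) + 1 by ring, Function.iterate_succ_apply',
        Function.iterate_succ_apply']
    rw [e, Function.iterate_succ_apply']
    have h1 := hu.trotterStep_iterate hK hV hh (2 * n)
    have h2 := hu.trotterStep_iterate hK hV (add_pos hh hh) n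
    have h3 := norm_trotterStep_double_sub_le h1 hK hV hh x
    have h4 := norm_trotterStep_sub_le h1 h2 hK hV (add_pos hh hh) ih x
    push_cast
    linarith [norm_sub_le_norm_sub_add_norm_sub
      (trotterStep V h (trotterStep V h ((trotterStep V h)^[2 * n] u)) x)
      (trotterStep V (h + h) ((trotterStep V h)^[2 * n] u) x)
      (trotterStep V (h + h) ((trotterStep V (h + h))^[n] u) x)]

/-! ### Dyadic times -/

theorem floor_two_pow_mul_dyadic {k l₀ l : ℕ} (h : l₀ ≤ l) :
    ⌊(2 : ℝ) ^ l * ((k : ℝ) / 2 ^ l₀)⌋₊ = k * 2 ^ (l - l₀) := by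
  obtain ⟨d, rfl⟩ := Nat.exists_eq_add_of_le h
  have : (2 : ℝ) ^ (l₀ + d) * ((k : ℝ) / 2 ^ l₀) = ((k * 2 ^ d : ℕ) : ℝ) := by
    push_cast
    rw [pow_add]
    field_simp
  rw [this, Nat.floor_natCast, Nat.add_sub_cancel_left]

/-- The constant in the geometric rate of convergence of the splitting scheme. -/
def trotterRate (m : ℕ) (C K t : ℝ) : ℝ := K * C / 4 * t * Real.sqrt m

theorem norm_langevinApprox_succ_sub_le (hu : Lip2 K u) (hK : 0 ≤ K) (hV : UnifConvex c C V)
    {k l₀ l : ℕ} (hl : l₀ ≤ l) (x : SATuple m N) :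
    ‖langevinApprox V (l + 1) ((k : ℝ) / 2 ^ l₀) u x - langevinApprox V l ((k : ℝ) / 2 ^ l₀) u x‖ ≤
      trotterRate m C K ((k : ℝ) / 2 ^ l₀) * Real.sqrt (1 / 2) ^ l := by
  have hC := hV.C_pos
  obtain ⟨d, rfl⟩ := Nat.exists_eq_add_of_le hl
  rw [langevinApprox, langevinApprox, floor_two_pow_mul_dyadic hl,
    floor_two_pow_mul_dyadic (by omega : l₀ ≤ l₀ + d + 1), trotter_eq, trotter_eq]
  set h : ℝ := ((2 : ℝ) ^ (l₀ + d + 1))⁻¹ with hh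
  have hpos : 0 < h := by positivity
  have e1 : ((2 : ℝ) ^ (l₀ + d))⁻¹ = h + h := by
    rw [hh, pow_succ]; field_simp; norm_num
  have e2 : k * 2 ^ (l₀ + d + 1 - l₀) = 2 * (k * 2 ^ (l₀ + d - l₀)) := by
    rw [show l₀ + d + 1 - l₀ = d + 1 by omega, show l₀ + d - l₀ = d by omega, pow_succ]
    ring
  rw [e1, e2]
  refine (norm_trotterStep_iterate_double_sub_le hu hK hV hpos _ x).trans ?_
  rw [Nat.add_sub_cancel_left]
  have e3 : Real.sqrt h ≤ Real.sqrt (1 / 2) ^ (l₀ + d) := by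
    have : h = (1 / 2) ^ (l₀ + d + 1) := by rw [hh]; simp
    have e5 : (1 / 2 : ℝ) ^ (l₀ + d + 1) = (Real.sqrt (1 / 2) ^ (l₀ + d + 1)) ^ 2 := by
      rw [← pow_mul, mul_comm, pow_mul, Real.sq_sqrt (by positivity)]
    rw [this, e5, Real.sqrt_sq (by positivity)]
    exact pow_le_pow_of_le_one (Real.sqrt_nonneg _) (Real.sqrt_le_one.2 (by norm_num))
      (by omega)
  have e4 : ((k * 2 ^ d : ℕ) : ℝ) * h = (k : ℝ) / 2 ^ l₀ / 2 := by
    rw [hh, pow_succ, pow_add]; push_cast; field_simp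
  rw [Real.sqrt_mul (by positivity), trotterRate]
  calc ((k * 2 ^ d : ℕ) : ℝ) * (K * (C / 2 * h * (Real.sqrt m * Real.sqrt h)))
      = (((k * 2 ^ d : ℕ) : ℝ) * h) * K * C / 2 * Real.sqrt m * Real.sqrt h := by ring
    _ ≤ ((k : ℝ) / 2 ^ l₀ / 2) * K * C / 2 * Real.sqrt m * Real.sqrt (1 / 2) ^ (l₀ + d) := by
        rw [e4]
        gcongr
    _ = _ := by ring

theorem sqrt_half_lt_one : Real.sqrt (1 / 2) < 1 := by
  rw [Real.sqrt_lt' one_pos]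
  norm_num

theorem exists_tendsto_langevinApprox (hu : Lip2 K u) (hK : 0 ≤ K) (hV : UnifConvex c C V)
    (k l₀ : ℕ) (x : SATuple m N) :
    ∃ a : ℂ, Tendsto (fun l => langevinApprox V l ((k : ℝ) / 2 ^ l₀) u x) atTop (𝓝 a) ∧
      ∀ l ≥ l₀, ‖langevinApprox V l ((k : ℝ) / 2 ^ l₀) u x - a‖ ≤
        trotterRate m C K ((k : ℝ) / 2 ^ l₀) / (1 - Real.sqrt (1 / 2)) * Real.sqrt (1 / 2) ^ l := by
  -- The index starts at l₀, the level from which the time is an exact multiple of the step and the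
  -- geometric estimate applies.
  set f : ℕ → ℂ := fun l => langevinApprox V (l + l₀) ((k : ℝ) / 2 ^ l₀) u x with hf
  set D := trotterRate m C K ((k : ℝ) / 2 ^ l₀) with hD
  set r := Real.sqrt (1 / 2) with hr
  have hstep : ∀ l, dist (f l) (f (l + 1)) ≤ (D * r ^ l₀) * r ^ l := by
    intro l
    rw [dist_comm, dist_eq_norm]
    have := norm_langevinApprox_succ_sub_le hu hK hV (k := k) (Nat.le_add_left l₀ l) x
    simp only [hf]
    rw [show l + 1 + l₀ = l + l₀ + 1 by ring]
    refine this.trans (le_of_eq ?_)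
    rw [pow_add]
    ring
  have hc := cauchySeq_of_le_geometric r _ sqrt_half_lt_one hstep
  obtain ⟨a, ha⟩ := cauchySeq_tendsto_of_complete hc
  refine ⟨a, (tendsto_add_atTop_iff_nat
    (f := fun l => langevinApprox V l ((k : ℝ) / 2 ^ l₀) u x) l₀).1 ha, fun l hl => ?_⟩
  have := dist_le_of_le_geometric_of_tendsto r _ sqrt_half_lt_one hstep ha (l - l₀)
  simp only [hf, Nat.sub_add_cancel hl, dist_eq_norm] at this
  refine this.trans (le_of_eq ?_)
  have e : r ^ l = r ^ l₀ * r ^ (l - l₀) := by rw [← pow_add, Nat.add_sub_cancel' hl]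
  rw [e]
  ring

theorem tendsto_langevinApprox (hu : Lip2 K u) (hK : 0 ≤ K) (hV : UnifConvex c C V) {t : ℝ}
    (ht : t ∈ dyadics) (x : SATuple m N) :
    Tendsto (fun l => langevinApprox V l t u x) atTop (𝓝 (langevinDyadic V t u x)) := by
  obtain ⟨k, l₀, rfl⟩ := ht
  obtain ⟨a, ha, -⟩ := exists_tendsto_langevinApprox hu hK hV k l₀ x
  exact tendsto_nhds_limUnder ⟨a, ha⟩

theorem norm_langevinApprox_sub_langevinDyadic_le (hu : Lip2 K u) (hK : 0 ≤ K)
    (hV : UnifConvex c C V) {k l₀ l : ℕ} (hl : l₀ ≤ l) (x : SATuple m N) :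
    ‖langevinApprox V l ((k : ℝ) / 2 ^ l₀) u x - langevinDyadic V ((k : ℝ) / 2 ^ l₀) u x‖ ≤
      trotterRate m C K ((k : ℝ) / 2 ^ l₀) / (1 - Real.sqrt (1 / 2)) * Real.sqrt (1 / 2) ^ l := by
  obtain ⟨a, ha, hb⟩ := exists_tendsto_langevinApprox hu hK hV k l₀ x
  have : langevinDyadic V ((k : ℝ) / 2 ^ l₀) u x = a := ha.limUnder_eq
  rw [this]
  exact hb l hl

/-! ### Regularity in time -/

theorem integral_inner_gue (hN : 1 ≤ N) {t : ℝ} (ht : 0 < t) (w : SATuple m N) :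
    ∫ y, (inner ℝ w y : ℝ) ∂(gue m N t) = 0 := by
  have h := integral_inner_smul_gaussTilt (gue_rate_pos hN ht) w (F := fun _ => (1 : ℝ))
    (F' := fun _ => 0) (ExpGrowth.const _) (ExpGrowth.const _)
    (fun y => by simpa using (hasFDerivAt_const (1 : ℝ) y).hasLineDerivAt w)
  rw [gue_eq_gaussTilt]
  simpa using h

theorem integral_norm2_add_sq_gue (hN : 1 ≤ N) {t : ℝ} (ht : 0 < t) (z : SATuple m N) :
    Integrable (fun y => norm2 (z + y).mat ^ 2) (gue m N t) ∧
      ∫ y, norm2 (z + y).mat ^ 2 ∂(gue m N t) = norm2 z.mat ^ 2 + m * t := by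
  have := isProbabilityMeasure_gue (m := m) hN ht
  have hN' : (0 : ℝ) < N := by exact_mod_cast hN
  have h1 : ∀ y : SATuple m N, norm2 (z + y).mat ^ 2 =
      (norm2 z.mat ^ 2 + 2 * (N : ℝ)⁻¹ * inner ℝ z y) + norm2 y.mat ^ 2 := by
    intro y
    rw [SATuple.norm2_mat_sq, SATuple.norm2_mat_sq, SATuple.norm2_mat_sq, norm_add_sq_real]
    ring
  have h2 : Integrable (fun y : SATuple m N => norm2 y.mat ^ 2) (gue m N t) := by
    simp only [SATuple.norm2_mat_sq]
    exact (integrable_norm_pow_gue hN ht 2).const_mul _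
  have h3 : Integrable (fun y : SATuple m N => (inner ℝ z y : ℝ)) (gue m N t) := by
    refine integrable_gue_of_norm_le_exp hN ht (A := ‖z‖) (β := 1) (by fun_prop) fun y => ?_
    refine (norm_inner_le_norm z y).trans ?_
    rw [one_mul]
    exact mul_le_mul_of_nonneg_left (norm_le_exp_norm y) (norm_nonneg _)
  have h4 : Integrable (fun y : SATuple m N =>
      norm2 z.mat ^ 2 + 2 * (N : ℝ)⁻¹ * inner ℝ z y) (gue m N t) :=
    (integrable_const _).add (h3.const_mul _)
  simp only [h1]
  refine ⟨h4.add h2, ?_⟩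
  rw [integral_add h4 h2, integral_add (integrable_const _) (h3.const_mul _), integral_const_mul,
    integral_inner_gue hN ht, integral_norm2_sq_gue hN ht]
  simp

/-- A quadratic majorant centred at x₀ survives one step: the flow contracts, it moves x₀ by at most
hB in ‖·‖₂, and the Gaussian adds mh because its cross term has mean zero. -/
theorem norm_trotterStep_sub_le_of_quadratic (hu : Lip2 K u) (hK : 0 ≤ K) (hV : UnifConvex c C V)
    {h : ℝ} (hh : 0 < h) (x₀ : SATuple m N) (a : ℂ) {α β : ℝ} (hβ : 0 ≤ β)
    (hb : ∀ x, ‖u x - a‖ ≤ α + β * norm2 (x - x₀).mat ^ 2) (x : SATuple m N) :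
    ‖trotterStep V h u x - a‖ ≤ α + β * (1 + h) * (norm2 (x - x₀).mat ^ 2 +
      h * (m + (norm2 (normGrad V x₀).mat / 2) ^ 2)) := by
  have hN := hV.one_le
  have := isProbabilityMeasure_gue (m := m) hN hh
  set B := norm2 (normGrad V x₀).mat / 2 with hB
  have h1 := (hu.det hK hV hh.le).integrable_gue hN hK hh x
  have e : trotterStep V h u x - a = ∫ y, (u (gradFlow V (x + y) h) - a) ∂(gue m N h) := by
    have h2 : ∫ y, (u (gradFlow V (x + y) h) - a) ∂(gue m N h) =
        ∫ y, detSemigroup V h u (x + y) ∂(gue m N h) - ∫ _, a ∂(gue m N h) :=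
      integral_sub h1 (integrable_const _)
    rw [h2]
    simp [trotterStep, heatSemigroup]
  obtain ⟨hi, hint⟩ := integral_norm2_add_sq_gue (m := m) hN hh (x - x₀)
  have hpt : ∀ y : SATuple m N, ‖u (gradFlow V (x + y) h) - a‖ ≤
      β * (1 + h) * norm2 (x - x₀ + y).mat ^ 2 + (α + β * (1 + h) * (h * B ^ 2)) := by
    intro y
    refine (hb _).trans ?_
    have h2 : norm2 (gradFlow V (x + y) h - x₀).mat ≤ norm2 (x - x₀ + y).mat + h * B := by
      have e1 : gradFlow V (x + y) h - x₀ = (gradFlow V (x + y) h - gradFlow V x₀ h) +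
          (gradFlow V x₀ h - x₀) := by abel
      rw [e1]
      refine (norm2_mat_add_le _ _).trans ?_
      have h3 : norm2 (gradFlow V (x + y) h - gradFlow V x₀ h).mat ≤
          1 * norm2 (x - x₀ + y).mat := by
        refine norm2_mono_of_norm_le ?_
        have := hV.norm_gradFlow_sub_le (x + y) x₀ hh.le
        rwa [one_mul, show x - x₀ + y = x + y - x₀ by abel]
      have h4 := norm2_mono_of_norm_le (hV.norm_gradFlow_sub_self_le x₀ hh.le)
      rw [hB]
      linarith
    -- (r + hB)² ≤ (1 + h)(r² + hB²), the difference being h(r - B)². A factor of the form 1 + h is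
    -- needed so that n steps cost at most e^{nh}.
    have h5 : norm2 (gradFlow V (x + y) h - x₀).mat ^ 2 ≤
        (1 + h) * (norm2 (x - x₀ + y).mat ^ 2 + h * B ^ 2) := by
      have h6 := pow_le_pow_left₀ (norm2_nonneg _) h2 2
      nlinarith [mul_nonneg hh.le (sq_nonneg (norm2 (x - x₀ + y).mat - B))]
    have := mul_le_mul_of_nonneg_left h5 hβ
    linarith
  rw [e]
  refine (norm_integral_le_of_norm_le ((hi.const_mul (β * (1 + h))).add (integrable_const _))
    (Eventually.of_forall hpt)).trans (le_of_eq ?_)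
  rw [integral_add' (hi.const_mul _) (integrable_const _), integral_const_mul, hint]
  simp
  ring

theorem norm_trotterStep_iterate_sub_le_of_quadratic (hu : Lip2 K u) (hK : 0 ≤ K)
    (hV : UnifConvex c C V) {h : ℝ} (hh : 0 < h) (x₀ : SATuple m N) (a : ℂ) {α β : ℝ} (hβ : 0 ≤ β)
    (hb : ∀ x, ‖u x - a‖ ≤ α + β * norm2 (x - x₀).mat ^ 2) (n : ℕ) (x : SATuple m N) :
    ‖(trotterStep V h)^[n] u x - a‖ ≤ α + β * (1 + h) ^ n * (norm2 (x - x₀).mat ^ 2 +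
      n * h * (m + (norm2 (normGrad V x₀).mat / 2) ^ 2)) := by
  induction n generalizing x with
  | zero => simpa using hb x
  | succ n ih =>
    set M := m + (norm2 (normGrad V x₀).mat / 2) ^ 2 with hM
    have hM0 : 0 ≤ M := by positivity
    rw [Function.iterate_succ_apply']
    have h1 := norm_trotterStep_sub_le_of_quadratic (hu.trotterStep_iterate hK hV hh n) hK hV hh
      x₀ a (α := α + β * (1 + h) ^ n * (n * h * M)) (β := β * (1 + h) ^ n) (by positivity)
      (fun x => (ih x).trans (le_of_eq (by ring))) x
    refine h1.trans ?_
    rw [← hM]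
    have h2 : β * (1 + h) ^ n * (n * h * M) ≤ β * (1 + h) ^ n * (1 + h) * (n * h * M) := by
      have : 0 ≤ β * (1 + h) ^ n * (n * h * M) := by positivity
      nlinarith
    push_cast
    rw [pow_succ (1 + h)]
    linarith

/-- The modulus of continuity in time of the semigroups. -/
def timeModulus (m : ℕ) (K D δ : ℝ) : ℝ :=
  K * Real.sqrt (Real.exp δ * (δ * (m + (D / 2) ^ 2 + 1)))

/-- A linear modulus is not preserved by the scheme, but K r ≤ Kθ/2 + K r²/(2θ) replaces it by a
quadratic one, which is. Choosing θ of the order of the square root of the elapsed time gives a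
bound that sees x only through ‖DV(x)‖₂. -/
theorem norm_trotterStep_iterate_sub_self_le (hu : Lip2 K u) (hK : 0 ≤ K) (hV : UnifConvex c C V)
    {h : ℝ} (hh : 0 < h) (n : ℕ) (x : SATuple m N) :
    ‖(trotterStep V h)^[n] u x - u x‖ ≤
      timeModulus m K (norm2 (normGrad V x).mat) (n * h) := by
  rcases Nat.eq_zero_or_pos n with h0 | h0
  · subst h0
    simp [timeModulus]
  set M := m + (norm2 (normGrad V x).mat / 2) ^ 2 with hM
  -- The summand 1 keeps E positive even when M = 0, since θ = √E is divided by.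
  set E := Real.exp (n * h) * (n * h * (M + 1)) with hE
  have hn : (0 : ℝ) < n := by exact_mod_cast h0
  have hE0 : 0 < E := by positivity
  set θ := Real.sqrt E with hθ
  have hθ0 : 0 < θ := Real.sqrt_pos.2 hE0
  have h1 : ∀ y, ‖u y - u x‖ ≤ K * θ / 2 + K / (2 * θ) * norm2 (y - x).mat ^ 2 := by
    intro y
    refine (hu y x).trans ?_
    have e : K * θ / 2 + K / (2 * θ) * norm2 (y - x).mat ^ 2 - K * norm2 (y - x).mat =
        K / (2 * θ) * (θ - norm2 (y - x).mat) ^ 2 := by field_simp; ring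
    have : 0 ≤ K / (2 * θ) * (θ - norm2 (y - x).mat) ^ 2 := by positivity
    linarith
  have h2 := norm_trotterStep_iterate_sub_le_of_quadratic hu hK hV hh x (u x)
    (show 0 ≤ K / (2 * θ) by positivity) h1 n x
  rw [← hM] at h2
  have h3 : norm2 (x - x).mat = 0 := by rw [sub_self, SATuple.norm2_mat]; simp
  have h4 : (1 + h) ^ n ≤ Real.exp (n * h) := by
    rw [Real.exp_nat_mul]
    gcongr
    linarith [Real.add_one_le_exp h]
  have h5 : (1 + h) ^ n * (n * h * M) ≤ E := by
    rw [hE]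
    gcongr
    linarith
  have h6 : timeModulus m K (norm2 (normGrad V x).mat) (n * h) = K * θ := by
    rw [timeModulus, hθ, hE, hM]
  have h7 : K / (2 * θ) * E = K * θ / 2 := by
    have : E = θ ^ 2 := (Real.sq_sqrt hE0.le).symm
    rw [this]
    field_simp
  have h8 := mul_le_mul_of_nonneg_left h5 (show 0 ≤ K / (2 * θ) by positivity)
  rw [h6]
  rw [h3] at h2
  calc _ ≤ _ := h2
    _ = K * θ / 2 + K / (2 * θ) * ((1 + h) ^ n * (n * h * M)) := by ring
    _ ≤ K * θ := by linarith

theorem dyadics_common {s t : ℝ} (hs : s ∈ dyadics) (ht : t ∈ dyadics) :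
    ∃ j k l : ℕ, s = (j : ℝ) / 2 ^ l ∧ t = (k : ℝ) / 2 ^ l := by
  obtain ⟨j, l, rfl⟩ := hs
  obtain ⟨k, l', rfl⟩ := ht
  refine ⟨j * 2 ^ l', k * 2 ^ l, l + l', ?_, ?_⟩
  · push_cast
    rw [pow_add]
    field_simp
  · push_cast
    rw [pow_add]
    field_simp

/-- At a common level l the scheme up to t is the scheme for t - s applied to the scheme up to s,
and the latter still has Lipschitz constant K. -/
theorem norm_langevinDyadic_sub_le (hu : Lip2 K u) (hK : 0 ≤ K) (hV : UnifConvex c C V)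
    {s t : ℝ} (hs : s ∈ dyadics) (ht : t ∈ dyadics) (hst : s ≤ t) (x : SATuple m N) :
    ‖langevinDyadic V t u x - langevinDyadic V s u x‖ ≤
      timeModulus m K (norm2 (normGrad V x).mat) (t - s) := by
  obtain ⟨j, k, l₀, hsj, htk⟩ := dyadics_common hs ht
  have h1 := ((tendsto_langevinApprox hu hK hV ht x).sub (tendsto_langevinApprox hu hK hV hs x)).norm
  refine le_of_tendsto h1 ?_
  filter_upwards [eventually_ge_atTop l₀] with l hl
  have hjk : j ≤ k := by
    rw [hsj, htk, div_le_div_iff_of_pos_right (by positivity)] at hst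
    exact_mod_cast hst
  rw [langevinApprox, langevinApprox, hsj, htk, floor_two_pow_mul_dyadic hl,
    floor_two_pow_mul_dyadic hl, trotter_eq, trotter_eq]
  set h : ℝ := ((2 : ℝ) ^ l)⁻¹ with hh
  have hpos : 0 < h := by positivity
  have e1 : k * 2 ^ (l - l₀) = (k - j) * 2 ^ (l - l₀) + j * 2 ^ (l - l₀) := by
    rw [← add_mul, Nat.sub_add_cancel hjk]
  rw [e1, Function.iterate_add_apply]
  have h2 := norm_trotterStep_iterate_sub_self_le (hu.trotterStep_iterate hK hV hpos
    (j * 2 ^ (l - l₀))) hK hV hpos ((k - j) * 2 ^ (l - l₀)) x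
  have e2 : (((k - j) * 2 ^ (l - l₀) : ℕ) : ℝ) * h = (k : ℝ) / 2 ^ l₀ - (j : ℝ) / 2 ^ l₀ := by
    rw [hh]
    push_cast [Nat.cast_sub hjk]
    obtain ⟨d, rfl⟩ := Nat.exists_eq_add_of_le hl
    rw [Nat.add_sub_cancel_left, pow_add]
    field_simp
  rwa [e2] at h2

theorem timeModulus_mono {D D' δ δ' : ℝ} (hK : 0 ≤ K) (hD : 0 ≤ D) (hDD : D ≤ D') (hδ : 0 ≤ δ)
    (hδδ : δ ≤ δ') : timeModulus m K D δ ≤ timeModulus m K D' δ' := by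
  have := hδ.trans hδδ
  rw [timeModulus, timeModulus]
  gcongr

theorem tendsto_timeModulus (m : ℕ) (K D : ℝ) :
    Tendsto (fun δ => timeModulus m K D δ) (𝓝 0) (𝓝 0) := by
  have h : Continuous fun δ => timeModulus m K D δ := by
    unfold timeModulus
    fun_prop
  have := h.tendsto 0
  simpa [timeModulus] using this

theorem norm_langevinDyadic_sub_le_abs (hu : Lip2 K u) (hK : 0 ≤ K) (hV : UnifConvex c C V)
    {s t δ : ℝ} (hs : s ∈ dyadics) (ht : t ∈ dyadics) (hst : |s - t| ≤ δ) (x : SATuple m N) :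
    ‖langevinDyadic V t u x - langevinDyadic V s u x‖ ≤
      timeModulus m K (norm2 (normGrad V x).mat) δ := by
  rcases le_total s t with h | h
  · refine (norm_langevinDyadic_sub_le hu hK hV hs ht h x).trans
      (timeModulus_mono hK (norm2_nonneg _) le_rfl (sub_nonneg.2 h) ?_)
    rw [abs_sub_comm] at hst
    exact (le_abs_self _).trans hst
  · rw [norm_sub_rev]
    exact (norm_langevinDyadic_sub_le hu hK hV ht hs h x).trans
      (timeModulus_mono hK (norm2_nonneg _) le_rfl (sub_nonneg.2 h) ((le_abs_self _).trans hst))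

/-- Rounding 2^l t down keeps the approximating dyadics nonnegative, so t = 0 needs no separate
case. -/
theorem nhdsWithin_dyadics_neBot {t : ℝ} (ht : 0 ≤ t) : (𝓝[dyadics] t).NeBot := by
  rw [← mem_closure_iff_nhdsWithin_neBot, Metric.mem_closure_iff]
  intro ε hε
  obtain ⟨l, hl⟩ := exists_pow_lt_of_lt_one hε (by norm_num : (1 / 2 : ℝ) < 1)
  refine ⟨(⌊(2 : ℝ) ^ l * t⌋₊ : ℝ) / 2 ^ l, ⟨_, l, rfl⟩, ?_⟩
  have h2 : (0 : ℝ) < 2 ^ l := by positivity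
  have h3 := Nat.floor_le (mul_nonneg h2.le ht)
  have h4 := Nat.lt_floor_add_one ((2 : ℝ) ^ l * t)
  have h5 : t - (⌊(2 : ℝ) ^ l * t⌋₊ : ℝ) / 2 ^ l =
      ((2 : ℝ) ^ l * t - ⌊(2 : ℝ) ^ l * t⌋₊) / 2 ^ l := by field_simp
  rw [Real.dist_eq, h5, abs_of_nonneg (div_nonneg (by linarith) h2.le)]
  refine lt_of_le_of_lt ?_ hl
  rw [div_pow, one_pow]
  gcongr
  linarith

theorem tendsto_langevinDyadic (hu : Lip2 K u) (hK : 0 ≤ K) (hV : UnifConvex c C V) {t : ℝ}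
    (ht : 0 ≤ t) (x : SATuple m N) :
    Tendsto (fun s => langevinDyadic V s u x) (𝓝[dyadics] t) (𝓝 (langevin V t u x)) := by
  have hne := nhdsWithin_dyadics_neBot ht
  refine tendsto_nhds_limUnder (cauchy_map_iff_exists_tendsto.1 ?_)
  rw [Metric.cauchy_iff]
  refine ⟨inferInstance, fun ε hε => ?_⟩
  have h1 := ((tendsto_timeModulus m K (norm2 (normGrad V x).mat)).eventually (gt_mem_nhds hε))
  obtain ⟨η, hη, hη'⟩ := Metric.eventually_nhds_iff.1 h1
  refine ⟨(fun s => langevinDyadic V s u x) '' (dyadics ∩ Metric.ball t (η / 4)),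
    image_mem_map (inter_mem_nhdsWithin _ (Metric.ball_mem_nhds _ (by positivity))), ?_⟩
  rintro _ ⟨s, ⟨hs, hs'⟩, rfl⟩ _ ⟨s', ⟨hs1, hs1'⟩, rfl⟩
  rw [dist_eq_norm]
  rw [Metric.mem_ball] at hs' hs1'
  refine (norm_langevinDyadic_sub_le_abs hu hK hV hs1 hs (δ := η / 2) ?_ x).trans_lt (hη' ?_)
  · rw [← Real.dist_eq]
    linarith [dist_triangle_right s' s t]
  · rw [Real.dist_eq, sub_zero, abs_of_pos (by positivity)]
    linarith

theorem norm_langevin_sub_langevinDyadic_le (hu : Lip2 K u) (hK : 0 ≤ K) (hV : UnifConvex c C V)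
    {s t δ : ℝ} (ht : 0 ≤ t) (hs : s ∈ dyadics) (hst : |s - t| < δ) (x : SATuple m N) :
    ‖langevin V t u x - langevinDyadic V s u x‖ ≤
      timeModulus m K (norm2 (normGrad V x).mat) (2 * δ) := by
  have hne := nhdsWithin_dyadics_neBot ht
  have h1 := ((tendsto_langevinDyadic hu hK hV ht x).sub_const (langevinDyadic V s u x)).norm
  refine le_of_tendsto h1 ?_
  filter_upwards [self_mem_nhdsWithin, mem_nhdsWithin_of_mem_nhds
    (Metric.ball_mem_nhds t ((abs_nonneg _).trans_lt hst))] with r hr hr'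
  refine norm_langevinDyadic_sub_le_abs hu hK hV hs hr ?_ x
  rw [Metric.mem_ball] at hr'
  rw [← Real.dist_eq] at hst ⊢
  linarith [dist_triangle_right s r t]

end Semigroups

/-! ### Trace words and the Schwinger–Dyson equation -/

section Words

variable {m N : ℕ}

/-- Words in two families of letters: `inl j` stands for `x_j` and `inr j` for `z_j`. -/
abbrev TwoWord (m : ℕ) : Type := List (Fin m ⊕ Fin m)

/-- The value of a letter. -/
def letterVal (x z : SATuple m N) : Fin m ⊕ Fin m → Matrix (Fin N) (Fin N) ℂ :=
  Sum.elim x.mat z.mat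

/-- The value of a word. -/
def wordVal (x z : SATuple m N) (w : TwoWord m) : Matrix (Fin N) (Fin N) ℂ :=
  (w.map (letterVal x z)).prod

/-- The value of a product of traces of words. -/
def traceProd (x z : SATuple m N) (L : List (TwoWord m)) : ℂ :=
  (L.map fun w => normTrace N (wordVal x z w)).prod

/-- The derivative of `wordVal x z w` when `z_b` moves in the direction `H`. -/
def wordDeriv (x z : SATuple m N) (b : Fin m) (H : Matrix (Fin N) (Fin N) ℂ) :
    TwoWord m → Matrix (Fin N) (Fin N) ℂ
  | [] => 0
  | a :: w => (if a = .inr b then H else 0) * wordVal x z w +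
      letterVal x z a * wordDeriv x z b H w

/-- The derivative of `traceProd x z L` when `z_b` moves in the direction `H`. -/
def traceDeriv (x z : SATuple m N) (b : Fin m) (H : Matrix (Fin N) (Fin N) ℂ) :
    List (TwoWord m) → ℂ
  | [] => 0
  | w :: L => normTrace N (wordDeriv x z b H w) * traceProd x z L +
      normTrace N (wordVal x z w) * traceDeriv x z b H L

/-- All pairs `(A₁, A₂)` with `w = A₁ z_b A₂`. -/
def splits (b : Fin m) : TwoWord m → List (TwoWord m × TwoWord m)
  | [] => []
  | a :: w => (if a = .inr b then [([], w)] else []) ++ (splits b w).map fun s => (a :: s.1, s.2)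

/-- All ways to single out a letter `z_b` in one of the words. -/
def markings (b : Fin m) : List (TwoWord m) → List ((TwoWord m × TwoWord m) × List (TwoWord m))
  | [] => []
  | w :: L => (splits b w).map (fun s => (s, L)) ++
      (markings b L).map fun s => (s.1, w :: s.2)

theorem wordVal_cons (x z : SATuple m N) (a : Fin m ⊕ Fin m) (w : TwoWord m) :
    wordVal x z (a :: w) = letterVal x z a * wordVal x z w := by
  simp [wordVal]

theorem wordVal_append (x z : SATuple m N) (v w : TwoWord m) :
    wordVal x z (v ++ w) = wordVal x z v * wordVal x z w := by
  simp [wordVal]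

theorem traceProd_cons (x z : SATuple m N) (w : TwoWord m) (L : List (TwoWord m)) :
    traceProd x z (w :: L) = normTrace N (wordVal x z w) * traceProd x z L := by
  simp [traceProd]

theorem normTrace_mul_comm (A B : Matrix (Fin N) (Fin N) ℂ) :
    normTrace N (A * B) = normTrace N (B * A) := by
  simp [normTrace, Matrix.trace_mul_comm A B]

theorem wordDeriv_eq_sum (x z : SATuple m N) (b : Fin m) (H : Matrix (Fin N) (Fin N) ℂ)
    (w : TwoWord m) : wordDeriv x z b H w =
      ((splits b w).map fun s => wordVal x z s.1 * H * wordVal x z s.2).sum := by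
  induction w with
  | nil => simp [wordDeriv, splits]
  | cons a w ih =>
    rw [wordDeriv, splits, ih, List.map_append, List.sum_append, List.map_map,
      ← List.sum_map_mul_left]
    congr 1
    · split_ifs <;> simp [wordVal]
    · congr 2
      funext s
      simp only [Function.comp_apply, wordVal_cons, mul_assoc]

theorem traceDeriv_eq_sum (x z : SATuple m N) (b : Fin m) (H : Matrix (Fin N) (Fin N) ℂ)
    (L : List (TwoWord m)) : traceDeriv x z b H L =
      ((markings b L).map fun s =>
        normTrace N (wordVal x z s.1.1 * H * wordVal x z s.1.2) * traceProd x z s.2).sum := by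
  induction L with
  | nil => simp [traceDeriv, markings]
  | cons w L ih =>
    rw [traceDeriv, markings, ih, List.map_append, List.sum_append, List.map_map, List.map_map,
      ← List.sum_map_mul_left, wordDeriv_eq_sum, map_list_sum, List.map_map,
      ← List.sum_map_mul_right]
    congr 1
    congr 2
    funext s
    simp only [Function.comp_apply, traceProd_cons]
    ring

/-- H may be any complex matrix in the formal derivative. Complex linearity combines the genuine
derivatives along two self-adjoint directions into the formal one along a matrix unit. -/
theorem wordDeriv_add_smul (x z : SATuple m N) (b : Fin m) (H H' : Matrix (Fin N) (Fin N) ℂ)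
    (r : ℂ) (w : TwoWord m) : wordDeriv x z b (H + r • H') w =
      wordDeriv x z b H w + r • wordDeriv x z b H' w := by
  induction w with
  | nil => simp [wordDeriv]
  | cons a w ih =>
    rw [wordDeriv, wordDeriv, wordDeriv, ih]
    split_ifs
    · simp only [add_mul, mul_add, smul_add, smul_mul_assoc, mul_smul_comm]
      abel
    · simp only [zero_mul, zero_add, mul_add, mul_smul_comm]

theorem traceDeriv_add_smul (x z : SATuple m N) (b : Fin m) (H H' : Matrix (Fin N) (Fin N) ℂ)
    (r : ℂ) (L : List (TwoWord m)) : traceDeriv x z b (H + r • H') L =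
      traceDeriv x z b H L + r * traceDeriv x z b H' L := by
  induction L with
  | nil => simp [traceDeriv]
  | cons w L ih =>
    rw [traceDeriv, traceDeriv, traceDeriv, ih, wordDeriv_add_smul, map_add, map_smul,
      smul_eq_mul]
    ring

theorem hasLineDerivAt_letterVal (x y h : SATuple m N) (b : Fin m) (H : Matrix (Fin N) (Fin N) ℂ)
    (hh : ∀ a, h.mat a = if a = b then H else 0) (a : Fin m ⊕ Fin m) (i j : Fin N) :
    HasLineDerivAt ℝ (fun y => letterVal x (x + y) a i j)
      ((if a = .inr b then H else 0 : Matrix (Fin N) (Fin N) ℂ) i j) y h := by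
  cases a with
  | inl a => simpa [letterVal] using
      (hasFDerivAt_const (𝕜 := ℝ) (x.mat a i j) y).hasLineDerivAt h
  | inr a =>
    have h1 := ((SATuple.entryCLM a i j).hasFDerivAt (x := y)).const_add (x.mat a i j)
    have h2 := h1.hasLineDerivAt h
    have h3 : (SATuple.entryCLM a i j) h =
        (if (Sum.inr a : Fin m ⊕ Fin m) = .inr b then H else 0 : Matrix (Fin N) (Fin N) ℂ) i j := by
      have := congrFun (congrFun (hh a) i) j
      simp only [Sum.inr.injEq]
      rw [← this]
      rfl
    rw [h3] at h2
    exact h2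

theorem HasLineDerivAt.mul' {E : Type*} [NormedAddCommGroup E] [NormedSpace ℝ E] {F G : E → ℂ}
    {F' G' : ℂ} {y h : E} (hF : HasLineDerivAt ℝ F F' y h) (hG : HasLineDerivAt ℝ G G' y h) :
    HasLineDerivAt ℝ (fun y => F y * G y) (F' * G y + F y * G') y h := by
  have := HasDerivAt.mul hF hG
  simp only [zero_smul, add_zero] at this
  exact this

theorem HasLineDerivAt.finset_sum' {ι E : Type*} [NormedAddCommGroup E] [NormedSpace ℝ E]
    {s : Finset ι} {F : ι → E → ℂ} {F' : ι → ℂ} {y h : E}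
    (hF : ∀ i ∈ s, HasLineDerivAt ℝ (F i) (F' i) y h) :
    HasLineDerivAt ℝ (fun y => ∑ i ∈ s, F i y) (∑ i ∈ s, F' i) y h := by
  have := HasDerivAt.fun_sum hF
  exact this

theorem hasLineDerivAt_wordVal (x y h : SATuple m N) (b : Fin m) (H : Matrix (Fin N) (Fin N) ℂ)
    (hh : ∀ a, h.mat a = if a = b then H else 0) (w : TwoWord m) (i j : Fin N) :
    HasLineDerivAt ℝ (fun y => wordVal x (x + y) w i j)
      (wordDeriv x (x + y) b H w i j) y h := by
  induction w generalizing i j with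
  | nil => simpa [wordVal, wordDeriv] using
      (hasFDerivAt_const (𝕜 := ℝ) ((1 : Matrix (Fin N) (Fin N) ℂ) i j) y).hasLineDerivAt h
  | cons a w ih =>
    simp only [wordVal_cons, wordDeriv, Matrix.add_apply, Matrix.mul_apply,
      ← Finset.sum_add_distrib]
    exact HasLineDerivAt.finset_sum' fun k _ =>
      (hasLineDerivAt_letterVal x y h b H hh a i k).mul' (ih k j)

theorem normTrace_eq_sum (A : Matrix (Fin N) (Fin N) ℂ) :
    normTrace N A = ∑ i, (N : ℂ)⁻¹ * A i i := by
  simp [normTrace, Matrix.trace, Finset.mul_sum]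

theorem hasLineDerivAt_normTrace_wordVal (x y h : SATuple m N) (b : Fin m)
    (H : Matrix (Fin N) (Fin N) ℂ) (hh : ∀ a, h.mat a = if a = b then H else 0) (w : TwoWord m) :
    HasLineDerivAt ℝ (fun y => normTrace N (wordVal x (x + y) w))
      (normTrace N (wordDeriv x (x + y) b H w)) y h := by
  simp only [normTrace_eq_sum]
  exact HasLineDerivAt.finset_sum' fun i _ =>
    (hasLineDerivAt_wordVal x y h b H hh w i i).const_mul _

theorem hasLineDerivAt_traceProd (x y h : SATuple m N) (b : Fin m)
    (H : Matrix (Fin N) (Fin N) ℂ) (hh : ∀ a, h.mat a = if a = b then H else 0)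
    (L : List (TwoWord m)) :
    HasLineDerivAt ℝ (fun y => traceProd x (x + y) L) (traceDeriv x (x + y) b H L) y h := by
  induction L with
  | nil => simpa [traceProd, traceDeriv] using
      (hasFDerivAt_const (𝕜 := ℝ) (1 : ℂ) y).hasLineDerivAt h
  | cons w L ih =>
    simp only [traceProd_cons, traceDeriv]
    exact (hasLineDerivAt_normTrace_wordVal x y h b H hh w).mul' ih

theorem expGrowth_letterVal (x : SATuple m N) (a : Fin m ⊕ Fin m) (i j : Fin N) :
    ExpGrowth fun y : SATuple m N => letterVal x (x + y) a i j := by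
  cases a with
  | inl a => exact ExpGrowth.const _
  | inr a => exact (ExpGrowth.const (x.mat a i j)).add (expGrowth_entry a i j)

theorem expGrowth_wordVal (x : SATuple m N) (w : TwoWord m) (i j : Fin N) :
    ExpGrowth fun y : SATuple m N => wordVal x (x + y) w i j := by
  induction w generalizing i j with
  | nil => exact ExpGrowth.const _
  | cons a w ih =>
    simp only [wordVal_cons, Matrix.mul_apply]
    exact ExpGrowth.finset_sum _ fun k => (expGrowth_letterVal x a i k).mul (ih k j)

theorem expGrowth_wordDeriv (x : SATuple m N) (b : Fin m) (H : Matrix (Fin N) (Fin N) ℂ)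
    (w : TwoWord m) (i j : Fin N) :
    ExpGrowth fun y : SATuple m N => wordDeriv x (x + y) b H w i j := by
  induction w generalizing i j with
  | nil => exact ExpGrowth.const _
  | cons a w ih =>
    simp only [wordDeriv, Matrix.add_apply, Matrix.mul_apply]
    exact (ExpGrowth.finset_sum _ fun k => (ExpGrowth.const _).mul
      (expGrowth_wordVal x w k j)).add
      (ExpGrowth.finset_sum _ fun k => (expGrowth_letterVal x a i k).mul (ih k j))

theorem expGrowth_normTrace {F : SATuple m N → Matrix (Fin N) (Fin N) ℂ}
    (hF : ∀ i j, ExpGrowth fun y => F y i j) : ExpGrowth fun y => normTrace N (F y) := by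
  simp only [normTrace_eq_sum]
  exact ExpGrowth.finset_sum _ fun i => (ExpGrowth.const _).mul (hF i i)

theorem expGrowth_traceProd (x : SATuple m N) (L : List (TwoWord m)) :
    ExpGrowth fun y : SATuple m N => traceProd x (x + y) L := by
  induction L with
  | nil => exact ExpGrowth.const _
  | cons w L ih =>
    simp only [traceProd_cons]
    exact (expGrowth_normTrace (expGrowth_wordVal x w)).mul ih

theorem expGrowth_traceDeriv (x : SATuple m N) (b : Fin m) (H : Matrix (Fin N) (Fin N) ℂ)
    (L : List (TwoWord m)) :
    ExpGrowth fun y : SATuple m N => traceDeriv x (x + y) b H L := by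
  induction L with
  | nil => exact ExpGrowth.const _
  | cons w L ih =>
    simp only [traceDeriv]
    exact ((expGrowth_normTrace (expGrowth_wordDeriv x b H w)).mul (expGrowth_traceProd x L)).add
      ((expGrowth_normTrace (expGrowth_wordVal x w)).mul ih)

/-- Since ∑ (A E_{ji} B)_{ji} = Tr A · Tr B, contraction within one word cuts its trace in two; N²
comes from normalising both traces. -/
theorem sum_wordDeriv_single (x z : SATuple m N) (hN : 1 ≤ N) (b : Fin m) (w : TwoWord m) :
    ∑ i, ∑ j, wordDeriv x z b (Matrix.single j i (1 : ℂ)) w j i =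
      N ^ 2 * ((splits b w).map fun s =>
        normTrace N (wordVal x z s.1) * normTrace N (wordVal x z s.2)).sum := by
  have hN' : (N : ℂ) ≠ 0 := by exact_mod_cast (by omega : N ≠ 0)
  simp only [wordDeriv_eq_sum]
  induction splits b w with
  | nil => simp
  | cons s S ih =>
    simp only [List.map_cons, List.sum_cons, Matrix.add_apply, Finset.sum_add_distrib, ih, mul_add]
    congr 1
    have : ∀ (A B : Matrix (Fin N) (Fin N) ℂ) (i j : Fin N),
        (A * Matrix.single j i (1 : ℂ) * B) j i = A j j * B i i := by
      intro A B i j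
      rw [mul_assoc, Matrix.mul_apply, Finset.sum_eq_single j]
      · simp
      · intro k _ hk
        rw [Matrix.single_mul_apply_of_ne _ _ _ _ _ hk, mul_zero]
      · simp
    simp only [this, normTrace_eq_sum, ← Finset.mul_sum, ← Finset.sum_mul]
    field_simp

/-- Contraction with a letter of another trace merges the two into one. No N² appears here, so this
term is smaller than the cutting term by 1/N². -/
theorem sum_mul_traceDeriv_single (x z : SATuple m N) (b : Fin m)
    (A : Matrix (Fin N) (Fin N) ℂ) (L : List (TwoWord m)) :
    ∑ i, ∑ j, A j i * traceDeriv x z b (Matrix.single j i (1 : ℂ)) L =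
      ((markings b L).map fun s =>
        normTrace N (A * (wordVal x z s.1.2 * wordVal x z s.1.1)) * traceProd x z s.2).sum := by
  simp only [traceDeriv_eq_sum]
  induction markings b L with
  | nil => simp
  | cons s S ih =>
    simp only [List.map_cons, List.sum_cons, Finset.sum_add_distrib, ih, mul_add]
    congr 1
    have : ∀ (B D : Matrix (Fin N) (Fin N) ℂ) (i j : Fin N),
        normTrace N (B * Matrix.single j i (1 : ℂ) * D) = (N : ℂ)⁻¹ * (D * B) i j := by
      intro B D i j
      rw [normTrace_mul_comm, ← mul_assoc, normTrace_mul_comm]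
      simp [normTrace, Matrix.trace_single_mul]
    simp only [this]
    rw [normTrace_eq_sum, Finset.sum_comm, Finset.sum_mul]
    refine Finset.sum_congr rfl fun j _ => ?_
    rw [Matrix.mul_apply, Finset.mul_sum, Finset.sum_mul]
    refine Finset.sum_congr rfl fun i _ => ?_
    ring

theorem integrable_list_sum {α ι : Type*} [MeasurableSpace α] {μ : Measure α} (S : List ι)
    {F : ι → α → ℂ} (hF : ∀ s ∈ S, Integrable (F s) μ) :
    Integrable (fun a => (S.map fun s => F s a).sum) μ := by
  induction S with
  | nil => simp
  | cons s S ih =>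
    simp only [List.map_cons, List.sum_cons]
    exact (hF s (by simp)).add (ih fun s' hs => hF s' (by simp [hs]))

theorem integral_list_sum {α ι : Type*} [MeasurableSpace α] {μ : Measure α} (S : List ι)
    {F : ι → α → ℂ} (hF : ∀ s ∈ S, Integrable (F s) μ) :
    ∫ a, (S.map fun s => F s a).sum ∂μ = (S.map fun s => ∫ a, F s a ∂μ).sum := by
  induction S with
  | nil => simp
  | cons s S ih =>
    simp only [List.map_cons, List.sum_cons]
    have h := fun s' hs => hF s' (List.mem_cons_of_mem s hs)
    rw [integral_add (hF s (by simp)) (integrable_list_sum S h), ih h]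

/-- The Schwinger–Dyson equation for the shifted GUE. -/
theorem integral_traceProd_cons {t : ℝ} (hN : 1 ≤ N) (ht : 0 < t) (x : SATuple m N) (b : Fin m)
    (A : TwoWord m) (L : List (TwoWord m)) :
    ∫ y, traceProd x (x + y) ((.inr b :: A) :: L) ∂(gue m N t) =
      ∫ y, traceProd x (x + y) ((.inl b :: A) :: L) ∂(gue m N t) +
      t * ((splits b A).map fun s =>
        ∫ y, traceProd x (x + y) (s.1 :: s.2 :: L) ∂(gue m N t)).sum +
      (t / N ^ 2) * ((markings b L).map fun s =>
        ∫ y, traceProd x (x + y) ((A ++ (s.1.2 ++ s.1.1)) :: s.2) ∂(gue m N t)).sum := by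
  have hN' : (N : ℂ) ≠ 0 := by exact_mod_cast (by omega : N ≠ 0)
  have hi : ∀ L, Integrable (fun y => traceProd x (x + y) L) (gue m N t) :=
    fun L => (expGrowth_traceProd x L).integrable_gue hN ht
  -- The leading letter is z_b = x_b + y_b, and only the factor y_b is integrated by parts.
  have e1 : ∀ y, traceProd x (x + y) ((.inr b :: A) :: L) =
      traceProd x (x + y) ((.inl b :: A) :: L) + ∑ i, ∑ j, (N : ℂ)⁻¹ *
        (y.mat b i j * (wordVal x (x + y) A j i * traceProd x (x + y) L)) := by
    intro y
    rw [traceProd_cons, traceProd_cons, wordVal_cons, wordVal_cons]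
    have : letterVal x (x + y) (.inr b) = letterVal x (x + y) (.inl b) + y.mat b := rfl
    rw [this, add_mul, map_add, add_mul]
    congr 1
    rw [normTrace_eq_sum, Finset.sum_mul]
    refine Finset.sum_congr rfl fun i _ => ?_
    rw [Matrix.mul_apply, Finset.mul_sum, Finset.sum_mul]
    refine Finset.sum_congr rfl fun j _ => ?_
    ring
  have hF : ∀ i j, ExpGrowth fun y : SATuple m N =>
      wordVal x (x + y) A j i * traceProd x (x + y) L :=
    fun i j => (expGrowth_wordVal x A j i).mul (expGrowth_traceProd x L)
  set D : Matrix (Fin N) (Fin N) ℂ → Fin N → Fin N → SATuple m N → ℂ := fun H i j y =>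
    wordDeriv x (x + y) b H A j i * traceProd x (x + y) L +
      wordVal x (x + y) A j i * traceDeriv x (x + y) b H L with hD
  have hDg : ∀ H i j, ExpGrowth (D H i j) := fun H i j =>
    ((expGrowth_wordDeriv x b H A j i).mul (expGrowth_traceProd x L)).add
      ((expGrowth_wordVal x A j i).mul (expGrowth_traceDeriv x b H L))
  have hDd : ∀ (h : SATuple m N) H (_ : ∀ a, h.mat a = if a = b then H else 0) i j y,
      HasLineDerivAt ℝ (fun y => wordVal x (x + y) A j i * traceProd x (x + y) L)
        (D H i j y) y h := fun h H hh i j y =>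
    (hasLineDerivAt_wordVal x y h b H hh A j i).mul' (hasLineDerivAt_traceProd x y h b H hh L)
  have hDl : ∀ H H' r i j y, D H i j y + r * D H' i j y = D (H + r • H') i j y := by
    intro H H' r i j y
    simp only [hD, wordDeriv_add_smul, traceDeriv_add_smul, Matrix.add_apply, Matrix.smul_apply,
      smul_eq_mul]
    ring
  have e2 : ∀ i j, ∫ y, y.mat b i j * (wordVal x (x + y) A j i * traceProd x (x + y) L)
      ∂(gue m N t) = (t / N) * ∫ y, D (Matrix.single j i (1 : ℂ)) i j y ∂(gue m N t) := by
    intro i j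
    rw [integral_entry_mul_gue hN ht b i j (hF i j)
      (hDg (realPart (Matrix.single j i (1 : ℂ))).1 i j)
      (hDg (imaginaryPart (Matrix.single j i (1 : ℂ))).1 i j)
      (hDd _ _ (fun a => SATuple.single_mat b _ a) i j)
      (hDd _ _ (fun a => SATuple.single_mat b _ a) i j)]
    simp only [hDl]
    rw [realPart_add_I_smul_imaginaryPart]
  have e3 : ∀ y, ∑ i, ∑ j, D (Matrix.single j i (1 : ℂ)) i j y =
      N ^ 2 * ((splits b A).map fun s => traceProd x (x + y) (s.1 :: s.2 :: L)).sum +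
      ((markings b L).map fun s =>
        traceProd x (x + y) ((A ++ (s.1.2 ++ s.1.1)) :: s.2)).sum := by
    intro y
    simp only [hD, Finset.sum_add_distrib, ← Finset.sum_mul]
    rw [sum_wordDeriv_single x _ hN, sum_mul_traceDeriv_single, mul_assoc, ← List.sum_map_mul_right]
    simp only [traceProd_cons, wordVal_append, mul_assoc]
  have hs1 := integrable_list_sum (splits b A) (F := fun s y =>
    traceProd x (x + y) (s.1 :: s.2 :: L)) (μ := gue m N t) fun s _ => hi _
  have hs2 := integrable_list_sum (markings b L) (F := fun s y =>
    traceProd x (x + y) ((A ++ (s.1.2 ++ s.1.1)) :: s.2)) (μ := gue m N t) fun s _ => hi _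
  have hint : ∀ i j, Integrable (fun y : SATuple m N => (N : ℂ)⁻¹ *
        (y.mat b i j * (wordVal x (x + y) A j i * traceProd x (x + y) L))) (gue m N t) :=
    fun i j => (((expGrowth_entry b i j).mul (hF i j)).integrable_gue hN ht).const_mul _
  simp only [e1]
  rw [integral_add (hi _) (integrable_finsetSum _ fun i _ => integrable_finsetSum _
    fun j _ => hint i j), add_assoc]
  congr 1
  rw [integral_finsetSum _ fun i _ => integrable_finsetSum _ fun j _ => hint i j]
  have e4 : ∀ i, ∫ y, ∑ j, (N : ℂ)⁻¹ *
        (y.mat b i j * (wordVal x (x + y) A j i * traceProd x (x + y) L)) ∂(gue m N t) =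
      (t / N ^ 2) * ∑ j, ∫ y, D (Matrix.single j i (1 : ℂ)) i j y ∂(gue m N t) := by
    intro i
    rw [integral_finsetSum _ fun j _ => hint i j, Finset.mul_sum]
    refine Finset.sum_congr rfl fun j _ => ?_
    rw [integral_const_mul, e2]
    field_simp
  have hDi : ∀ i j, Integrable (fun y => D (Matrix.single j i (1 : ℂ)) i j y) (gue m N t) :=
    fun i j => (hDg _ i j).integrable_gue hN ht
  simp only [e4]
  rw [← Finset.mul_sum]
  simp only [← integral_finsetSum _ fun j _ => hDi _ j]
  rw [← integral_finsetSum _ fun i _ => integrable_finsetSum _ fun j _ => hDi i j]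
  simp only [e3]
  rw [integral_add (hs1.const_mul _) hs2, integral_const_mul,
    integral_list_sum _ fun s _ => hi _, integral_list_sum _ fun s _ => hi _]
  field_simp

end Words

/-! ### The heat semigroup on trace polynomials -/

section HeatTracePolynomials

variable {m : ℕ}

/-- Approximation by a single trace polynomial, uniformly on balls as `N → ∞`. -/
def TendstoTrP0 (F : ∀ N, SATuple m N → ℂ) : Prop :=
  ∃ g : TrP0 m, ∀ R > (0 : ℝ), ∀ ε > (0 : ℝ), ∀ᶠ N in atTop, ∀ x : SATuple m N,
    normInf x.mat ≤ R → ‖F N x - eval0 x g‖ ≤ ε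

namespace TendstoTrP0

variable {F G : ∀ N, SATuple m N → ℂ}

theorem congr (hF : TendstoTrP0 F) (h : ∀ N ≥ 1, ∀ x, G N x = F N x) : TendstoTrP0 G := by
  obtain ⟨g, hg⟩ := hF
  refine ⟨g, fun R hR ε hε => ?_⟩
  filter_upwards [hg R hR ε hε, eventually_ge_atTop 1] with N h1 h2 x hx
  rw [h N h2]
  exact h1 x hx

theorem eval0 (g : TrP0 m) : TendstoTrP0 fun _ x => eval0 x g :=
  ⟨g, fun R _ ε hε => Eventually.of_forall fun N x _ => by simpa using hε.le⟩

theorem add (hF : TendstoTrP0 F) (hG : TendstoTrP0 G) :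
    TendstoTrP0 fun N x => F N x + G N x := by
  obtain ⟨f, hf⟩ := hF
  obtain ⟨g, hg⟩ := hG
  refine ⟨f + g, fun R hR ε hε => ?_⟩
  filter_upwards [hf R hR (ε / 2) (half_pos hε), hg R hR (ε / 2) (half_pos hε)] with N h1 h2 x hx
  rw [map_add, add_sub_add_comm]
  exact (norm_add_le _ _).trans ((add_le_add (h1 x hx) (h2 x hx)).trans (add_halves ε).le)

theorem const_mul (hF : TendstoTrP0 F) (r : ℂ) : TendstoTrP0 fun N x => r * F N x := by
  obtain ⟨f, hf⟩ := hF
  refine ⟨r • f, fun R hR ε hε => ?_⟩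
  have h0 : 0 < ‖r‖ + 1 := by positivity
  filter_upwards [hf R hR (ε / (‖r‖ + 1)) (by positivity)] with N h1 x hx
  rw [map_smul, smul_eq_mul, ← mul_sub, norm_mul]
  calc ‖r‖ * ‖F N x - _‖ ≤ (‖r‖ + 1) * (ε / (‖r‖ + 1)) :=
        mul_le_mul (by linarith) (h1 x hx) (norm_nonneg _) h0.le
    _ = ε := by field_simp

/-- F inherits from its approximant a bound on operator-norm balls uniform in large N, so the limit
is 0. -/
theorem div_sq (hF : TendstoTrP0 F) (r : ℂ) :
    TendstoTrP0 fun N x => r / (N : ℂ) ^ 2 * F N x := by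
  obtain ⟨f, hf⟩ := hF
  refine ⟨0, fun R hR ε hε => ?_⟩
  obtain ⟨B, hB, hb⟩ := f.exists_bound (R := R)
  have hlim : Tendsto (fun N : ℕ => ‖r‖ / (N : ℝ) ^ 2 * (1 + B)) atTop (𝓝 0) := by
    have h1 : Tendsto (fun N : ℕ => (N : ℝ) ^ 2) atTop atTop :=
      (tendsto_pow_atTop two_ne_zero).comp tendsto_natCast_atTop_atTop
    simpa using (h1.const_div_atTop ‖r‖).mul_const (1 + B)
  filter_upwards [hf R hR 1 one_pos, hlim.eventually_le_const hε] with N h1 h2 x hx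
  have h3 : ‖F N x‖ ≤ 1 + B := by
    have := norm_add_le (F N x - _root_.eval0 x f) (_root_.eval0 x f)
    rw [sub_add_cancel] at this
    linarith [h1 x hx, hb N x hx]
  rw [map_zero, sub_zero, norm_mul, norm_div, norm_pow, Complex.norm_natCast]
  exact (mul_le_mul_of_nonneg_left h3 (by positivity)).trans h2

theorem list_sum {ι : Type*} (S : List ι) {F : ι → ∀ N, SATuple m N → ℂ}
    (hF : ∀ s ∈ S, TendstoTrP0 (F s)) : TendstoTrP0 fun N x => (S.map fun s => F s N x).sum := by
  induction S with
  | nil => exact (TendstoTrP0.eval0 0).congr fun N _ x => by simp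
  | cons s S ih =>
    simp only [List.map_cons, List.sum_cons]
    exact (hF s (by simp)).add (ih fun s' hs => hF s' (by simp [hs]))

end TendstoTrP0

/-- The number of letters `z_j` in a list of words. -/
def zCount (L : List (TwoWord m)) : ℕ := (L.map (List.countP Sum.isRight)).sum

theorem zCount_cons (w : TwoWord m) (L : List (TwoWord m)) :
    zCount (w :: L) = w.countP Sum.isRight + zCount L := by simp [zCount]

theorem countP_of_mem_splits {b : Fin m} {w : TwoWord m} {s : TwoWord m × TwoWord m}
    (hs : s ∈ splits b w) :
    w.countP Sum.isRight = s.1.countP Sum.isRight + s.2.countP Sum.isRight + 1 := by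
  induction w generalizing s with
  | nil => simp [splits] at hs
  | cons a w ih =>
    rw [splits, List.mem_append] at hs
    rcases hs with hs | hs
    · split_ifs at hs with h
      · rw [List.mem_singleton] at hs
        subst hs
        rw [h, List.countP_cons]
        simp
      · simp at hs
    · obtain ⟨s', hs', rfl⟩ := List.mem_map.1 hs
      have := ih hs'
      simp only [List.countP_cons]
      omega

theorem zCount_of_mem_markings {b : Fin m} {L : List (TwoWord m)}
    {s : (TwoWord m × TwoWord m) × List (TwoWord m)} (hs : s ∈ markings b L) :
    zCount L = s.1.1.countP Sum.isRight + s.1.2.countP Sum.isRight + zCount s.2 + 1 := by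
  induction L generalizing s with
  | nil => simp [markings] at hs
  | cons w L ih =>
    rw [markings, List.mem_append] at hs
    rcases hs with hs | hs
    · obtain ⟨s', hs', rfl⟩ := List.mem_map.1 hs
      have := countP_of_mem_splits hs'
      simp only [zCount_cons]
      omega
    · obtain ⟨s', hs', rfl⟩ := List.mem_map.1 hs
      have := ih hs'
      simp only [zCount_cons]
      omega

theorem traceProd_perm {N : ℕ} (x z : SATuple m N) {L L' : List (TwoWord m)} (h : L.Perm L') :
    traceProd x z L = traceProd x z L' :=
  (h.map _).prod_eq

theorem exists_eval0_eq_traceProd (L : List (TwoWord m)) (hL : zCount L = 0) :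
    ∃ g : TrP0 m, ∀ N (x z : SATuple m N), traceProd x z L = eval0 x g := by
  induction L with
  | nil => exact ⟨1, fun N x z => by simp [traceProd]⟩
  | cons w L ih =>
    rw [zCount_cons, Nat.add_eq_zero_iff] at hL
    obtain ⟨g, hg⟩ := ih hL.2
    have h1 : ∃ p : NCPoly m, ∀ N (x z : SATuple m N), wordVal x z w = evalNC x p := by
      have h2 := hL.1
      clear hL
      induction w with
      | nil => exact ⟨1, fun N x z => by simp [wordVal]⟩
      | cons a w ihw =>
        rw [List.countP_cons, Nat.add_eq_zero_iff] at h2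
        obtain ⟨p, hp⟩ := ihw h2.1
        cases a with
        | inl a => exact ⟨FreeAlgebra.ι ℂ a * p, fun N x z => by
            rw [wordVal_cons, map_mul, evalNC_ι, hp N x z]; rfl⟩
        | inr a => simp at h2
    obtain ⟨p, hp⟩ := h1
    exact ⟨SymmetricAlgebra.ι ℂ _ ((commutatorSpan m).mkQ p) * g, fun N x z => by
      rw [traceProd_cons, map_mul, eval0_ι_mk, hp N x z, hg]⟩

/-- Commutativity of the scalar factors and cyclicity of the trace bring a shifted Gaussian letter
to the very front, as the Schwinger–Dyson equation requires. -/
theorem exists_rotate_of_zCount_ne_zero (L : List (TwoWord m)) (hL : zCount L ≠ 0) :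
    ∃ (b : Fin m) (A : TwoWord m) (L' : List (TwoWord m)),
      zCount ((.inr b :: A) :: L') = zCount L ∧
      ∀ N (x z : SATuple m N), traceProd x z L = traceProd x z ((.inr b :: A) :: L') := by
  obtain ⟨w, hw, hw0⟩ : ∃ w ∈ L, w.countP Sum.isRight ≠ 0 := by
    by_contra! h
    exact hL (List.sum_eq_zero fun k hk => by
      obtain ⟨w, hw, rfl⟩ := List.mem_map.1 hk
      exact h w hw)
  obtain ⟨a, ha, haR⟩ := List.countP_pos_iff.1 (Nat.pos_of_ne_zero hw0)
  obtain ⟨b, rfl⟩ := Sum.isRight_iff.1 haR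
  obtain ⟨A₁, A₂, rfl⟩ := List.append_of_mem ha
  obtain ⟨L₁, L₂, rfl⟩ := List.append_of_mem hw
  refine ⟨b, A₂ ++ A₁, L₁ ++ L₂, ?_, fun N x z => ?_⟩
  · simp only [zCount, List.map_cons, List.map_append, List.sum_cons, List.sum_append,
      List.countP_cons, List.countP_append]
    omega
  · rw [traceProd_perm x z List.perm_middle, traceProd_cons, traceProd_cons, wordVal_append,
      normTrace_mul_comm, ← wordVal_append, List.cons_append]

/-- Induction on the number of letters z. In the Schwinger–Dyson equation the first term on the
right has one such letter fewer, the cutting and merging terms two fewer, and the merging terms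
vanish as N → ∞. -/
theorem tendstoTrP0_integral_traceProd {t : ℝ} (ht : 0 < t) (L : List (TwoWord m)) :
    TendstoTrP0 fun N (x : SATuple m N) => ∫ y, traceProd x (x + y) L ∂(gue m N t) := by
  induction hn : zCount L using Nat.strong_induction_on generalizing L with
  | _ n ih =>
    subst hn
    by_cases h0 : zCount L = 0
    · obtain ⟨g, hg⟩ := exists_eval0_eq_traceProd L h0
      refine (TendstoTrP0.eval0 g).congr fun N hN x => ?_
      have := isProbabilityMeasure_gue (m := m) hN ht
      simp [hg]
    · obtain ⟨b, A, L', hc, hL'⟩ := exists_rotate_of_zCount_ne_zero L h0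
      rw [zCount_cons, List.countP_cons] at hc
      simp only [Sum.isRight_inr, if_true] at hc
      have h1 := ih _ (by rw [← hc, zCount_cons, List.countP_cons]; simp) ((.inl b :: A) :: L') rfl
      have h2 := (TendstoTrP0.list_sum (splits b A) (F := fun s N (x : SATuple m N) =>
        ∫ y, traceProd x (x + y) (s.1 :: s.2 :: L') ∂(gue m N t)) fun s hs =>
          ih _ (by
            have := countP_of_mem_splits hs
            rw [zCount_cons, zCount_cons]; omega) _ rfl).const_mul t
      have h3 := (TendstoTrP0.list_sum (markings b L') (F := fun s N (x : SATuple m N) =>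
        ∫ y, traceProd x (x + y) ((A ++ (s.1.2 ++ s.1.1)) :: s.2) ∂(gue m N t)) fun s hs =>
          ih _ (by
            have := zCount_of_mem_markings hs
            rw [zCount_cons, List.countP_append, List.countP_append]; omega) _ rfl).div_sq t
      refine ((h1.add h2).add h3).congr fun N hN x => ?_
      simp only [hL']
      rw [integral_traceProd_cons hN ht x b A L']

theorem NCPoly.mem_span_words (p : NCPoly m) :
    p ∈ Submodule.span ℂ (Set.range fun w : List (Fin m) => (w.map (FreeAlgebra.ι ℂ)).prod) := by
  induction p using FreeAlgebra.induction with
  | grade0 r =>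
    rw [Algebra.algebraMap_eq_smul_one]
    exact Submodule.smul_mem _ _ (Submodule.subset_span ⟨[], by simp⟩)
  | grade1 j => exact Submodule.subset_span ⟨[j], by simp⟩
  | mul a b ha hb =>
    have := Submodule.mul_mem_mul ha hb
    rw [Submodule.span_mul_span] at this
    refine Submodule.span_mono ?_ this
    rintro _ ⟨_, ⟨v, rfl⟩, _, ⟨w, rfl⟩, rfl⟩
    exact ⟨v ++ w, by simp⟩
  | add a b ha hb => exact add_mem ha hb

/-- The product of the traces of the given words, as a trace polynomial. -/
def traceWordProd (L : List (List (Fin m))) : TrP0 m :=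
  (L.map fun w => SymmetricAlgebra.ι ℂ _
    ((commutatorSpan m).mkQ (w.map (FreeAlgebra.ι ℂ)).prod)).prod

theorem TrP0.mem_span_traceWordProd (f : TrP0 m) :
    f ∈ Submodule.span ℂ (Set.range (traceWordProd (m := m))) := by
  induction f using TrP0.induction_mk with
  | h0 r =>
    rw [Algebra.algebraMap_eq_smul_one]
    exact Submodule.smul_mem _ _ (Submodule.subset_span ⟨[], by simp [traceWordProd]⟩)
  | h1 p =>
    have h := NCPoly.mem_span_words p
    induction h using Submodule.span_induction with
    | mem _ h =>
      obtain ⟨w, rfl⟩ := h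
      exact Submodule.subset_span ⟨[w], by simp [traceWordProd]⟩
    | zero => simp
    | add a b _ _ ha hb => rw [map_add, map_add]; exact add_mem ha hb
    | smul r a _ ha => rw [map_smul, map_smul]; exact Submodule.smul_mem _ _ ha
  | hm a b ha hb =>
    have := Submodule.mul_mem_mul ha hb
    rw [Submodule.span_mul_span] at this
    refine Submodule.span_mono ?_ this
    rintro _ ⟨_, ⟨v, rfl⟩, _, ⟨w, rfl⟩, rfl⟩
    exact ⟨v ++ w, by simp [traceWordProd]⟩
  | ha a b ha hb => exact add_mem ha hb

theorem eval0_traceWordProd {N : ℕ} (x z : SATuple m N) (L : List (List (Fin m))) :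
    eval0 z (traceWordProd L) = traceProd x z (L.map (List.map Sum.inr)) := by
  rw [traceWordProd, traceProd, map_list_prod, List.map_map, List.map_map]
  congr 2
  funext w
  simp only [Function.comp_apply, eval0_ι_mk, map_list_prod, wordVal, List.map_map]
  congr 3
  funext j
  simp [evalNC_ι, letterVal]

theorem expGrowth_eval0_add {N : ℕ} (x : SATuple m N) (f : TrP0 m) :
    ExpGrowth fun y => eval0 (x + y) f := by
  induction f.mem_span_traceWordProd using Submodule.span_induction with
  | mem _ h =>
    obtain ⟨L, rfl⟩ := h
    simp only [eval0_traceWordProd x]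
    exact expGrowth_traceProd x _
  | zero => simp only [map_zero]; exact ExpGrowth.const 0
  | add a b _ _ ha hb => simp only [map_add]; exact ha.add hb
  | smul r a _ ha => simp only [map_smul, smul_eq_mul]; exact (ExpGrowth.const r).mul ha

/-- The heat semigroup maps trace polynomials to trace polynomials, up to an error that vanishes as
`N → ∞`. -/
theorem tendstoTrP0_heatSemigroup {t : ℝ} (ht : 0 < t) (f : TrP0 m) :
    TendstoTrP0 fun N => heatSemigroup (N := N) t fun x => eval0 x f := by
  unfold heatSemigroup
  induction f.mem_span_traceWordProd using Submodule.span_induction with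
  | mem _ h =>
    obtain ⟨L, rfl⟩ := h
    refine (tendstoTrP0_integral_traceProd ht (L.map (List.map Sum.inr))).congr fun N _ x => ?_
    simp only [eval0_traceWordProd x]
  | zero => exact (TendstoTrP0.eval0 0).congr fun N _ x => by simp
  | add a b _ _ ha hb =>
    refine (ha.add hb).congr fun N hN x => ?_
    simp only [map_add]
    exact integral_add ((expGrowth_eval0_add x a).integrable_gue hN ht)
      ((expGrowth_eval0_add x b).integrable_gue hN ht)
  | smul r a _ ha =>
    refine (ha.const_mul r).congr fun N hN x => ?_
    simp only [map_smul, smul_eq_mul]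
    exact integral_const_mul _ _

end HeatTracePolynomials

/-! ### Exponential tails of the GUE operator norm -/

section NormTail

variable {m N : ℕ}

theorem ContinuousLinearMap.exists_near_maximizers {E : Type*} [NormedAddCommGroup E]
    [InnerProductSpace ℂ E] (T : E →L[ℂ] E) :
    ∃ v w : E, ‖v‖ ≤ 1 ∧ ‖w‖ ≤ 1 ∧ 9 / 10 * ‖T‖ ≤ (inner ℂ v (T w)).re := by
  rcases (norm_nonneg T).eq_or_lt with h | h
  · exact ⟨0, 0, by simp, by simp, by simp [← h]⟩
  · obtain ⟨w, hw, hTw⟩ := T.exists_lt_apply_of_lt_opNorm (r := 9 / 10 * ‖T‖) (by linarith)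
    have h0 : 0 < ‖T w‖ := lt_of_le_of_lt (by positivity) hTw
    refine ⟨(‖T w‖⁻¹ : ℂ) • T w, w, ?_, hw.le, ?_⟩
    · rw [norm_smul, norm_inv, Complex.norm_real, norm_norm, inv_mul_cancel₀ h0.ne']
    · rw [inner_smul_left, inner_self_eq_norm_sq_to_K, map_inv₀, Complex.conj_ofReal]
      refine hTw.le.trans (le_of_eq ?_)
      have : ((‖T w‖ : ℂ)⁻¹ * ((‖T w‖ : ℝ) : ℂ) ^ 2) = ((‖T w‖ : ℝ) : ℂ) := by
        have : (‖T w‖ : ℂ) ≠ 0 := by exact_mod_cast h0.ne'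
        field_simp
      exact (congrArg Complex.re this).symm

/-- Near-maximising pairs fill a product of balls of fixed radius: 9/10 - 1/8 - (9/8)(1/8) ≥ 1/2. -/
theorem ContinuousLinearMap.half_norm_le_re_inner {E : Type*} [NormedAddCommGroup E]
    [InnerProductSpace ℂ E] (T : E →L[ℂ] E) {v₀ w₀ v w : E} (hv₀ : ‖v₀‖ ≤ 1) (hw₀ : ‖w₀‖ ≤ 1)
    (h : 9 / 10 * ‖T‖ ≤ (inner ℂ v₀ (T w₀)).re) (hv : ‖v - v₀‖ ≤ 1 / 8) (hw : ‖w - w₀‖ ≤ 1 / 8) :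
    ‖T‖ / 2 ≤ (inner ℂ v (T w)).re := by
  have key : ∀ a b : E, |(inner ℂ a (T b)).re| ≤ ‖a‖ * (‖T‖ * ‖b‖) := fun a b =>
    (Complex.abs_re_le_norm _).trans ((norm_inner_le_norm _ _).trans
      (mul_le_mul_of_nonneg_left (T.le_opNorm b) (norm_nonneg _)))
  have e : inner ℂ v (T w) = inner ℂ v₀ (T w₀) + inner ℂ (v - v₀) (T w₀) +
      inner ℂ v (T (w - w₀)) := by
    rw [map_sub, inner_sub_left, inner_sub_right]
    ring
  have hv1 : ‖v‖ ≤ 9 / 8 := by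
    have := norm_add_le (v - v₀) v₀
    rw [sub_add_cancel] at this
    linarith
  have h1 := (abs_le.1 (key (v - v₀) w₀)).1
  have h2 := (abs_le.1 (key v (w - w₀))).1
  have h3 : ‖v - v₀‖ * (‖T‖ * ‖w₀‖) ≤ 1 / 8 * (‖T‖ * 1) := by gcongr
  have h4 : ‖v‖ * (‖T‖ * ‖w - w₀‖) ≤ 9 / 8 * (‖T‖ * (1 / 8)) := by gcongr
  rw [e, Complex.add_re, Complex.add_re]
  have := norm_nonneg T
  linarith

/-- The real number `Re ⟨v, y_j w⟩`. -/
def matForm (j : Fin m) (y : SATuple m N) (v w : EuclideanSpace ℂ (Fin N)) : ℝ :=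
  (inner ℂ v (Matrix.toEuclideanCLM (n := Fin N) (𝕜 := ℂ) (y.mat j) w)).re

theorem continuous_matForm (j : Fin m) : Continuous fun q : SATuple m N ×
    (EuclideanSpace ℂ (Fin N) × EuclideanSpace ℂ (Fin N)) => matForm j q.1 q.2.1 q.2.2 := by
  have h1 : Continuous fun q : SATuple m N ×
      (EuclideanSpace ℂ (Fin N) × EuclideanSpace ℂ (Fin N)) =>
      Matrix.toEuclideanCLM (n := Fin N) (𝕜 := ℂ) (q.1.mat j) q.2.2 :=
    ((continuous_toEuclideanCLM_mat j).comp continuous_fst).clm_apply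
      (continuous_snd.comp continuous_snd)
  exact Complex.continuous_re.comp ((continuous_fst.comp continuous_snd).inner h1)

theorem exists_inner_eq_matForm (j : Fin m) (v w : EuclideanSpace ℂ (Fin N)) :
    ∃ a : SATuple m N, ‖a‖ ≤ ‖v‖ * ‖w‖ ∧ ∀ y, inner ℝ a y = matForm j y v w := by
  have hb : ∀ y : SATuple m N, |matForm j y v w| ≤ ‖v‖ * ‖w‖ * ‖y‖ := by
    intro y
    refine (Complex.abs_re_le_norm _).trans ((norm_inner_le_norm _ _).trans ?_)
    have h1 := (norm_toEuclideanCLM_apply_le (y.mat j) w).trans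
      (mul_le_mul_of_nonneg_right (opn_le_norm y j) (norm_nonneg w))
    calc _ ≤ ‖v‖ * (‖y‖ * ‖w‖) := mul_le_mul_of_nonneg_left h1 (norm_nonneg v)
      _ = _ := by ring
  let L : SATuple m N →ₗ[ℝ] ℝ :=
    { toFun := fun y => matForm j y v w
      map_add' := fun x y => by
        simp [matForm, SATuple.mat_add]
      map_smul' := fun r x => by
        have : Matrix.toEuclideanCLM (n := Fin N) (𝕜 := ℂ) (r • x.mat j) =
            (r : ℂ) • Matrix.toEuclideanCLM (n := Fin N) (𝕜 := ℂ) (x.mat j) := by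
          rw [← map_smul]
          congr 1
        simp [matForm, SATuple.mat_smul, this] }
  let L' : SATuple m N →L[ℝ] ℝ := L.mkContinuous (‖v‖ * ‖w‖) hb
  refine ⟨(InnerProductSpace.toDual ℝ (SATuple m N)).symm L', ?_, fun y => ?_⟩
  · rw [LinearIsometryEquiv.norm_map]
    exact L.mkContinuous_norm_le (by positivity) hb
  · rw [InnerProductSpace.toDual_symm_apply]
    rfl

/-- The form is ⟨a, ·⟩ with ‖a‖ ≤ 4, so the Laplace transform at N a is at most exp(16 N²/(4κ)) with
κ = N/(2t). -/
theorem lintegral_exp_matForm_le {t : ℝ} (hN : 1 ≤ N) (ht : 0 < t) (j : Fin m)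
    {v w : EuclideanSpace ℂ (Fin N)} (hv : ‖v‖ ≤ 2) (hw : ‖w‖ ≤ 2) :
    ∫⁻ y, ENNReal.ofReal (Real.exp (N * matForm j y v w)) ∂(gue m N t) ≤
      ENNReal.ofReal (Real.exp (8 * N * t)) := by
  obtain ⟨a, ha, hay⟩ := exists_inner_eq_matForm j v w
  have h1 : ∀ y, N * matForm j y v w = inner ℝ ((N : ℝ) • a) y := by
    intro y
    rw [real_inner_smul_left, hay]
  have hN' : (0 : ℝ) < N := by exact_mod_cast hN
  simp only [h1]
  rw [gue_eq_gaussTilt, ← ofReal_integral_eq_lintegral_ofReal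
    (integrable_exp_inner_gaussTilt (gue_rate_pos hN ht) _) (ae_of_all _ fun _ => (Real.exp_pos _).le),
    integral_exp_inner_gaussTilt (gue_rate_pos hN ht)]
  refine ENNReal.ofReal_le_ofReal (Real.exp_le_exp.2 ?_)
  have h2 : ‖a‖ ≤ 4 := ha.trans (by nlinarith [norm_nonneg v, norm_nonneg w])
  rw [norm_smul, Real.norm_natCast, mul_pow]
  have h3 : ‖a‖ ^ 2 ≤ 16 := by nlinarith [norm_nonneg a]
  have e : (N : ℝ) ^ 2 * ‖a‖ ^ 2 / (4 * (N / (2 * t))) = N * t / 2 * ‖a‖ ^ 2 := by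
    field_simp
    ring
  rw [e]
  nlinarith [mul_pos hN' ht]

/-- A volume argument in place of an ε-net: the supremum defining the norm is replaced by an
integral over pairs (v, w) in a product of balls of radius 2. The pairs that witness half of the
norm have relative volume at least 16^{-4N}, and for each fixed pair the Gaussian expectation is
explicit. -/
theorem lintegral_exp_opn_le {t : ℝ} (hN : 1 ≤ N) (ht : 0 < t) (j : Fin m) :
    ∫⁻ y : SATuple m N, ENNReal.ofReal (Real.exp (N * (opn (y.mat j) / 2))) ∂(gue m N t) ≤
      ENNReal.ofReal (16 ^ (4 * N) * Real.exp (8 * N * t)) := by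
  have := isProbabilityMeasure_gue (m := m) hN ht
  set E := EuclideanSpace ℂ (Fin N)
  have hd : Module.finrank ℝ E = 2 * N := by
    have h := finrank_real_of_complex E
    rwa [finrank_euclideanSpace_fin] at h
  set c : ℝ≥0∞ := volume (Metric.ball (0 : E) 1) with hc
  have hc0 : c ≠ 0 := (Metric.measure_ball_pos _ _ one_pos).ne'
  have hct : c ≠ ⊤ := measure_ball_lt_top.ne
  have hvol : ∀ (x : E) {r : ℝ}, 0 ≤ r → volume (Metric.closedBall x r) =
      ENNReal.ofReal (r ^ (2 * N)) * c := by
    intro x r hr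
    rw [← hd]
    exact Measure.addHaar_closedBall _ _ hr
  set a : ℝ≥0∞ := ENNReal.ofReal ((1 / 8) ^ (2 * N)) * c with ha
  have ha0 : a ≠ 0 := mul_ne_zero (by simp) hc0
  have hat : a ≠ ⊤ := ENNReal.mul_ne_top ENNReal.ofReal_ne_top hct
  set S : Set (E × E) := Metric.closedBall 0 2 ×ˢ Metric.closedBall 0 2 with hS
  have hSm : MeasurableSet S := measurableSet_closedBall.prod measurableSet_closedBall
  -- E × E has real dimension 4N, and the ratio of the radii 2 and 1/8 is 16.
  have hvS : volume S = ENNReal.ofReal (16 ^ (4 * N)) * (a * a) := by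
    rw [hS, Measure.volume_eq_prod, Measure.prod_prod, hvol _ zero_le_two, ha]
    have : (2 : ℝ) ^ (2 * N) = 16 ^ (2 * N) * (1 / 8) ^ (2 * N) := by
      rw [← mul_pow]; norm_num
    rw [this, ENNReal.ofReal_mul (by positivity), show 4 * N = 2 * N + 2 * N by ring, pow_add,
      ENNReal.ofReal_mul (by positivity)]
    ring
  set f : SATuple m N → E × E → ℝ≥0∞ := fun y p =>
    ENNReal.ofReal (Real.exp (N * matForm j y p.1 p.2)) with hf
  have hfm : Measurable (Function.uncurry f) :=
    (ENNReal.continuous_ofReal.comp (Real.continuous_exp.comp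
      (continuous_const.mul (continuous_matForm j)))).measurable
  have hlow : ∀ y, ENNReal.ofReal (Real.exp (N * (opn (y.mat j) / 2))) * (a * a) ≤
      ∫⁻ p in S, f y p := by
    intro y
    obtain ⟨v₀, w₀, hv₀, hw₀, h⟩ :=
      (Matrix.toEuclideanCLM (n := Fin N) (𝕜 := ℂ) (y.mat j)).exists_near_maximizers
    set U : Set (E × E) := Metric.closedBall v₀ (1 / 8) ×ˢ Metric.closedBall w₀ (1 / 8) with hU
    have hUm : MeasurableSet U := measurableSet_closedBall.prod measurableSet_closedBall
    have hUS : U ⊆ S := Set.prod_mono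
      (Metric.closedBall_subset_closedBall' (by rw [dist_zero_right]; linarith))
      (Metric.closedBall_subset_closedBall' (by rw [dist_zero_right]; linarith))
    have hUv : volume U = a * a := by
      rw [hU, Measure.volume_eq_prod, Measure.prod_prod, hvol _ (by norm_num),
        hvol _ (by norm_num)]
    refine le_trans ?_ (lintegral_mono_set hUS)
    rw [← hUv, ← setLIntegral_const]
    refine setLIntegral_mono' hUm fun p hp => ?_
    refine ENNReal.ofReal_le_ofReal (Real.exp_le_exp.2 ?_)
    refine mul_le_mul_of_nonneg_left ?_ (Nat.cast_nonneg N)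
    exact ContinuousLinearMap.half_norm_le_re_inner _ hv₀ hw₀ h
      (by simpa [dist_eq_norm] using hp.1) (by simpa [dist_eq_norm] using hp.2)
  have hup : ∀ p ∈ S, ∫⁻ y, f y p ∂(gue m N t) ≤ ENNReal.ofReal (Real.exp (8 * N * t)) := by
    intro p hp
    exact lintegral_exp_matForm_le hN ht j (by simpa using hp.1) (by simpa using hp.2)
  have hmain : (∫⁻ y : SATuple m N, ENNReal.ofReal (Real.exp (N * (opn (y.mat j) / 2)))
      ∂(gue m N t)) * (a * a) ≤
      ENNReal.ofReal (16 ^ (4 * N) * Real.exp (8 * N * t)) * (a * a) := by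
    rw [← lintegral_mul_const' _ _ (ENNReal.mul_ne_top hat hat)]
    refine (lintegral_mono hlow).trans ?_
    rw [lintegral_lintegral_swap hfm.aemeasurable]
    refine (setLIntegral_mono' hSm hup).trans (le_of_eq ?_)
    rw [setLIntegral_const, hvS, ENNReal.ofReal_mul (by positivity)]
    ring
  exact (ENNReal.mul_le_mul_iff_left (mul_ne_zero ha0 ha0) (ENNReal.mul_ne_top hat hat)).1 hmain

theorem integrable_exp_opn_gue {t : ℝ} (hN : 1 ≤ N) (ht : 0 < t) (j : Fin m) :
    Integrable (fun y : SATuple m N => Real.exp (N * (opn (y.mat j) / 2))) (gue m N t) := by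
  have hm : Continuous fun y : SATuple m N => Real.exp (N * (opn (y.mat j) / 2)) :=
    Real.continuous_exp.comp (continuous_const.mul ((continuous_opn_mat j).div_const 2))
  refine integrable_gue_of_norm_le_exp hN ht (A := 1) (β := N / 2) hm fun y => ?_
  rw [one_mul, Real.norm_eq_abs, abs_of_pos (Real.exp_pos _)]
  refine Real.exp_le_exp.2 ?_
  have := mul_le_mul_of_nonneg_left (opn_le_norm y j) (Nat.cast_nonneg (α := ℝ) N)
  linarith

theorem integral_exp_opn_le {t : ℝ} (hN : 1 ≤ N) (ht : 0 < t) (j : Fin m) :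
    ∫ y : SATuple m N, Real.exp (N * (opn (y.mat j) / 2)) ∂(gue m N t) ≤
      16 ^ (4 * N) * Real.exp (8 * N * t) := by
  have h := lintegral_exp_opn_le hN ht j
  rw [← ofReal_integral_eq_lintegral_ofReal (integrable_exp_opn_gue hN ht j)
    (ae_of_all _ fun _ => (Real.exp_pos _).le)] at h
  exact (ENNReal.ofReal_le_ofReal_iff (by positivity)).1 h

/-- Functions that are small where `‖y‖_∞ ≤ R` and have at most exponential growth in `‖y‖_∞` have
small GUE expectations for large `N`, where `R` depends only on the variance. -/
theorem exists_radius_norm_integral_gue_le (m : ℕ) {t : ℝ} (ht : 0 < t) :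
    ∃ R > (0 : ℝ), ∀ A > (0 : ℝ), ∀ ε > (0 : ℝ), ∀ᶠ N in atTop, ∀ (F : SATuple m N → ℂ) (δ : ℝ),
      0 ≤ δ → (∀ y, normInf y.mat ≤ R → ‖F y‖ ≤ δ) → (∀ y, ‖F y‖ ≤ A * Real.exp (normInf y.mat)) →
      ‖∫ y, F y ∂(gue m N t)‖ ≤ δ + ε := by
  have hlog : (0 : ℝ) < Real.log 16 := Real.log_pos (by norm_num)
  have hlog2 : (0 : ℝ) < Real.log 2 := Real.log_pos (by norm_num)
  -- Chosen so that e^{-NR/2} beats 16^{4N} e^{8Nt} and leaves exactly 2^{-N}.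
  set R : ℝ := 2 * (4 * Real.log 16 + 8 * t + Real.log 2) with hR
  have hRpos : 0 < R := by positivity
  refine ⟨R, hRpos, fun A hA ε hε => ?_⟩
  have hlim : Tendsto (fun N : ℕ => (m * (A * Real.exp R)) * (1 / 2 : ℝ) ^ N) atTop (𝓝 0) := by
    simpa using (tendsto_pow_atTop_nhds_zero_of_lt_one (by norm_num : (0 : ℝ) ≤ 1 / 2)
      (by norm_num)).const_mul (m * (A * Real.exp R))
  filter_upwards [hlim.eventually_le_const hε, eventually_ge_atTop 2] with N hNε hN2 F δ hδ h1 h2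
  have hN : 1 ≤ N := by omega
  have := isProbabilityMeasure_gue (m := m) hN ht
  set q : ℝ := A * Real.exp (R - N * (R / 2)) with hq
  have hq0 : 0 < q := by positivity
  have hpt : ∀ y : SATuple m N,
      ‖F y‖ ≤ δ + ∑ j, q * Real.exp (N * (opn (y.mat j) / 2)) := by
    intro y
    have hs : ∀ j ∈ Finset.univ, 0 ≤ q * Real.exp (N * (opn (y.mat j) / 2)) :=
      fun j _ => by positivity
    by_cases hy : normInf y.mat ≤ R
    · exact (h1 y hy).trans (le_add_of_nonneg_right (Finset.sum_nonneg hs))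
    · obtain ⟨j, hj⟩ : ∃ j, normInf y.mat = opn (y.mat j) := by
        rcases isEmpty_or_nonempty (Fin m) with he | he
        · exact absurd (normInf_le hRpos.le fun j => he.elim j) hy
        · obtain ⟨j, hj⟩ := exists_eq_ciSup_of_finite
            (f := fun j => ‖Matrix.toEuclideanCLM (n := Fin N) (𝕜 := ℂ) (y.mat j)‖)
          exact ⟨j, hj.symm⟩
      refine ((h2 y).trans ?_).trans (le_add_of_nonneg_left hδ)
      refine le_trans ?_ (Finset.single_le_sum hs (Finset.mem_univ j))
      rw [hq, mul_assoc, ← Real.exp_add, ← hj]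
      refine mul_le_mul_of_nonneg_left (Real.exp_le_exp.2 ?_) hA.le
      -- For s > R and N ≥ 2 one has s ≤ R + (N/2)(s - R), so e^s is dominated by e^{Ns/2} times the
      -- small factor in q.
      have hN2' : (2 : ℝ) ≤ N := by exact_mod_cast hN2
      nlinarith [not_le.1 hy]
  have hint : Integrable (fun y : SATuple m N => δ + ∑ j, q * Real.exp (N * (opn (y.mat j) / 2)))
      (gue m N t) := (integrable_const _).add (integrable_finsetSum _ fun j _ =>
        (integrable_exp_opn_gue hN ht j).const_mul q)
  refine (norm_integral_le_of_norm_le hint (ae_of_all _ hpt)).trans ?_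
  rw [integral_add (integrable_const _) (integrable_finsetSum _ fun j _ =>
    (integrable_exp_opn_gue hN ht j).const_mul q), integral_finsetSum _ fun j _ =>
    (integrable_exp_opn_gue hN ht j).const_mul q]
  have h3 : ∀ j : Fin m, ∫ y : SATuple m N, q * Real.exp (N * (opn (y.mat j) / 2)) ∂(gue m N t) ≤
      A * Real.exp R * (1 / 2) ^ N := by
    intro j
    rw [integral_const_mul]
    refine (mul_le_mul_of_nonneg_left (integral_exp_opn_le hN ht j) hq0.le).trans (le_of_eq ?_)
    have e1 : (16 : ℝ) ^ (4 * N) = Real.exp (N * (4 * Real.log 16)) := by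
      rw [← Real.exp_log (show (0 : ℝ) < 16 by norm_num), ← Real.exp_nat_mul, Real.log_exp]
      push_cast
      ring_nf
    have e2 : (1 / 2 : ℝ) ^ N = Real.exp (-(N * Real.log 2)) := by
      rw [Real.exp_neg, Real.exp_nat_mul, Real.exp_log two_pos, one_div, inv_pow]
    rw [e1, e2, hq, mul_assoc A, mul_assoc A, ← Real.exp_add, ← Real.exp_add, ← Real.exp_add, hR]
    congr 2
    ring
  refine add_le_add (by simp) (le_trans (Finset.sum_le_sum fun j _ => h3 j) ?_)
  rw [Finset.sum_const, Finset.card_univ, Fintype.card_fin, nsmul_eq_mul]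
  linarith

end NormTail

/-! ### Approximability under the heat, splitting and Langevin semigroups -/

section Approximability

variable {m : ℕ}

theorem one_add_pow_le_factorial_mul_exp {s : ℝ} (hs : 0 ≤ s) (d : ℕ) :
    (1 + s) ^ d ≤ d.factorial * Real.exp 1 * Real.exp s := by
  have h := Real.pow_div_factorial_le_exp (1 + s) (by positivity) d
  rw [div_le_iff₀ (by positivity), Real.exp_add] at h
  linarith

theorem TrP0.exists_norm_eval0_add_le (f : TrP0 m) {R : ℝ} : ∃ A : ℝ, 0 ≤ A ∧
    ∀ N (x y : SATuple m N), normInf x.mat ≤ R →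
      ‖eval0 (x + y) f‖ ≤ A * Real.exp (normInf y.mat) := by
  obtain ⟨A, hA, d, h⟩ := f.exists_norm_eval0_le
  refine ⟨A * ((1 + |R|) ^ d * (d.factorial * Real.exp 1)), by positivity, fun N x y hx => ?_⟩
  have hy := normInf_nonneg y.mat
  have hx0 := normInf_nonneg x.mat
  have h1 : 1 + normInf (x + y).mat ≤ (1 + |R|) * (1 + normInf y.mat) := by
    have h2 : normInf (x + y).mat ≤ _ := normInf_add_le x.mat y.mat
    have h3 := hx.trans (le_abs_self R)
    nlinarith [mul_nonneg (abs_nonneg R) hy]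
  have h0 := normInf_nonneg (x + y).mat
  have h4 := pow_le_pow_left₀ (add_nonneg zero_le_one h0) h1 d
  rw [mul_pow] at h4
  have h5 := mul_le_mul_of_nonneg_left (one_add_pow_le_factorial_mul_exp hy d)
    (by positivity : 0 ≤ (1 + |R|) ^ d)
  refine (h N _).trans ((mul_le_mul_of_nonneg_left (h4.trans h5) hA).trans (le_of_eq ?_))
  ring

/-- The heat semigroup preserves asymptotic approximability. -/
theorem asympApproxScalar_heatSemigroup {u : ∀ N, SATuple m N → ℂ} {K t : ℝ}
    (hu : AsympApproxScalar u) (hK : 0 ≤ K) (hLip : ∀ N ≥ 1, Lip2 K (u N)) (ht : 0 < t) :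
    AsympApproxScalar fun N => heatSemigroup t (u N) := by
  rw [asympApproxScalar_iff]
  intro R hR ε hε
  obtain ⟨R', hR', htail⟩ := exists_radius_norm_integral_gue_le m ht
  -- Off the tail event ‖y‖_∞ > R', the point x + y stays in the ball of radius R + R'.
  obtain ⟨f, hf⟩ := asympApproxScalar_iff.1 hu (R + R') (by positivity) (ε / 3) (by positivity)
  obtain ⟨g, hg⟩ := tendstoTrP0_heatSemigroup ht f
  obtain ⟨A, hA, hfA⟩ := f.exists_norm_eval0_add_le (R := R)
  obtain ⟨B, hB, huB⟩ := hu.exists_bound hR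
  -- Controls u(x + y) - f(x + y) by a multiple of exp ‖y‖_∞ for every y: u grows linearly from the
  -- bounded value u(x), and f grows polynomially.
  set A' : ℝ := B + K * Real.sqrt m + A + 1 with hA'
  have hA'0 : 0 < A' := by positivity
  refine ⟨g, ?_⟩
  filter_upwards [hf, hg R hR (ε / 3) (by positivity), huB, htail A' hA'0 (ε / 3) (by positivity),
    eventually_ge_atTop 1] with N h1 h2 h3 h4 hN x hx
  have e : heatSemigroup t (u N) x - heatSemigroup t (fun x => eval0 x f) x =
      ∫ y, (u N (x + y) - eval0 (x + y) f) ∂(gue m N t) :=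
    (integral_sub ((hLip N hN).integrable_gue hN hK ht x)
      ((expGrowth_eval0_add x f).integrable_gue hN ht)).symm
  have h5 := h4 (fun y => u N (x + y) - eval0 (x + y) f) (ε / 3) (by positivity)
    (fun y hy => h1 _ ((normInf_add_le x.mat y.mat).trans (add_le_add hx hy))) (fun y => by
      have hy := normInf_nonneg y.mat
      have h6 := hLip N hN (x + y) x
      rw [add_sub_cancel_left] at h6
      have h7 := norm2_le_normInf y.mat
      have h8 := h3 x hx
      have h9 : ‖u N (x + y)‖ ≤ K * (Real.sqrt m * normInf y.mat) + B := by
        have := norm_add_le (u N (x + y) - u N x) (u N x)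
        rw [sub_add_cancel] at this
        linarith [mul_le_mul_of_nonneg_left h7 hK]
      have h10 := hfA N x y hx
      have h11 := norm_sub_le (u N (x + y)) (eval0 (x + y) f)
      have h12 := Real.add_one_le_exp (normInf y.mat)
      have h13 : K * Real.sqrt m * normInf y.mat ≤ K * Real.sqrt m * Real.exp (normInf y.mat) :=
        mul_le_mul_of_nonneg_left (by linarith) (by positivity)
      have h14 : B * 1 ≤ B * Real.exp (normInf y.mat) :=
        mul_le_mul_of_nonneg_left (by linarith) hB
      rw [hA']
      nlinarith [Real.exp_pos (normInf y.mat)])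
  rw [← e] at h5
  have h6 := h2 x hx
  calc ‖heatSemigroup t (u N) x - eval0 x g‖
      = ‖(heatSemigroup t (u N) x - heatSemigroup t (fun x => eval0 x f) x) +
        (heatSemigroup t (fun x => eval0 x f) x - eval0 x g)‖ := by rw [sub_add_sub_cancel]
    _ ≤ (ε / 3 + ε / 3) + ε / 3 := (norm_add_le _ _).trans (add_le_add h5 h6)
    _ = ε := by ring

variable {V : ∀ N, SATuple m N → ℝ} {u : ∀ N, SATuple m N → ℂ} {c C K : ℝ}

theorem asympApproxScalar_trotterStep_iterate (hV : ∀ N ≥ 1, UnifConvex c C (V N))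
    (hDV : AsympApproxOp fun N x => (normGrad (V N) x).mat) (hu : AsympApproxScalar u)
    (hK : 0 ≤ K) (hLip : ∀ N ≥ 1, Lip2 K (u N)) {h : ℝ} (hh : 0 < h) (n : ℕ) :
    AsympApproxScalar fun N => (trotterStep (V N) h)^[n] (u N) := by
  induction n with
  | zero => exact hu
  | succ n ih =>
    have hL : ∀ N ≥ 1, Lip2 K ((trotterStep (V N) h)^[n] (u N)) := fun N hN =>
      (hLip N hN).trotterStep_iterate hK (hV N hN) hh n
    have h1 := asympApproxScalar_detSemigroup hV hDV ih hK hL hh.le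
    have h2 := asympApproxScalar_heatSemigroup h1 hK
      (fun N hN => (hL N hN).det hK (hV N hN) hh.le) hh
    simp only [Function.iterate_succ_apply']
    exact h2

/-- The level l can be fixed before N, because the splitting error depends neither on N nor on x. -/
theorem asympApproxScalar_langevinDyadic (hV : ∀ N ≥ 1, UnifConvex c C (V N))
    (hDV : AsympApproxOp fun N x => (normGrad (V N) x).mat) (hu : AsympApproxScalar u)
    (hK : 0 ≤ K) (hLip : ∀ N ≥ 1, Lip2 K (u N)) {t : ℝ} (ht : t ∈ dyadics) :
    AsympApproxScalar fun N => langevinDyadic (V N) t (u N) := by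
  obtain ⟨k, l₀, rfl⟩ := ht
  refine AsympApproxScalar.of_uniform_limit fun R _ ε hε => ?_
  have hlim : Tendsto (fun l : ℕ => trotterRate m C K ((k : ℝ) / 2 ^ l₀) /
      (1 - Real.sqrt (1 / 2)) * Real.sqrt (1 / 2) ^ l) atTop (𝓝 0) := by
    simpa using (tendsto_pow_atTop_nhds_zero_of_lt_one (Real.sqrt_nonneg _)
      sqrt_half_lt_one).const_mul (trotterRate m C K ((k : ℝ) / 2 ^ l₀) / (1 - Real.sqrt (1 / 2)))
  obtain ⟨l, hl, hl₀⟩ := ((hlim.eventually_le_const hε).and (eventually_ge_atTop l₀)).exists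
  refine ⟨fun N => langevinApprox (V N) l ((k : ℝ) / 2 ^ l₀) (u N),
    asympApproxScalar_trotterStep_iterate hV hDV hu hK hLip (by positivity) _, ?_⟩
  filter_upwards [eventually_ge_atTop 1] with N hN x _
  rw [norm_sub_rev]
  exact (norm_langevinApprox_sub_langevinDyadic_le (hLip N hN) hK (hV N hN) hl₀ x).trans hl

/-- The Langevin semigroup preserves asymptotic approximability. -/
theorem asympApproxScalar_langevin (hV : ∀ N ≥ 1, UnifConvex c C (V N))
    (hDV : AsympApproxOp fun N x => (normGrad (V N) x).mat) (hu : AsympApproxScalar u)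
    (hK : 0 ≤ K) (hLip : ∀ N ≥ 1, Lip2 K (u N)) {t : ℝ} (ht : 0 ≤ t) :
    AsympApproxScalar fun N => langevin (V N) t (u N) := by
  refine AsympApproxScalar.of_uniform_limit fun R hR ε hε => ?_
  obtain ⟨B, hB, hbd⟩ := hDV.exists_bound hR
  obtain ⟨δ, hδ, hm⟩ := Metric.eventually_nhds_iff.1
    ((tendsto_timeModulus m K B).eventually_le_const hε)
  have hne := nhdsWithin_dyadics_neBot ht
  -- One dyadic s serves all large N and all x in the ball, since the time modulus involves x only
  -- through ‖DV(x)‖₂ ≤ B.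
  obtain ⟨s, hs, hst⟩ := ((eventually_mem_nhdsWithin (a := t) (s := dyadics)).and
    (mem_nhdsWithin_of_mem_nhds (Metric.ball_mem_nhds t (by positivity : 0 < δ / 4)))).exists
  refine ⟨fun N => langevinDyadic (V N) s (u N),
    asympApproxScalar_langevinDyadic hV hDV hu hK hLip hs, ?_⟩
  filter_upwards [hbd, eventually_ge_atTop 1] with N hN1 hN x hx
  refine (norm_langevin_sub_langevinDyadic_le (hLip N hN) hK (hV N hN) ht hs
    (δ := δ / 4) (by simpa [Real.dist_eq] using hst) x).trans ?_
  refine (timeModulus_mono hK (norm2_nonneg _) (hN1 x hx) (by positivity) le_rfl).trans ?_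
  refine hm ?_
  rw [Real.dist_eq, sub_zero, abs_of_pos (by positivity)]
  linarith

end Approximability

/-! ### Approximate invariance under a proximal step -/

section ProximalStep

variable {E : Type*} [NormedAddCommGroup E] [InnerProductSpace ℝ E] [FiniteDimensional ℝ E]
  [MeasurableSpace E] [BorelSpace E]

theorem continuous_of_norm_sub_le {F G : Type*} [NormedAddCommGroup F] [NormedAddCommGroup G]
    {f : F → G} {L : ℝ} (h : ∀ x y, ‖f x - f y‖ ≤ L * ‖x - y‖) : Continuous f := by
  refine (LipschitzWith.of_dist_le_mul (K := L.toNNReal) fun x y => ?_).continuous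
  rw [dist_eq_norm, dist_eq_norm]
  exact (h x y).trans (mul_le_mul_of_nonneg_right (Real.le_coe_toNNReal L) (norm_nonneg _))

/-- A centred function of linear growth has small integral against a weight close to `1`. -/
theorem norm_integral_weight_smul_sub_le {γ : Measure E} [IsProbabilityMeasure γ]
    (h1 : Integrable (fun z => ‖z‖) γ) (h2 : Integrable (fun z => ‖z‖ ^ 2) γ)
    (h3 : Integrable (fun z => ‖z‖ ^ 3) γ) {F : E → ℂ} (hF : Continuous F) {L b : ℝ}
    (hL : 0 ≤ L) (hb : 0 ≤ b) (hFL : ∀ z, ‖F z‖ ≤ L * ‖z‖) {s : E → ℝ} (hs : Continuous s)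
    (hs0 : ∀ z, 0 ≤ s z) (hs1 : ∀ z, s z ≤ 1) (hsb : ∀ z, 1 - b * ‖z‖ ^ 2 ≤ s z)
    (hsmall : b * ∫ z, ‖z‖ ^ 2 ∂γ ≤ 1 / 2) :
    ‖∫ z, s z • (F z - ∫ z, F z ∂γ) ∂γ‖ ≤
      2 * (L * b * (∫ z, ‖z‖ ^ 3 ∂γ + (∫ z, ‖z‖ ∂γ) * ∫ z, ‖z‖ ^ 2 ∂γ)) * ∫ z, s z ∂γ := by
  set a := ∫ z, F z ∂γ with ha
  set M₁ := ∫ z, ‖z‖ ∂γ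
  set M₂ := ∫ z, ‖z‖ ^ 2 ∂γ
  set M₃ := ∫ z, ‖z‖ ^ 3 ∂γ
  have hM₁ : 0 ≤ M₁ := integral_nonneg fun _ => norm_nonneg _
  have hM₂ : 0 ≤ M₂ := integral_nonneg fun _ => by positivity
  have hM₃ : 0 ≤ M₃ := integral_nonneg fun _ => by positivity
  have hsi : Integrable s γ := (integrable_const (1 : ℝ)).mono' hs.aestronglyMeasurable
    (ae_of_all _ fun z => by rw [Real.norm_eq_abs, abs_of_nonneg (hs0 z)]; exact hs1 z)
  have hFi : Integrable F γ := (h1.const_mul L).mono' hF.aestronglyMeasurable (ae_of_all _ hFL)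
  have haL : ‖a‖ ≤ L * M₁ := by
    refine (norm_integral_le_of_norm_le (h1.const_mul L) (ae_of_all _ hFL)).trans (le_of_eq ?_)
    rw [integral_const_mul]
  have hbd : ∀ z, ‖(s z - 1) • (F z - a)‖ ≤ b * L * ‖z‖ ^ 3 + b * (L * M₁) * ‖z‖ ^ 2 := by
    intro z
    rw [norm_smul, Real.norm_eq_abs, abs_sub_comm, abs_of_nonneg (sub_nonneg.2 (hs1 z))]
    have h4 : 1 - s z ≤ b * ‖z‖ ^ 2 := by linarith [hsb z]
    have h5 : ‖F z - a‖ ≤ L * ‖z‖ + L * M₁ := (norm_sub_le _ _).trans (add_le_add (hFL z) haL)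
    calc (1 - s z) * ‖F z - a‖ ≤ (b * ‖z‖ ^ 2) * (L * ‖z‖ + L * M₁) :=
          mul_le_mul h4 h5 (norm_nonneg _) (by positivity)
      _ = _ := by ring
  have hbi : Integrable (fun z => b * L * ‖z‖ ^ 3 + b * (L * M₁) * ‖z‖ ^ 2) γ :=
    (h3.const_mul _).add (h2.const_mul _)
  have hci : Integrable (fun z => (s z - 1) • (F z - a)) γ :=
    hbi.mono' (((hs.sub continuous_const).smul (hF.sub continuous_const)).aestronglyMeasurable)
      (ae_of_all _ hbd)
  have e : ∫ z, s z • (F z - a) ∂γ = ∫ z, (s z - 1) • (F z - a) ∂γ := by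
    have h4 : ∀ z, s z • (F z - a) = (s z - 1) • (F z - a) + (F z - a) := by
      intro z
      rw [sub_smul, one_smul, sub_add_cancel]
    simp only [h4]
    have h5 : ∫ z, (F z - a) ∂γ = 0 := by
      rw [integral_sub hFi (integrable_const a)]
      simp [ha]
    have h6 : Integrable (fun z => F z - a) γ := hFi.sub (integrable_const a)
    rw [integral_add hci h6, h5, add_zero]
  have hlow : 1 / 2 ≤ ∫ z, s z ∂γ := by
    have h4 : ∫ z, (1 - b * ‖z‖ ^ 2) ∂γ ≤ ∫ z, s z ∂γ :=
      integral_mono ((integrable_const 1).sub (h2.const_mul b)) hsi hsb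
    rw [integral_sub (integrable_const 1) (h2.const_mul b), integral_const_mul] at h4
    simp only [integral_const, probReal_univ, smul_eq_mul, mul_one] at h4
    linarith
  rw [e]
  refine (norm_integral_le_of_norm_le hbi (ae_of_all _ hbd)).trans ?_
  rw [integral_add (h3.const_mul _) (h2.const_mul _), integral_const_mul, integral_const_mul]
  have h5 : 0 ≤ L * b * (M₃ + M₁ * M₂) := by positivity
  nlinarith

/-- Fubini for the joint law of `(X, X + G)`: a bound on the conditional expectations given `X + G`
yields a bound on the expectation. -/
theorem norm_integral_integral_shift_le {q k : E → ℝ} (hq : Integrable q) (hk : Integrable k)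
    {Ψ : E → E → ℂ}
    (hΨ : Integrable (fun p : E × E => (q p.1 * k p.2) • Ψ p.1 (p.1 + p.2))
      ((volume : Measure E).prod volume)) {ε : ℝ}
    (h : ∀ y, ‖∫ x, (q x * k (y - x)) • Ψ x y‖ ≤ ε * ∫ x, q x * k (y - x)) :
    ‖∫ x, ∫ g, (q x * k g) • Ψ x (x + g)‖ ≤ ε * ((∫ x, q x) * ∫ g, k g) := by
  have hmp := measurePreserving_prod_neg_add (volume : Measure E) (volume : Measure E)
  have hΨ' : Integrable (fun p : E × E => (q p.1 * k (p.2 - p.1)) • Ψ p.1 p.2)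
      ((volume : Measure E).prod volume) := by
    have := hmp.integrable_comp_of_integrable hΨ
    refine this.congr (ae_of_all _ fun p => ?_)
    simp only [Function.comp_apply, neg_add_eq_sub, add_sub_cancel]
  have hqk : Integrable (fun p : E × E => q p.1 * k p.2) ((volume : Measure E).prod volume) :=
    hq.mul_prod hk
  have hqk' : Integrable (fun p : E × E => q p.1 * k (p.2 - p.1))
      ((volume : Measure E).prod volume) := by
    have := hmp.integrable_comp_of_integrable hqk
    refine this.congr (ae_of_all _ fun p => ?_)
    simp only [Function.comp_apply, neg_add_eq_sub]
  have e1 : ∫ x, ∫ g, (q x * k g) • Ψ x (x + g) =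
      ∫ y, ∫ x, (q x * k (y - x)) • Ψ x y := by
    refine Eq.trans (integral_congr_ae (ae_of_all _ fun x => ?_))
      (integral_integral_swap (f := fun x y => (q x * k (y - x)) • Ψ x y) hΨ')
    simp only
    rw [← integral_add_left_eq_self (fun y => (q x * k (y - x)) • Ψ x y) x]
    simp only [add_sub_cancel_left]
  have e2 : ∫ y, ∫ x, q x * k (y - x) = (∫ x, q x) * ∫ g, k g := by
    rw [← integral_mul_const]
    refine Eq.trans (integral_integral_swap (f := fun x y => q x * k (y - x)) hqk').symm
      (integral_congr_ae (ae_of_all _ fun x => ?_))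
    simp only
    rw [integral_const_mul, ← integral_add_left_eq_self (fun y => k (y - x)) x]
    simp only [add_sub_cancel_left]
  rw [e1, ← e2, ← integral_const_mul]
  exact norm_integral_le_of_norm_le (hqk'.integral_prod_right.const_mul ε) (ae_of_all _ h)

theorem integrable_of_norm_sub_le {ν : Measure E} [IsProbabilityMeasure ν]
    (h1 : Integrable (fun z => ‖z‖) ν) {f : E → ℂ} {L : ℝ}
    (hf : ∀ x y, ‖f x - f y‖ ≤ L * ‖x - y‖) : Integrable f ν := by
  refine ((integrable_const ‖f 0‖).add (h1.const_mul L)).mono'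
    (continuous_of_norm_sub_le hf).aestronglyMeasurable (ae_of_all _ fun z => ?_)
  have h2 := norm_add_le (f z - f 0) (f 0)
  have h3 := hf z 0
  rw [sub_add_cancel] at h2
  rw [sub_zero] at h3
  simp only [Pi.add_apply]
  linarith

theorem norm_integral_add_sub_le {γ : Measure E} [IsProbabilityMeasure γ]
    (h1 : Integrable (fun z => ‖z‖) γ) {f : E → ℂ} {L : ℝ}
    (hf : ∀ x y, ‖f x - f y‖ ≤ L * ‖x - y‖) (x y : E) :
    ‖∫ z, f (x + z) ∂γ - ∫ z, f (y + z) ∂γ‖ ≤ L * ‖x - y‖ := by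
  have hi : ∀ x, Integrable (fun z => f (x + z)) γ := fun x =>
    integrable_of_norm_sub_le h1 fun z z' => by simpa using hf (x + z) (x + z')
  rw [← integral_sub (hi x) (hi y)]
  refine (norm_integral_le_of_norm_le_const (C := L * ‖x - y‖) (ae_of_all _ fun z => ?_)).trans
    (by simp)
  simpa using hf (x + z) (y + z)

theorem integral_tilted_density {f : E → ℝ} (hf : Integrable fun x => Real.exp (f x)) :
    ∫ x, Real.exp (f x) / ∫ x, Real.exp (f x) = 1 := by
  have := isProbabilityMeasure_tilted hf
  have h := integral_tilted (μ := (volume : Measure E)) f (fun _ => (1 : ℝ))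
  simpa using h.symm

theorem integrable_tilted_density_smul {f : E → ℝ} (hf : Integrable fun x => Real.exp (f x))
    {g : E → ℝ} (hg : Integrable g ((volume : Measure E).tilted f)) :
    Integrable fun x => (Real.exp (f x) / ∫ x, Real.exp (f x)) * g x := by
  have h := ((integrable_tilted_iff hf g).1 hg).const_mul (∫ x, Real.exp (f x))⁻¹
  refine h.congr (ae_of_all _ fun x => ?_)
  simp only [smul_eq_mul, div_eq_inv_mul, mul_assoc]

/-- The Gibbs measure of `U` is almost invariant under the composition of a Gaussian step, a
proximal step, and another Gaussian step. -/
theorem norm_integral_proximal_step_sub_le {U : E → ℝ} (hUc : Continuous U) {κ b L : ℝ}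
    (hκ : 0 < κ) (hb : 0 ≤ b) (hL : 0 ≤ L) (hU : Integrable fun x => Real.exp (-U x))
    (hU1 : Integrable (fun x => ‖x‖) ((volume : Measure E).tilted fun x => -U x))
    {p : E → E} (hp : ∀ x y, ‖p x - p y‖ ≤ ‖x - y‖)
    (hr0 : ∀ y z, 2 * κ * inner ℝ (y - p y) z ≤ U (p y + z) - U (p y))
    (hr1 : ∀ y z, U (p y + z) - U (p y) ≤ 2 * κ * inner ℝ (y - p y) z + b * ‖z‖ ^ 2)
    {v : E → ℂ} (hv : ∀ x y, ‖v x - v y‖ ≤ L * ‖x - y‖)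
    (hsmall : b * ∫ z, ‖z‖ ^ 2 ∂(gaussTilt E κ) ≤ 1 / 2) :
    ‖∫ x, ∫ g, (∫ z, v (p (x + g) + z) ∂(gaussTilt E κ)) ∂(gaussTilt E κ)
        ∂((volume : Measure E).tilted fun x => -U x) -
      ∫ x, v x ∂((volume : Measure E).tilted fun x => -U x)‖ ≤
      2 * (L * b * (∫ z, ‖z‖ ^ 3 ∂(gaussTilt E κ) +
        (∫ z, ‖z‖ ∂(gaussTilt E κ)) * ∫ z, ‖z‖ ^ 2 ∂(gaussTilt E κ))) := by
  set γ := gaussTilt E κ with hγ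
  set μ := (volume : Measure E).tilted fun x => -U x with hμ
  have hγp : IsProbabilityMeasure γ := isProbabilityMeasure_gaussTilt hκ
  have hμp : IsProbabilityMeasure μ := isProbabilityMeasure_tilted hU
  have hpow : ∀ k : ℕ, Integrable (fun z : E => ‖z‖ ^ k) γ := by
    intro k
    refine integrable_gaussTilt_of_norm_le_exp hκ (A := 1) (β := k) (by fun_prop) fun y => ?_
    rw [one_mul, Real.exp_nat_mul, norm_pow, norm_norm]
    exact pow_le_pow_left₀ (norm_nonneg _) (norm_le_exp_norm y) k
  have h1 : Integrable (fun z : E => ‖z‖) γ := by simpa using hpow 1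
  set w : E → ℂ := fun x => ∫ z, v (x + z) ∂γ with hw
  have hwL : ∀ x y, ‖w x - w y‖ ≤ L * ‖x - y‖ := norm_integral_add_sub_le h1 hv
  have hwpL : ∀ x y, ‖w (p x) - w (p y)‖ ≤ L * ‖x - y‖ := fun x y =>
    (hwL _ _).trans (mul_le_mul_of_nonneg_left (hp x y) hL)
  have hPi : Integrable (fun x => ∫ g, w (p (x + g)) ∂γ) μ :=
    integrable_of_norm_sub_le hU1 (norm_integral_add_sub_le h1 hwpL)
  set q : E → ℝ := fun x => Real.exp (-U x) / ∫ x, Real.exp (-U x) with hq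
  set k : E → ℝ := fun g => Real.exp (-(κ * ‖g‖ ^ 2)) / ∫ g : E, Real.exp (-(κ * ‖g‖ ^ 2)) with hk
  have hZU : 0 < ∫ x, Real.exp (-U x) := integral_exp_pos hU
  have hZk : 0 < ∫ g : E, Real.exp (-(κ * ‖g‖ ^ 2)) :=
    integral_exp_pos (integrable_exp_neg_mul_norm_sq hκ)
  have hq0 : ∀ x, 0 ≤ q x := fun x => (div_pos (Real.exp_pos _) hZU).le
  have hk0 : ∀ x, 0 ≤ k x := fun x => (div_pos (Real.exp_pos _) hZk).le
  have hqc : Continuous q := (Real.continuous_exp.comp hUc.neg).div_const _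
  have hkc : Continuous k := by fun_prop
  have hpc : Continuous p := continuous_of_norm_sub_le (L := 1) (by simpa using hp)
  have hwc := continuous_of_norm_sub_le hwL
  have hvc := continuous_of_norm_sub_le hv
  set Ψ : E → E → ℂ := fun x y => w (p y) - v x with hΨ
  have e : ∫ x, ∫ g, w (p (x + g)) ∂γ ∂μ - ∫ x, v x ∂μ =
      ∫ x, ∫ g, (q x * k g) • Ψ x (x + g) := by
    rw [← integral_sub hPi (integrable_of_norm_sub_le hU1 hv), hμ, integral_tilted]
    refine integral_congr_ae (ae_of_all _ fun x => ?_)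
    have h2 : ∫ g, w (p (x + g)) ∂γ - v x = ∫ g, Ψ x (x + g) ∂γ := by
      have h3 : Integrable (fun g => w (p (x + g))) γ :=
        integrable_of_norm_sub_le (L := L) h1 fun g g' => by simpa using hwpL (x + g) (x + g')
      rw [hΨ, integral_sub h3 (integrable_const _)]
      simp
    simp only [h2]
    rw [hγ, gaussTilt, integral_tilted, ← integral_smul]
    simp only [smul_smul]
    rfl
  have hΨi : Integrable (fun r : E × E => (q r.1 * k r.2) • Ψ r.1 (r.1 + r.2))
      ((volume : Measure E).prod volume) := by
    have i1 : Integrable fun x => q x * (1 + ‖x‖) :=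
      integrable_tilted_density_smul hU ((integrable_const 1).add hU1)
    have i2 : Integrable fun x => k x * (1 + ‖x‖) :=
      integrable_tilted_density_smul (integrable_exp_neg_mul_norm_sq hκ)
        ((integrable_const 1).add h1)
    refine ((i1.mul_prod i2).const_mul (‖w (p 0) - v 0‖ + 2 * L)).mono'
      (Continuous.aestronglyMeasurable ?_) (ae_of_all _ fun r => ?_)
    · exact ((hqc.comp continuous_fst).mul (hkc.comp continuous_snd)).smul
        ((hwc.comp (hpc.comp (continuous_fst.add continuous_snd))).sub (hvc.comp continuous_fst))
    · rw [norm_smul, Real.norm_eq_abs, abs_of_nonneg (mul_nonneg (hq0 _) (hk0 _))]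
      have h2 : ‖Ψ r.1 (r.1 + r.2)‖ ≤ (‖w (p 0) - v 0‖ + 2 * L) * ((1 + ‖r.1‖) * (1 + ‖r.2‖)) := by
        have e1 : Ψ r.1 (r.1 + r.2) = (w (p (r.1 + r.2)) - w (p 0)) + (w (p 0) - v 0) -
            (v r.1 - v 0) := by simp only [hΨ]; ring
        have h3 := hwpL (r.1 + r.2) 0
        have h4 := hv r.1 0
        rw [sub_zero] at h3 h4
        have h5 := mul_le_mul_of_nonneg_left (norm_add_le r.1 r.2) hL
        have h6 := norm_sub_le ((w (p (r.1 + r.2)) - w (p 0)) + (w (p 0) - v 0)) (v r.1 - v 0)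
        have h7 := norm_add_le (w (p (r.1 + r.2)) - w (p 0)) (w (p 0) - v 0)
        have n1 := norm_nonneg r.1
        have n2 := norm_nonneg r.2
        have n3 := norm_nonneg (w (p 0) - v 0)
        rw [e1]
        nlinarith [mul_nonneg n3 n1, mul_nonneg n3 n2, mul_nonneg n3 (mul_nonneg n1 n2),
          mul_nonneg hL n1, mul_nonneg hL n2, mul_nonneg hL (mul_nonneg n1 n2)]
      calc q r.1 * k r.2 * ‖Ψ r.1 (r.1 + r.2)‖ ≤ q r.1 * k r.2 *
            ((‖w (p 0) - v 0‖ + 2 * L) * ((1 + ‖r.1‖) * (1 + ‖r.2‖))) :=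
            mul_le_mul_of_nonneg_left h2 (mul_nonneg (hq0 _) (hk0 _))
        _ = _ := by ring
  have hq1 : ∫ x, q x = 1 := integral_tilted_density hU
  have hk1 : ∫ x, k x = 1 := integral_tilted_density (integrable_exp_neg_mul_norm_sq hκ)
  have hqi : Integrable q := hU.div_const _
  have hki : Integrable k := (integrable_exp_neg_mul_norm_sq hκ).div_const _
  rw [e]
  refine (norm_integral_integral_shift_le hqi hki hΨi
    (ε := 2 * (L * b * (∫ z, ‖z‖ ^ 3 ∂γ + (∫ z, ‖z‖ ∂γ) * ∫ z, ‖z‖ ^ 2 ∂γ))) fun y => ?_).trans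
    (le_of_eq (by rw [hq1, hk1, one_mul, mul_one]))
  set a : ℝ := q (p y) * Real.exp (-(κ * ‖y - p y‖ ^ 2)) with ha
  have ha0 : 0 ≤ a := mul_nonneg (hq0 _) (Real.exp_pos _).le
  set s : E → ℝ := fun z =>
    Real.exp (-(U (p y + z) - U (p y) - 2 * κ * inner ℝ (y - p y) z)) with hs
  -- Completing the square at p y: by the choice of p the linear terms of U and of the Gaussian
  -- compensate. In z = x - p y the conditional density given y is therefore the same Gaussian times
  -- s, and the two bounds on U place s between 1 - b‖z‖² and 1.
  have hqk : ∀ z, q (p y + z) * k (y - (p y + z)) = a * (k z * s z) := by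
    intro z
    have e1 : ‖y - (p y + z)‖ ^ 2 = ‖y - p y‖ ^ 2 - 2 * inner ℝ (y - p y) z + ‖z‖ ^ 2 := by
      rw [← sub_sub, norm_sub_sq_real]
    have e2 : Real.exp (-U (p y + z)) * Real.exp (-(κ * ‖y - (p y + z)‖ ^ 2)) =
        Real.exp (-U (p y)) * Real.exp (-(κ * ‖y - p y‖ ^ 2)) *
          (Real.exp (-(κ * ‖z‖ ^ 2)) * s z) := by
      rw [hs, e1, ← Real.exp_add, ← Real.exp_add, ← Real.exp_add, ← Real.exp_add]
      congr 1
      ring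
    simp only [hq, hk, ha]
    rw [div_mul_div_comm, e2]
    field_simp
  have hswap : ∀ {G : Type} [NormedAddCommGroup G] [NormedSpace ℝ G] (f : E → G),
      ∫ x, (q x * k (y - x)) • f x = a • ∫ z, s z • f (p y + z) ∂γ := by
    intro G _ _ f
    rw [← integral_add_left_eq_self _ (p y)]
    simp only [hqk]
    rw [hγ, gaussTilt, integral_tilted, ← integral_smul]
    refine integral_congr_ae (ae_of_all _ fun z => ?_)
    simp only [smul_smul, hk]
  have hsw1 := hswap (fun x => Ψ x y)
  have hsw2 := hswap (fun _ => (1 : ℝ))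
  simp only [smul_eq_mul, mul_one] at hsw2
  rw [hsw1, hsw2, norm_smul, Real.norm_eq_abs, abs_of_nonneg ha0]
  have hFc : Continuous fun z => v (p y) - v (p y + z) :=
    continuous_const.sub (hvc.comp (continuous_const.add continuous_id))
  have hkey := norm_integral_weight_smul_sub_le h1 (hpow 2) (hpow 3) hFc hL hb
    (fun z => by simpa using hv (p y) (p y + z)) (s := s)
    (Real.continuous_exp.comp (((hUc.comp (continuous_const.add continuous_id)).sub
      continuous_const).sub (continuous_const.mul (continuous_const.inner continuous_id))).neg)
    (fun z => (Real.exp_pos _).le) (fun z => Real.exp_le_one_iff.2 (by linarith [hr0 y z]))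
    (fun z => by
      refine le_trans ?_ (Real.one_sub_le_exp_neg _)
      linarith [hr1 y z]) hsmall
  have hF : ∫ z, (v (p y) - v (p y + z)) ∂γ = v (p y) - w (p y) := by
    have h3 : Integrable (fun z => v (p y + z)) γ :=
      integrable_of_norm_sub_le (L := L) h1 fun g g' => by simpa using hv (p y + g) (p y + g')
    rw [integral_sub (integrable_const _) h3]
    simp [hw]
  -- For fixed y, Ψ is F minus its Gaussian mean; this is why w averages v around p y.
  have hΨF : ∀ z, Ψ (p y + z) y = (v (p y) - v (p y + z)) - (v (p y) - w (p y)) := by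
    intro z
    simp only [hΨ]
    ring
  rw [hF] at hkey
  simp only [hΨF]
  refine (mul_le_mul_of_nonneg_left hkey ha0).trans (le_of_eq ?_)
  ring

end ProximalStep

/-! ### The Gibbs measure and the symmetric splitting step -/

section Gibbs

variable {m N : ℕ} {c C K : ℝ} {V : SATuple m N → ℝ} {u v : SATuple m N → ℂ}

theorem Lip2.norm_sub_le (hu : Lip2 K u) (hN : 1 ≤ N) (hK : 0 ≤ K) (x y : SATuple m N) :
    ‖u x - u y‖ ≤ K * ‖x - y‖ :=
  (hu x y).trans (mul_le_mul_of_nonneg_left (norm2_mat_le_norm hN _) hK)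

theorem sq_mul_inner_gradient (V : SATuple m N → ℝ) (x z : SATuple m N) :
    (N : ℝ) ^ 2 * inner ℝ (gradient V x) z = N * inner ℝ (normGrad V x) z := by
  rw [normGrad, real_inner_smul_left]
  ring

namespace UnifConvex

theorem continuous (hV : UnifConvex c C V) : Continuous V :=
  continuous_iff_continuousAt.2 fun x =>
    (hV.mem.quadraticBounds.hasGradientAt x).differentiableAt.continuousAt

theorem quadratic_lower (hV : UnifConvex c C V) (x z : SATuple m N) :
    N * inner ℝ (normGrad V x) z + c * N / 2 * ‖z‖ ^ 2 ≤
      (N : ℝ) ^ 2 * V (x + z) - (N : ℝ) ^ 2 * V x := by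
  have hN' : (0 : ℝ) < N := by exact_mod_cast hV.one_le
  have h := mul_le_mul_of_nonneg_left (hV.mem.quadraticBounds.lower x (x + z))
    (by positivity : (0 : ℝ) ≤ (N : ℝ) ^ 2)
  rw [add_sub_cancel_left] at h
  have e : (N : ℝ) ^ 2 * (c / N / 2 * ‖z‖ ^ 2) = c * N / 2 * ‖z‖ ^ 2 := by field_simp
  rw [← sq_mul_inner_gradient, ← e]
  linarith

theorem quadratic_upper (hV : UnifConvex c C V) (x z : SATuple m N) :
    (N : ℝ) ^ 2 * V (x + z) - (N : ℝ) ^ 2 * V x ≤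
      N * inner ℝ (normGrad V x) z + C * N / 2 * ‖z‖ ^ 2 := by
  have hN' : (0 : ℝ) < N := by exact_mod_cast hV.one_le
  have h := mul_le_mul_of_nonneg_left (hV.mem.quadraticBounds.upper x (x + z))
    (by positivity : (0 : ℝ) ≤ (N : ℝ) ^ 2)
  rw [add_sub_cancel_left] at h
  have e : (N : ℝ) ^ 2 * (C / N / 2 * ‖z‖ ^ 2) = C * N / 2 * ‖z‖ ^ 2 := by field_simp
  rw [← sq_mul_inner_gradient, ← e]
  linarith

/-- The lower quadratic bound at 0 dominates the density by a Gaussian with a linear term. -/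
theorem integrable_exp_neg_mul_exp_norm (hV : UnifConvex c C V) (β : ℝ) :
    Integrable fun x : SATuple m N => Real.exp (-((N : ℝ) ^ 2 * V x)) * Real.exp (β * ‖x‖) := by
  have hN' : (0 : ℝ) < N := by exact_mod_cast hV.one_le
  have hc := hV.pos
  have hVc := hV.continuous
  refine ((integrable_exp_mul_norm_mul_gaussian (E := SATuple m N) (κ := c * N / 2) (by positivity)
    (N * ‖normGrad V 0‖ + β)).const_mul (Real.exp (-((N : ℝ) ^ 2 * V 0)))).mono'
    (by fun_prop) (ae_of_all _ fun x => ?_)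
  rw [Real.norm_eq_abs, abs_of_pos (by positivity), ← Real.exp_add, ← Real.exp_add, ← Real.exp_add]
  refine Real.exp_le_exp.2 ?_
  have h1 := hV.quadratic_lower 0 x
  rw [zero_add] at h1
  have h2 := mul_le_mul_of_nonneg_left
    (abs_le.1 (abs_real_inner_le_norm (normGrad V 0) x)).1 hN'.le
  linarith

theorem integrable_exp_neg (hV : UnifConvex c C V) :
    Integrable fun x : SATuple m N => Real.exp (-((N : ℝ) ^ 2 * V x)) := by
  simpa using hV.integrable_exp_neg_mul_exp_norm 0

theorem isProbabilityMeasure_gibbs (hV : UnifConvex c C V) : IsProbabilityMeasure (gibbs V) :=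
  isProbabilityMeasure_tilted hV.integrable_exp_neg

theorem integrable_norm_gibbs (hV : UnifConvex c C V) : Integrable (fun x => ‖x‖) (gibbs V) := by
  have hVc := hV.continuous
  rw [gibbs, integrable_tilted_iff hV.integrable_exp_neg]
  refine (hV.integrable_exp_neg_mul_exp_norm 1).mono'
    ((by fun_prop : Continuous fun x : SATuple m N =>
      Real.exp (-((N : ℝ) ^ 2 * V x)) • ‖x‖).aestronglyMeasurable) (ae_of_all _ fun x => ?_)
  rw [norm_smul, norm_norm, Real.norm_eq_abs, abs_of_pos (Real.exp_pos _), one_mul]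
  exact mul_le_mul_of_nonneg_left (norm_le_exp_norm x) (Real.exp_pos _).le

theorem integrable_gibbs (hV : UnifConvex c C V) (hu : Lip2 K u) (hK : 0 ≤ K) :
    Integrable u (gibbs V) := by
  have := hV.isProbabilityMeasure_gibbs
  exact integrable_of_norm_sub_le hV.integrable_norm_gibbs (hu.norm_sub_le hV.one_le hK)

theorem inner_normGrad_sub_nonneg (hV : UnifConvex c C V) (x y : SATuple m N) :
    0 ≤ inner ℝ (normGrad V x - normGrad V y) (x - y) :=
  le_trans (mul_nonneg hV.pos.le (by positivity)) (hV.monotone x y)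

/-- p is the resolvent (1 + h DV)⁻¹: it exists because x ↦ y - h DV(x) contracts when hC ≤ 1/2, and
it is nonexpansive because DV is monotone. -/
theorem exists_proximal (hV : UnifConvex c C V) {h : ℝ} (hh : 0 < h) (hC : h * C ≤ 1 / 2) :
    ∃ p : SATuple m N → SATuple m N, (∀ y, p y + h • normGrad V (p y) = y) ∧
      ∀ x y, ‖p x - p y‖ ≤ ‖x - y‖ := by
  have hC0 := hV.C_pos
  have hfix : ∀ y : SATuple m N, ∃ p, p + h • normGrad V p = y := by
    intro y
    have hc : ContractingWith (1 / 2) fun x => y - h • normGrad V x := by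
      refine ⟨by
        rw [← NNReal.coe_lt_coe]
        norm_num, LipschitzWith.of_dist_le_mul fun x x' => ?_⟩
      rw [dist_eq_norm, dist_eq_norm, sub_sub_sub_cancel_left, ← smul_sub, norm_smul,
        Real.norm_eq_abs, abs_of_pos hh, norm_sub_rev]
      have h1 := mul_le_mul_of_nonneg_left (hV.lipschitz x x') hh.le
      have h2 := mul_le_mul_of_nonneg_right hC (norm_nonneg (x - x'))
      push_cast
      linarith
    refine ⟨hc.fixedPoint _, ?_⟩
    have := hc.fixedPoint_isFixedPt
    rw [Function.IsFixedPt] at this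
    nth_rewrite 1 [← this]
    exact sub_add_cancel _ _
  choose p hp using hfix
  refine ⟨p, hp, fun x y => ?_⟩
  have h1 := hV.inner_normGrad_sub_nonneg (p x) (p y)
  have h2 : x - y = (p x - p y) + h • (normGrad V (p x) - normGrad V (p y)) := by
    conv_lhs => rw [← hp x, ← hp y]
    rw [smul_sub]
    abel
  have h3 : ‖p x - p y‖ ^ 2 ≤ inner ℝ (x - y) (p x - p y) := by
    rw [h2, inner_add_left, real_inner_self_eq_norm_sq, real_inner_smul_left]
    linarith [mul_nonneg hh.le h1]
  have h4 := h3.trans (real_inner_le_norm _ _)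
  by_contra! h5
  nlinarith [norm_nonneg (x - y)]

/-- Flow and resolvent both agree with the explicit step y - h DV(y) up to O(h²), with constants
C(2h)²/4 = Ch² and 2Ch². The time is 2h because the drift of the flow is DV/2. -/
theorem norm_gradFlow_sub_proximal_le (hV : UnifConvex c C V) {h : ℝ} (hh : 0 < h)
    (hC : h * C ≤ 1 / 2) {y p : SATuple m N} (hp : p + h • normGrad V p = y) :
    ‖gradFlow V y (2 * h) - p‖ ≤ 3 * C * h ^ 2 * ‖normGrad V y‖ := by
  have hC0 := hV.C_pos
  have h1 := hV.norm_gradFlow_sub_euler_le y (by positivity : 0 ≤ 2 * h)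
  rw [mul_div_cancel_left₀ h two_ne_zero] at h1
  have e1 : y - p = h • normGrad V p := by rw [← hp, add_sub_cancel_left]
  have h2 : ‖y - p‖ = h * ‖normGrad V p‖ := by
    rw [e1, norm_smul, Real.norm_eq_abs, abs_of_pos hh]
  have h3 : ‖normGrad V p‖ ≤ 2 * ‖normGrad V y‖ := by
    have h4 := hV.lipschitz p y
    rw [norm_sub_rev p y, h2] at h4
    have h5 := norm_add_le (normGrad V p - normGrad V y) (normGrad V y)
    rw [sub_add_cancel] at h5
    nlinarith [norm_nonneg (normGrad V p)]
  have h6 : ‖(y - h • normGrad V y) - p‖ ≤ 2 * C * h ^ 2 * ‖normGrad V y‖ := by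
    have e2 : (y - h • normGrad V y) - p = h • (normGrad V p - normGrad V y) := by
      rw [smul_sub, ← e1]
      abel
    have h4 := hV.lipschitz p y
    rw [norm_sub_rev p y, h2] at h4
    rw [e2, norm_smul, Real.norm_eq_abs, abs_of_pos hh]
    calc h * ‖normGrad V p - normGrad V y‖ ≤ h * (C * (h * (2 * ‖normGrad V y‖))) := by
          refine mul_le_mul_of_nonneg_left (h4.trans ?_) hh.le
          exact mul_le_mul_of_nonneg_left (mul_le_mul_of_nonneg_left h3 hh.le) hC0.le
      _ = _ := by ring
  have h7 := norm_add_le (gradFlow V y (2 * h) - (y - h • normGrad V y))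
    ((y - h • normGrad V y) - p)
  rw [sub_add_sub_cancel] at h7
  nlinarith

end UnifConvex

theorem integral_norm_pow_gue_eq (hN : 1 ≤ N) {t : ℝ} (ht : 0 < t) (k : ℕ) :
    ∫ y : SATuple m N, ‖y‖ ^ k ∂(gue m N t) =
      Real.sqrt t ^ k * ∫ y : SATuple m N, ‖y‖ ^ k ∂(gue m N 1) := by
  rw [← map_sqrt_smul_gue hN ht, integral_map (by fun_prop) (by fun_prop), ← integral_const_mul]
  simp only [norm_smul, mul_pow, Real.norm_eq_abs, abs_of_nonneg (Real.sqrt_nonneg t)]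

/-- The symmetric splitting step `P_h S_{2h} P_h`. -/
def symmetricStep (V : SATuple m N → ℝ) (h : ℝ) (u : SATuple m N → ℂ) : SATuple m N → ℂ :=
  heatSemigroup h (detSemigroup V (2 * h) (heatSemigroup h u))

theorem Lip2.symmetricStep (hu : Lip2 K u) (hK : 0 ≤ K) (hV : UnifConvex c C V) {h : ℝ}
    (hh : 0 < h) : Lip2 K (symmetricStep V h u) :=
  ((hu.heat hV.one_le hK hh).det hK hV (by positivity)).heat hV.one_le hK hh

theorem Lip2.symmetricStep_iterate (hu : Lip2 K u) (hK : 0 ≤ K) (hV : UnifConvex c C V) {h : ℝ}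
    (hh : 0 < h) (n : ℕ) : Lip2 K ((_root_.symmetricStep V h)^[n] u) := by
  induction n with
  | zero => simpa using hu
  | succ n ih =>
    rw [Function.iterate_succ_apply']
    exact ih.symmetricStep hK hV hh

/-- The Gibbs measure is invariant under the symmetric splitting step up to an error of order
`h^{3/2}`, uniformly over Lipschitz functions. -/
theorem exists_norm_integral_symmetricStep_sub_le (hV : UnifConvex c C V) (hK : 0 ≤ K) :
    ∃ A : ℝ, ∀ᶠ h in 𝓝[>] (0 : ℝ), ∀ v : SATuple m N → ℂ, Lip2 K v →
      ‖∫ x, symmetricStep V h v x ∂(gibbs V) - ∫ x, v x ∂(gibbs V)‖ ≤ A * (h * Real.sqrt h) := by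
  have hN := hV.one_le
  have hN' : (0 : ℝ) < N := by exact_mod_cast hN
  have hC0 := hV.C_pos
  have hμp := hV.isProbabilityMeasure_gibbs
  set b : ℝ := C * N / 2 with hb
  have hb0 : 0 < b := by positivity
  set M₁ := ∫ y : SATuple m N, ‖y‖ ∂(gue m N 1) with hM₁
  set M₂ := ∫ y : SATuple m N, ‖y‖ ^ 2 ∂(gue m N 1) with hM₂
  set M₃ := ∫ y : SATuple m N, ‖y‖ ^ 3 ∂(gue m N 1) with hM₃
  set Mμ := ∫ x, ‖x‖ ∂(gibbs V) with hMμ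
  have hM₁0 : 0 ≤ M₁ := integral_nonneg fun _ => norm_nonneg _
  have hM₂0 : 0 ≤ M₂ := integral_nonneg fun _ => by positivity
  have hMμ0 : 0 ≤ Mμ := integral_nonneg fun _ => norm_nonneg _
  -- This constant may depend on N: here h → 0 with N fixed.
  refine ⟨2 * (K * b * (M₃ + M₁ * M₂)) + K * (3 * C * (‖normGrad V 0‖ + C * Mμ + C * M₁)), ?_⟩
  have hev : ∀ r > (0 : ℝ), ∀ᶠ h in 𝓝[>] (0 : ℝ), h ≤ r := fun r hr =>
    mem_nhdsWithin_of_mem_nhds (Iic_mem_nhds hr)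
  filter_upwards [self_mem_nhdsWithin, hev 1 one_pos, hev (1 / (2 * C)) (by positivity),
    hev (1 / (2 * b * M₂ + 1)) (by positivity)] with h hh h1 hhC hhb v hv
  rw [Set.mem_Ioi] at hh
  have hhC' : h * C ≤ 1 / 2 := by
    rw [le_div_iff₀ (by positivity)] at hhC
    linarith
  have hγp := isProbabilityMeasure_gue (m := m) hN hh
  have m1 : ∫ y : SATuple m N, ‖y‖ ∂(gue m N h) = Real.sqrt h * M₁ := by
    simpa using integral_norm_pow_gue_eq (m := m) hN hh 1
  have m2 : ∫ y : SATuple m N, ‖y‖ ^ 2 ∂(gue m N h) = h * M₂ := by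
    rw [integral_norm_pow_gue_eq hN hh 2, Real.sq_sqrt hh.le]
  have m3 : ∫ y : SATuple m N, ‖y‖ ^ 3 ∂(gue m N h) = h * Real.sqrt h * M₃ := by
    rw [integral_norm_pow_gue_eq hN hh 3, pow_succ, Real.sq_sqrt hh.le]
  have hsqrt : Real.sqrt h ≤ 1 := Real.sqrt_le_one.2 h1
  have hgi : Integrable (fun g : SATuple m N => ‖g‖) (gue m N h) := by
    simpa using integrable_norm_pow_gue (m := m) hN hh 1
  obtain ⟨p, hp, hpL⟩ := hV.exists_proximal hh hhC'
  have hyp : ∀ y, y - p y = h • normGrad V (p y) := by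
    intro y
    nth_rewrite 1 [← hp y]
    rw [add_sub_cancel_left]
  -- With κ = N/(2h), the relation y - p y = h DV(p y) reads 2κ(y - p y) = N² ∇V(p y), the
  -- first-order condition for the proximal point.
  have hin : ∀ y z, 2 * ((N : ℝ) / (2 * h)) * inner ℝ (y - p y) z =
      N * inner ℝ (normGrad V (p y)) z := by
    intro y z
    rw [hyp, real_inner_smul_left]
    field_simp
  set w := heatSemigroup h v with hw
  have hwL : Lip2 K w := hv.heat hN hK hh
  have hprox : ‖∫ x, ∫ g, w (p (x + g)) ∂(gue m N h) ∂(gibbs V) - ∫ x, v x ∂(gibbs V)‖ ≤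
      2 * (K * b * (M₃ + M₁ * M₂)) * (h * Real.sqrt h) := by
    have hk := norm_integral_proximal_step_sub_le (U := fun x => (N : ℝ) ^ 2 * V x)
      (continuous_const.mul hV.continuous) (gue_rate_pos hN hh) hb0.le hK hV.integrable_exp_neg
      hV.integrable_norm_gibbs hpL
      (fun y z => by
        rw [hin]
        have := hV.quadratic_lower (p y) z
        have h2 : 0 ≤ c * N / 2 * ‖z‖ ^ 2 := by have := hV.pos; positivity
        linarith)
      (fun y z => by
        rw [hin]
        exact hV.quadratic_upper (p y) z)
      (hv.norm_sub_le hN hK)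
      (by
        rw [← gue_eq_gaussTilt, m2]
        rw [le_div_iff₀ (by positivity)] at hhb
        nlinarith)
    rw [← gue_eq_gaussTilt, m1, m2, m3] at hk
    refine hk.trans (le_of_eq ?_)
    ring
  -- Exchanging the proximal point for the flow costs O(h²), with linear growth in x and g, both of
  -- which have first moments.
  have hD : ∀ x g, ‖w (gradFlow V (x + g) (2 * h)) - w (p (x + g))‖ ≤
      K * (3 * C * h ^ 2) * (‖normGrad V 0‖ + C * ‖x‖) + K * (3 * C * h ^ 2) * C * ‖g‖ := by
    intro x g
    have h2 := hV.norm_gradFlow_sub_proximal_le hh hhC' (hp (x + g))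
    have h3 : ‖normGrad V (x + g)‖ ≤ ‖normGrad V 0‖ + C * (‖x‖ + ‖g‖) := by
      have h4 := hV.lipschitz (x + g) 0
      have h5 := norm_add_le (normGrad V (x + g) - normGrad V 0) (normGrad V 0)
      rw [sub_add_cancel] at h5
      rw [sub_zero] at h4
      have h6 := mul_le_mul_of_nonneg_left (norm_add_le x g) hC0.le
      linarith
    have h4 : 0 ≤ 3 * C * h ^ 2 := by positivity
    calc _ ≤ K * ‖gradFlow V (x + g) (2 * h) - p (x + g)‖ := hwL.norm_sub_le hN hK _ _
      _ ≤ K * (3 * C * h ^ 2 * (‖normGrad V 0‖ + C * (‖x‖ + ‖g‖))) :=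
        mul_le_mul_of_nonneg_left (h2.trans (mul_le_mul_of_nonneg_left h3 h4)) hK
      _ = _ := by ring
  have hSL : Lip2 K (detSemigroup V (2 * h) w) := hwL.det hK hV (by positivity)
  have hpwL : ∀ x y, ‖w (p x) - w (p y)‖ ≤ K * ‖x - y‖ := fun x y =>
    (hwL.norm_sub_le hN hK _ _).trans (mul_le_mul_of_nonneg_left (hpL x y) hK)
  have i1 : ∀ x, Integrable (fun g => w (p (x + g))) (gue m N h) := fun x =>
    integrable_of_norm_sub_le (L := K) hgi fun g g' => by simpa using hpwL (x + g) (x + g')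
  have i2 : Integrable (fun x => ∫ g, w (p (x + g)) ∂(gue m N h)) (gibbs V) :=
    integrable_of_norm_sub_le hV.integrable_norm_gibbs (norm_integral_add_sub_le hgi hpwL)
  have i3 := hV.integrable_gibbs (hv.symmetricStep hK hV hh) hK
  have hstep : ∀ x, ‖symmetricStep V h v x - ∫ g, w (p (x + g)) ∂(gue m N h)‖ ≤
      K * (3 * C * h ^ 2) * (‖normGrad V 0‖ + C * M₁) + K * (3 * C * h ^ 2) * C * ‖x‖ := by
    intro x
    have e : symmetricStep V h v x - ∫ g, w (p (x + g)) ∂(gue m N h) =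
        ∫ g, (w (gradFlow V (x + g) (2 * h)) - w (p (x + g))) ∂(gue m N h) :=
      (integral_sub (hSL.integrable_gue hN hK hh x) (i1 x)).symm
    rw [e]
    refine (norm_integral_le_of_norm_le ((integrable_const _).add (hgi.const_mul _))
      (ae_of_all _ (hD x))).trans ?_
    simp only [Pi.add_apply]
    rw [integral_add (integrable_const _) (hgi.const_mul _),
      integral_const_mul (K * (3 * C * h ^ 2) * C), m1]
    simp only [integral_const, probReal_univ, one_smul]
    have h2 : Real.sqrt h * M₁ ≤ M₁ := mul_le_of_le_one_left hM₁0 hsqrt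
    have h3 : 0 ≤ K * (3 * C * h ^ 2) * C := by positivity
    nlinarith [mul_le_mul_of_nonneg_left h2 h3]
  have hdiff : ‖∫ x, symmetricStep V h v x ∂(gibbs V) -
      ∫ x, ∫ g, w (p (x + g)) ∂(gue m N h) ∂(gibbs V)‖ ≤
      K * (3 * C * (‖normGrad V 0‖ + C * Mμ + C * M₁)) * h ^ 2 := by
    rw [← integral_sub i3 i2]
    refine (norm_integral_le_of_norm_le ((integrable_const _).add
      (hV.integrable_norm_gibbs.const_mul _)) (ae_of_all _ hstep)).trans (le_of_eq ?_)
    simp only [Pi.add_apply]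
    rw [integral_add (integrable_const _) (hV.integrable_norm_gibbs.const_mul _),
      integral_const_mul (K * (3 * C * h ^ 2) * C)]
    simp only [integral_const, probReal_univ, one_smul]
    ring
  have hsq : h ^ 2 ≤ h * Real.sqrt h := by
    have : h ≤ Real.sqrt h := Real.le_sqrt_of_sq_le (by nlinarith)
    nlinarith
  have h5 : 0 ≤ K * (3 * C * (‖normGrad V 0‖ + C * Mμ + C * M₁)) := by positivity
  have h6 := norm_add_le (∫ x, symmetricStep V h v x ∂(gibbs V) -
    ∫ x, ∫ g, w (p (x + g)) ∂(gue m N h) ∂(gibbs V))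
    (∫ x, ∫ g, w (p (x + g)) ∂(gue m N h) ∂(gibbs V) - ∫ x, v x ∂(gibbs V))
  rw [sub_add_sub_cancel] at h6
  have h7 := mul_le_mul_of_nonneg_left hsq h5
  rw [add_mul]
  linarith

end Gibbs

/-! ### Invariance of the Gibbs measure and convergence to equilibrium -/

section Invariance

variable {m N : ℕ} {c C K : ℝ} {V : SATuple m N → ℝ} {u v : SATuple m N → ℂ}

/-- Regrouping of P_h (P_h S_{2h} P_h)^n, using P_h P_h = P_{2h}. -/
theorem heatSemigroup_symmetricStep_iterate (hu : Lip2 K u) (hK : 0 ≤ K) (hV : UnifConvex c C V)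
    {h : ℝ} (hh : 0 < h) (n : ℕ) : heatSemigroup h ((symmetricStep V h)^[n] u) =
      (trotterStep V (2 * h))^[n] (heatSemigroup h u) := by
  induction n with
  | zero => rfl
  | succ n ih =>
    have hL := hu.symmetricStep_iterate hK hV hh n
    rw [Function.iterate_succ_apply', Function.iterate_succ_apply', ← ih, trotterStep]
    generalize (symmetricStep V h)^[n] u = w at hL
    rw [symmetricStep, two_mul, heatSemigroup_add ((hL.heat hV.one_le hK hh).det hK hV
      (by positivity)) hV.one_le hK hh hh]

theorem norm_trotterStep_iterate_sub_le (hu : Lip2 K u) (hv : Lip2 K v) (hK : 0 ≤ K)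
    (hV : UnifConvex c C V) {h : ℝ} (hh : 0 < h) {δ : ℝ} (hδ : ∀ x, ‖u x - v x‖ ≤ δ) (n : ℕ)
    (x : SATuple m N) : ‖(trotterStep V h)^[n] u x - (trotterStep V h)^[n] v x‖ ≤ δ := by
  induction n generalizing x with
  | zero => exact hδ x
  | succ n ih =>
    rw [Function.iterate_succ_apply', Function.iterate_succ_apply']
    exact norm_trotterStep_sub_le (hu.trotterStep_iterate hK hV hh n)
      (hv.trotterStep_iterate hK hV hh n) hK hV hh ih x

/-- The two schemes differ by one factor P_h at each end, each costing K√(mh) whatever n is. -/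
theorem norm_symmetricStep_iterate_sub_le (hu : Lip2 K u) (hK : 0 ≤ K) (hV : UnifConvex c C V)
    {h : ℝ} (hh : 0 < h) (n : ℕ) (x : SATuple m N) :
    ‖(trotterStep V (2 * h))^[n] u x - (symmetricStep V h)^[n] u x‖ ≤
      2 * (K * Real.sqrt (m * h)) := by
  have hN := hV.one_le
  have hL := hu.symmetricStep_iterate hK hV hh n
  have h1 := norm_heatSemigroup_sub_self_le hL hN hK hh x
  have h2 := norm_trotterStep_iterate_sub_le (hu.heat hN hK hh) hu hK hV
    (by positivity : 0 < 2 * h) (norm_heatSemigroup_sub_self_le hu hN hK hh) n x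
  rw [heatSemigroup_symmetricStep_iterate hu hK hV hh] at h1
  rw [norm_sub_rev] at h2
  have h3 := norm_add_le ((trotterStep V (2 * h))^[n] u x -
    (trotterStep V (2 * h))^[n] (heatSemigroup h u) x)
    ((trotterStep V (2 * h))^[n] (heatSemigroup h u) x - (symmetricStep V h)^[n] u x)
  rw [sub_add_sub_cancel] at h3
  linarith

/-- The one-step defect is uniform over a class of functions that Q preserves, so defects merely add
up. -/
theorem norm_integral_iterate_sub_le {Q : (SATuple m N → ℂ) → SATuple m N → ℂ} {δ : ℝ}
    (hQ : ∀ v, Lip2 K v → Lip2 K (Q v)) {μ : Measure (SATuple m N)}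
    (hδ : ∀ v, Lip2 K v → ‖∫ x, Q v x ∂μ - ∫ x, v x ∂μ‖ ≤ δ) (hu : Lip2 K u) (n : ℕ) :
    ‖∫ x, Q^[n] u x ∂μ - ∫ x, u x ∂μ‖ ≤ n * δ := by
  have hL : ∀ n, Lip2 K (Q^[n] u) := by
    intro n
    induction n with
    | zero => exact hu
    | succ n ih =>
      rw [Function.iterate_succ_apply']
      exact hQ _ ih
  induction n with
  | zero => simp
  | succ n ih =>
    have h1 := hδ _ (hL n)
    rw [← Function.iterate_succ_apply' Q n u] at h1
    have h2 := norm_add_le (∫ x, Q^[n + 1] u x ∂μ - ∫ x, Q^[n] u x ∂μ)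
      (∫ x, Q^[n] u x ∂μ - ∫ x, u x ∂μ)
    rw [sub_add_sub_cancel] at h2
    push_cast
    linarith

theorem Lip2.langevinApprox (hu : Lip2 K u) (hK : 0 ≤ K) (hV : UnifConvex c C V) (l : ℕ) (t : ℝ) :
    Lip2 K (langevinApprox V l t u) :=
  hu.trotterStep_iterate hK hV (by positivity) _

theorem Lip2.langevinDyadic (hu : Lip2 K u) (hK : 0 ≤ K) (hV : UnifConvex c C V) {t : ℝ}
    (ht : t ∈ dyadics) : Lip2 (K * Real.exp (-(c * t / 2))) (langevinDyadic V t u) := by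
  intro x y
  have h := ((tendsto_langevinApprox hu hK hV ht x).sub
    (tendsto_langevinApprox hu hK hV ht y)).norm
  obtain ⟨k, l₀, rfl⟩ := ht
  refine le_of_tendsto h ?_
  filter_upwards [eventually_ge_atTop l₀] with l hl
  have h1 := hu.trotterStep_iterate_exp hK hV (h := ((2 : ℝ) ^ l)⁻¹) (by positivity)
    (k * 2 ^ (l - l₀)) x y
  rw [_root_.langevinApprox, floor_two_pow_mul_dyadic hl, trotter_eq]
  have e : ((k * 2 ^ (l - l₀) : ℕ) : ℝ) * ((2 : ℝ) ^ l)⁻¹ = (k : ℝ) / 2 ^ l₀ := by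
    obtain ⟨d, rfl⟩ := Nat.exists_eq_add_of_le hl
    rw [Nat.add_sub_cancel_left]
    push_cast
    rw [pow_add]
    field_simp
  rwa [e] at h1

/-- The Gibbs measure is invariant under the Langevin semigroup at dyadic times. -/
theorem integral_langevinDyadic (hu : Lip2 K u) (hK : 0 ≤ K) (hV : UnifConvex c C V) {t : ℝ}
    (ht : t ∈ dyadics) : ∫ x, langevinDyadic V t u x ∂(gibbs V) = ∫ x, u x ∂(gibbs V) := by
  have hμ := hV.isProbabilityMeasure_gibbs
  have hc := hV.pos
  have hLt := hu.langevinDyadic hK hV ht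
  obtain ⟨A, hA⟩ := exists_norm_integral_symmetricStep_sub_le hV hK
  obtain ⟨k, l₀, rfl⟩ := ht
  set r := Real.sqrt (1 / 2) with hr
  have hr1 := sqrt_half_lt_one
  set B := trotterRate m C K ((k : ℝ) / 2 ^ l₀) / (1 - r) with hB
  -- Half of the dyadic step, because P_h S_{2h} P_h corresponds to a splitting step 2h. For l ≥ l₀
  -- the product nh is then constant and the accumulated defect n h^{3/2} tends to 0.
  set h : ℕ → ℝ := fun l => ((2 : ℝ) ^ l)⁻¹ / 2 with hh
  have hh0 : ∀ l, 0 < h l := fun l => by positivity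
  have hlim2 : Tendsto h atTop (𝓝 0) := by
    have h1 : Tendsto (fun l : ℕ => (1 / 2 : ℝ) ^ l) atTop (𝓝 0) :=
      tendsto_pow_atTop_nhds_zero_of_lt_one (by norm_num) (by norm_num)
    have h2 := h1.div_const 2
    rw [zero_div] at h2
    refine h2.congr fun l => ?_
    simp only [hh, one_div, inv_pow]
  have hlim3 : Tendsto h atTop (𝓝[>] 0) :=
    tendsto_nhdsWithin_iff.2 ⟨hlim2, Eventually.of_forall hh0⟩
  have hbound : ∀ᶠ l in atTop,
      ‖∫ x, langevinDyadic V ((k : ℝ) / 2 ^ l₀) u x ∂(gibbs V) - ∫ x, u x ∂(gibbs V)‖ ≤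
        B * r ^ l + (2 * (K * Real.sqrt (m * h l)) +
          (k : ℝ) / 2 ^ l₀ / 2 * A * Real.sqrt (h l)) := by
    filter_upwards [eventually_ge_atTop l₀, hlim3.eventually hA] with l hl hAl
    set n := k * 2 ^ (l - l₀) with hn
    have e2 : 2 * h l = ((2 : ℝ) ^ l)⁻¹ := by simp only [hh]; ring
    have hnh : (n : ℝ) * h l = (k : ℝ) / 2 ^ l₀ / 2 := by
      obtain ⟨d, rfl⟩ := Nat.exists_eq_add_of_le hl
      rw [hn, Nat.add_sub_cancel_left]
      simp only [hh]
      push_cast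
      rw [pow_add]
      field_simp
    have eL : langevinApprox V l ((k : ℝ) / 2 ^ l₀) u = (trotterStep V (2 * h l))^[n] u := by
      rw [langevinApprox, floor_two_pow_mul_dyadic hl, trotter_eq, e2]
    have h1 : ‖∫ x, langevinDyadic V ((k : ℝ) / 2 ^ l₀) u x ∂(gibbs V) -
        ∫ x, langevinApprox V l ((k : ℝ) / 2 ^ l₀) u x ∂(gibbs V)‖ ≤ B * r ^ l := by
      rw [← integral_sub (hV.integrable_gibbs hLt (by positivity))
        (hV.integrable_gibbs (hu.langevinApprox hK hV _ _) hK)]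
      refine (norm_integral_le_of_norm_le_const (ae_of_all _ fun x => ?_)).trans
        (le_of_eq (by rw [probReal_univ, mul_one]))
      rw [norm_sub_rev]
      exact norm_langevinApprox_sub_langevinDyadic_le hu hK hV hl x
    have h2 : ‖∫ x, langevinApprox V l ((k : ℝ) / 2 ^ l₀) u x ∂(gibbs V) -
        ∫ x, (symmetricStep V (h l))^[n] u x ∂(gibbs V)‖ ≤ 2 * (K * Real.sqrt (m * h l)) := by
      rw [← integral_sub (hV.integrable_gibbs (hu.langevinApprox hK hV _ _) hK)
        (hV.integrable_gibbs (hu.symmetricStep_iterate hK hV (hh0 l) n) hK)]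
      refine (norm_integral_le_of_norm_le_const (ae_of_all _ fun x => ?_)).trans
        (le_of_eq (by rw [probReal_univ, mul_one]))
      rw [eL]
      exact norm_symmetricStep_iterate_sub_le hu hK hV (hh0 l) n x
    have h3 := norm_integral_iterate_sub_le (fun v hv => hv.symmetricStep hK hV (hh0 l)) hAl hu n
    have e3 : (n : ℝ) * (A * (h l * Real.sqrt (h l))) =
        (k : ℝ) / 2 ^ l₀ / 2 * A * Real.sqrt (h l) := by
      rw [← hnh]
      ring
    rw [e3] at h3
    have h4 := norm_add₃_le (a := ∫ x, langevinDyadic V ((k : ℝ) / 2 ^ l₀) u x ∂(gibbs V) -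
        ∫ x, langevinApprox V l ((k : ℝ) / 2 ^ l₀) u x ∂(gibbs V))
      (b := ∫ x, langevinApprox V l ((k : ℝ) / 2 ^ l₀) u x ∂(gibbs V) -
        ∫ x, (symmetricStep V (h l))^[n] u x ∂(gibbs V))
      (c := ∫ x, (symmetricStep V (h l))^[n] u x ∂(gibbs V) - ∫ x, u x ∂(gibbs V))
    rw [sub_add_sub_cancel, sub_add_sub_cancel] at h4
    linarith
  have hlim : Tendsto (fun l : ℕ => B * r ^ l + (2 * (K * Real.sqrt (m * h l)) +
      (k : ℝ) / 2 ^ l₀ / 2 * A * Real.sqrt (h l))) atTop (𝓝 0) := by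
    have h1 := (tendsto_pow_atTop_nhds_zero_of_lt_one (Real.sqrt_nonneg (1 / 2)) hr1).const_mul B
    have h2 := (((hlim2.const_mul (m : ℝ)).sqrt).const_mul K).const_mul 2
    have h3 := (hlim2.sqrt).const_mul ((k : ℝ) / 2 ^ l₀ / 2 * A)
    have h4 := h1.add (h2.add h3)
    simp only [mul_zero, Real.sqrt_zero, add_zero] at h4
    exact h4
  have := ge_of_tendsto hlim hbound
  exact sub_eq_zero.1 (norm_le_zero_iff.1 this)

theorem integrable_norm2_gibbs (hV : UnifConvex c C V) :
    Integrable (fun x : SATuple m N => norm2 x.mat) (gibbs V) := by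
  refine hV.integrable_norm_gibbs.mono' continuous_norm2_mat.aestronglyMeasurable
    (ae_of_all _ fun x => ?_)
  rw [Real.norm_eq_abs, abs_of_nonneg (norm2_nonneg _)]
  exact norm2_mat_le_norm hV.one_le x

/-- Exponential convergence to equilibrium. -/
theorem norm_langevinDyadic_zero_sub_integral_le (hu : Lip2 K u) (hK : 0 ≤ K)
    (hV : UnifConvex c C V) {t : ℝ} (ht : t ∈ dyadics) :
    ‖langevinDyadic V t u 0 - ∫ x, u x ∂(gibbs V)‖ ≤
      K * Real.exp (-(c * t / 2)) * ∫ x, norm2 x.mat ∂(gibbs V) := by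
  have hμ := hV.isProbabilityMeasure_gibbs
  have hL := hu.langevinDyadic hK hV ht
  have e : langevinDyadic V t u 0 - ∫ x, u x ∂(gibbs V) =
      ∫ x, (langevinDyadic V t u 0 - langevinDyadic V t u x) ∂(gibbs V) := by
    rw [integral_sub (integrable_const _) (hV.integrable_gibbs hL (by positivity)),
      integral_langevinDyadic hu hK hV ht]
    simp
  rw [e, ← integral_const_mul]
  refine norm_integral_le_of_norm_le ((integrable_norm2_gibbs hV).const_mul _)
    (ae_of_all _ fun x => ?_)
  have h1 := hL 0 x
  rwa [SATuple.norm2_mat (0 - x), zero_sub, norm_neg, ← SATuple.norm2_mat] at h1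

theorem lip2_norm2 : Lip2 1 fun x : SATuple m N => ((norm2 x.mat : ℝ) : ℂ) := by
  intro x y
  rw [← Complex.ofReal_sub, Complex.norm_real, one_mul, Real.norm_eq_abs, SATuple.norm2_mat,
    SATuple.norm2_mat, SATuple.norm2_mat, ← mul_sub, abs_mul, abs_of_nonneg (by positivity)]
  exact mul_le_mul_of_nonneg_left (abs_norm_sub_norm_le x y) (by positivity)

theorem langevinDyadic_zero (x : SATuple m N) : langevinDyadic V 0 u x = u x := by
  refine Tendsto.limUnder_eq (tendsto_const_nhds.congr fun l => ?_)
  simp [langevinApprox, trotter]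

/-- The first moment of the Gibbs measure is bounded in terms of `c` and the size of `DV` at `0`. -/
theorem integral_norm2_gibbs_le (hV : UnifConvex c C V) {t : ℝ} (ht : t ∈ dyadics) (ht0 : 0 ≤ t)
    (hct : Real.exp (-(c * t / 2)) ≤ 1 / 2) :
    ∫ x, norm2 x.mat ∂(gibbs V) ≤
      2 * timeModulus m 1 (norm2 (normGrad V (0 : SATuple m N)).mat) t := by
  have hM : 0 ≤ ∫ x, norm2 x.mat ∂(gibbs V) := integral_nonneg fun _ => norm2_nonneg _
  -- Convergence to equilibrium is applied to ‖·‖₂ itself: the moment reappears on the right with a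
  -- factor at most 1/2 and is absorbed.
  have h1 := norm_langevinDyadic_zero_sub_integral_le lip2_norm2 zero_le_one hV ht
  have h2 := norm_langevinDyadic_sub_le lip2_norm2 zero_le_one hV ⟨0, 0, by simp⟩ ht ht0
    (0 : SATuple m N)
  rw [langevinDyadic_zero, SATuple.norm2_mat, norm_zero, mul_zero, Complex.ofReal_zero, sub_zero,
    sub_zero] at h2
  rw [integral_complex_ofReal, one_mul, norm_sub_rev] at h1
  have h3 := norm_sub_norm_le ((∫ x, norm2 x.mat ∂(gibbs V) : ℝ) : ℂ)
    (langevinDyadic V t (fun x : SATuple m N => ((norm2 x.mat : ℝ) : ℂ)) 0)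
  rw [Complex.norm_real, Real.norm_eq_abs, abs_of_nonneg hM] at h3
  have h4 := mul_le_mul_of_nonneg_right hct hM
  linarith

end Invariance

/-! ### Convergence of the expectations -/

section Limit

variable {m : ℕ}

/-- Only the constant term of p survives at 0. -/
theorem exists_evalNC_zero_eq (p : NCPoly m) : ∃ a : ℂ, ∀ N : ℕ,
    evalNC (0 : SATuple m N) p = a • (1 : Matrix (Fin N) (Fin N) ℂ) := by
  induction p using FreeAlgebra.induction with
  | grade0 r => exact ⟨r, fun N => by rw [AlgHom.commutes, Algebra.algebraMap_eq_smul_one]⟩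
  | grade1 j => exact ⟨0, fun N => by rw [evalNC_ι, zero_smul]; rfl⟩
  | mul a b ha hb =>
    obtain ⟨r, hr⟩ := ha
    obtain ⟨s, hs⟩ := hb
    exact ⟨r * s, fun N => by rw [map_mul, hr, hs, smul_mul_smul_comm, one_mul]⟩
  | add a b ha hb =>
    obtain ⟨r, hr⟩ := ha
    obtain ⟨s, hs⟩ := hb
    exact ⟨r + s, fun N => by rw [map_add, hr, hs, add_smul]⟩

/-- The value of a scalar-valued trace polynomial at `0` does not depend on `N`. -/
theorem exists_eval0_zero_eq (f : TrP0 m) : ∃ a : ℂ, ∀ N ≥ 1, eval0 (0 : SATuple m N) f = a := by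
  induction f using TrP0.induction_mk with
  | h0 r => exact ⟨r, fun N _ => by simp⟩
  | h1 p =>
    obtain ⟨a, ha⟩ := exists_evalNC_zero_eq p
    refine ⟨a, fun N hN => ?_⟩
    have : (N : ℂ) ≠ 0 := by exact_mod_cast (by omega : N ≠ 0)
    rw [eval0_ι_mk, ha, map_smul]
    simp [normTrace, this]
  | hm a b ha hb =>
    obtain ⟨r, hr⟩ := ha
    obtain ⟨s, hs⟩ := hb
    exact ⟨r * s, fun N hN => by rw [map_mul, hr N hN, hs N hN]⟩
  | ha a b ha hb =>
    obtain ⟨r, hr⟩ := ha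
    obtain ⟨s, hs⟩ := hb
    exact ⟨r + s, fun N hN => by rw [map_add, hr N hN, hs N hN]⟩

variable {V : ∀ N, SATuple m N → ℝ} {u : ∀ N, SATuple m N → ℂ} {c C K : ℝ}

/-- Approximability bounds ‖DV(0)‖₂ in N, and an integer time n with e^{-cn/2} ≤ 1/2 turns this into
a moment bound. -/
theorem exists_integral_norm2_gibbs_le (hV : ∀ N ≥ 1, UnifConvex c C (V N))
    (hDV : AsympApproxOp fun N x => (normGrad (V N) x).mat) :
    ∃ M : ℝ, 0 ≤ M ∧ ∀ᶠ N in atTop, ∫ x, norm2 x.mat ∂(gibbs (V N)) ≤ M := by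
  have hc : 0 < c := (hV 1 le_rfl).pos
  obtain ⟨B, hB, hbd⟩ := hDV.exists_bound one_pos
  have hlim : Tendsto (fun n : ℕ => Real.exp (-(c * n / 2))) atTop (𝓝 0) :=
    Real.tendsto_exp_neg_atTop_nhds_zero.comp
      ((tendsto_natCast_atTop_atTop.const_mul_atTop hc).atTop_div_const two_pos)
  obtain ⟨n, hn⟩ := (hlim.eventually_le_const (by norm_num : (0 : ℝ) < 1 / 2)).exists
  refine ⟨2 * timeModulus m 1 B n, by rw [timeModulus]; positivity, ?_⟩
  filter_upwards [hbd, eventually_ge_atTop 1] with N h1 hN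
  refine (integral_norm2_gibbs_le (hV N hN) ⟨n, 0, by simp⟩ (Nat.cast_nonneg n) hn).trans ?_
  refine mul_le_mul_of_nonneg_left ?_ zero_le_two
  refine timeModulus_mono zero_le_one (norm2_nonneg _) (h1 0 ?_) (Nat.cast_nonneg n) le_rfl
  exact (normInf_le_norm _).trans (by simp)

/-- Convergence of the expectations of asymptotically approximable functions. -/
theorem exists_tendsto_integral_gibbs (hV : ∀ N ≥ 1, UnifConvex c C (V N))
    (hDV : AsympApproxOp fun N x => (normGrad (V N) x).mat) (hu : AsympApproxScalar u)
    (hK : 0 ≤ K) (hLip : ∀ N ≥ 1, Lip2 K (u N)) :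
    ∃ L : ℂ, Tendsto (fun N => ∫ x, u N x ∂(gibbs (V N))) atTop (𝓝 L) := by
  have hc : 0 < c := (hV 1 le_rfl).pos
  obtain ⟨M, hM, hMb⟩ := exists_integral_norm2_gibbs_le hV hDV
  refine cauchySeq_tendsto_of_complete (Metric.cauchySeq_iff'.2 fun ε hε => ?_)
  have hlim : Tendsto (fun n : ℕ => K * Real.exp (-(c * n / 2)) * M) atTop (𝓝 0) := by
    have := (Real.tendsto_exp_neg_atTop_nhds_zero.comp
      ((tendsto_natCast_atTop_atTop.const_mul_atTop hc).atTop_div_const two_pos)).const_mul K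
    simpa using this.mul_const M
  -- The relaxation time is fixed before N, and is an integer so that dyadic times suffice.
  -- Relaxation and approximation at the origin cost ε/5 each, so two expectations differ by at most
  -- 4ε/5 < ε.
  obtain ⟨n, hn⟩ := (hlim.eventually_le_const (by positivity : 0 < ε / 5)).exists
  have ht : (n : ℝ) ∈ dyadics := ⟨n, 0, by simp⟩
  obtain ⟨f, hf⟩ := asympApproxScalar_iff.1
    (asympApproxScalar_langevinDyadic hV hDV hu hK hLip ht) 1 one_pos (ε / 5) (by positivity)
  obtain ⟨a, ha⟩ := exists_eval0_zero_eq f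
  have hclose : ∀ᶠ N in atTop, ‖∫ x, u N x ∂(gibbs (V N)) - a‖ ≤ 2 * (ε / 5) := by
    filter_upwards [hMb, hf, eventually_ge_atTop 1] with N h1 h2 hN
    have h3 := norm_langevinDyadic_zero_sub_integral_le (hLip N hN) hK (hV N hN) ht
    have h4 := h2 0 ((normInf_le_norm _).trans (by simp))
    rw [ha N hN] at h4
    have h5 : K * Real.exp (-(c * n / 2)) * ∫ x, norm2 x.mat ∂(gibbs (V N)) ≤
        K * Real.exp (-(c * n / 2)) * M := mul_le_mul_of_nonneg_left h1 (by positivity)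
    rw [norm_sub_rev] at h3
    have h6 := norm_add_le (∫ x, u N x ∂(gibbs (V N)) - langevinDyadic (V N) n (u N) 0)
      (langevinDyadic (V N) n (u N) 0 - a)
    rw [sub_add_sub_cancel] at h6
    linarith
  obtain ⟨N₀, hN₀⟩ := eventually_atTop.1 hclose
  refine ⟨N₀, fun N hN => ?_⟩
  have h1 := hN₀ N hN
  have h2 := hN₀ N₀ le_rfl
  rw [norm_sub_rev] at h2
  rw [dist_eq_norm]
  have h6 := norm_add_le (∫ x, u N x ∂(gibbs (V N)) - a) (a - ∫ x, u N₀ x ∂(gibbs (V N₀)))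
  rw [sub_add_sub_cancel] at h6
  linarith

end Limit

theorem mainTheorem8 (m : ℕ) (c C K : ℝ) (hc : 0 < c) (hcC : c ≤ C)
    (V : ∀ N : ℕ, SATuple m N → ℝ) (hV : ∀ N ≥ 1, MemE c C (V N))
    (hDV : AsympApproxOp (fun N x => (normGrad (V N) x).mat))
    (u : ∀ N : ℕ, SATuple m N → ℂ)
    (huLip : ∀ N ≥ 1, ∀ x y : SATuple m N, ‖u N x - u N y‖ ≤ K * norm2 (x - y).mat)
    (hu : AsympApproxScalar u) :
    -- the objects below are well defined for every `N ≥ 1`: the flow, the limits, the measure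
    (∀ N ≥ 1,
      (∀ x, IsGradFlow (V N) x (gradFlow (V N) x) ∧
        ∀ w, IsGradFlow (V N) x w → ∀ t ≥ (0 : ℝ), w t = gradFlow (V N) x t) ∧
      (∀ t ∈ dyadics, ∀ x, Tendsto (fun l : ℕ => langevinApprox (V N) l t (u N) x) atTop
        (𝓝 (langevinDyadic (V N) t (u N) x))) ∧
      (∀ t ≥ (0 : ℝ), ∀ x, Tendsto (fun s => langevinDyadic (V N) s (u N) x) (𝓝[dyadics] t)
        (𝓝 (langevin (V N) t (u N) x))) ∧
      IsProbabilityMeasure (gibbs (V N)) ∧ Integrable (u N) (gibbs (V N))) ∧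
    (∀ t ≥ (0 : ℝ), AsympApproxScalar (fun N => detSemigroup (V N) t (u N))) ∧
    (∀ t ≥ (0 : ℝ), AsympApproxScalar (fun N => langevin (V N) t (u N))) ∧
    ∃ L : ℂ, Tendsto (fun N => ∫ x, u N x ∂(gibbs (V N))) atTop (𝓝 L) := by
  have hV' : ∀ N ≥ 1, UnifConvex c C (V N) := fun N hN => ⟨hN, hc, hcC, hV N hN⟩
  -- Nothing forces K ≥ 0 (take m = 0), but |K| is still a Lipschitz constant.
  have hK : 0 ≤ |K| := abs_nonneg K
  have hLip : ∀ N ≥ 1, Lip2 |K| (u N) := fun N hN => Lip2.mono (huLip N hN) (le_abs_self K)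
  refine ⟨fun N hN => ⟨fun x => ⟨(hV N hN).isGradFlow_gradFlow hN hc hcC x,
      fun w hw t ht => (hV' N hN).gradFlow_unique hw ht⟩,
      fun t ht x => tendsto_langevinApprox (hLip N hN) hK (hV' N hN) ht x,
      fun t ht x => tendsto_langevinDyadic (hLip N hN) hK (hV' N hN) ht x,
      (hV' N hN).isProbabilityMeasure_gibbs, (hV' N hN).integrable_gibbs (hLip N hN) hK⟩,
    fun t ht => asympApproxScalar_detSemigroup hV' hDV hu hK hLip ht,
    fun t ht => asympApproxScalar_langevin hV' hDV hu hK hLip ht,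
    exists_tendsto_integral_gibbs hV' hDV hu hK hLip⟩
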